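/- For a function \(\rho:X\times X\to[0,\infty]\) satisfying the axioms of a metric (infinite values allowed), let \(\rho_\varepsilon(x,y)\) be the infimum of \(\sum_{k=1}^{N}\rho(x_{k-1},x_k)\) over all finite chains \(x=x_0,x_1,\dots,x_N=y\) with \(\rho(x_{k-1},x_k)\le\varepsilon\) for all \(k\), put \(\rho_0=\sup_{\varepsilon>0}\rho_\varepsilon\), and let \(\bar\rho(x,y)\in[0,\infty]\) be the infimum of the \(\rho\)-lengths of the \(\rho\)-continuous paths \([0,1]\to X\) from \(x\) to \(y\) (infima of empty sets are \(\infty\)). For a metric \(d\) put \(d_0^0=d\) and \(d_0^{n+1}=(d_0^n)_0\). Write \(\rho<\rho'\) if \(\rho\le\rho'\) at all pairs of points and \(\rho(x,y)<\rho'(x,y)\) for at least one pair. Let \(Y_1=\{p\}\cup\bigcup_{k\ge2}S_k\subset\ell^\infty\) with the metric \(d\) of the supremum norm, where, with \(e_1,e_2,\dots\) the unit sequences, \[S_k=\{e_1+te_k:0\le t\le1\}\cup\{te_1+e_k:\tfrac1k\le t\le1\}\cup\{\tfrac1ke_1+te_k:0\le t\le1\},\] \(p=0\) and \(q=e_1\).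 Given \(Y_{n-1}\) \((n\ge2)\) with its points \(p,q\), take for every integer \(m\ge1\) disjoint copies \(Z_m^1,\dots,Z_m^m\) of \(Y_{n-1}\) with the metric multiplied by \(\frac1m\), and let \(Y_n\) be obtained by gluing, with the quotient metric \(d\) (the infimum of the lengths of chains each of whose steps is measured inside one copy): the point \(q\) of \(Z_m^j\) to the point \(p\) of \(Z_m^{j+1}\) for \(1\le j<m\); the points \(p\) of all \(Z_m^1\), \(m\ge1\), to a single point, again called \(p\); and the points \(q\) of all \(Z_m^m\), \(m\ge1\), to a single point, again called \(q\). Identify \(Y_{n-1}\) with the copy \(Z_1^1\subset Y_n\), and let \(Y_\infty=\bigcup_{n\ge1}Y_n\), with the metric \(d\) that extends those of the \(Y_n\). Then \((Y_n,d)\), for every \(n\ge1\), and \((Y_\infty,d)\) are complete metric spaces. For every \(n\ge1\), in \(Y_n\) one has \(d_0^n(p,y)=3+\bar d(q,y)\) for all \(y\ne p\), and \(d_0^n(x,y)=\bar d(x,y)\) for all \(x,y\ne p\); in particular \[d<d_0<\dots<d_0^{n-1}<d_0^n<d_0^{n+1}=\bar d\quad\text{in }Y_n.\] In \((Y_\infty,d)\)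 one has \(d_0^n<d_0^{n+1}\) for every \(n\ge0\), and the pointwise limit \(\lim_{n\to\infty}d_0^n\) exists in \([0,\infty]\) and satisfies \(\lim_{n\to\infty}d_0^n<\bar d\). -/

import Mathlib

open scoped ENNReal NNReal

noncomputable section

namespace DiscreteLength

/-! ### Distance functions, and the operations `d ↦ d₀` and `d ↦ d̄`

A (possibly infinite) metric on `X` is a function `ρ : X → X → ℝ≥0∞`.  For two such functions
`ρ < ρ'` is the pointwise order: `ρ ≤ ρ'` everywhere, with strict inequality for at least one
pair. -/

/-- `ρ` is a metric with finite values. -/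
structure IsMetric {X : Type} (ρ : X → X → ℝ≥0∞) : Prop where
  finite : ∀ x y, ρ x y ≠ ∞
  eq_zero_iff : ∀ x y, ρ x y = 0 ↔ x = y
  symm : ∀ x y, ρ x y = ρ y x
  triangle : ∀ x y z, ρ x z ≤ ρ x y + ρ y z

/-- Every `ρ`-Cauchy sequence `ρ`-converges. -/
def IsComplete {X : Type} (ρ : X → X → ℝ≥0∞) : Prop :=
  ∀ u : ℕ → X,
    (∀ ε : ℝ≥0∞, 0 < ε → ∃ N : ℕ, ∀ i ≥ N, ∀ j ≥ N, ρ (u i) (u j) < ε) →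
      ∃ x : X, Filter.Tendsto (fun i => ρ (u i) x) Filter.atTop (nhds 0)

/-- The length of the chain `(c 0, …, c n)`. -/
def chainLength {X : Type} (ρ : X → X → ℝ≥0∞) (n : ℕ) (c : ℕ → X) : ℝ≥0∞ :=
  ∑ k ∈ Finset.range n, ρ (c k) (c (k + 1))

/-- `(c 0, …, c n)` is an `ε`-chain joining `a` to `b`. -/
def IsEpsChain {X : Type} (ρ : X → X → ℝ≥0∞) (ε : ℝ≥0) (a b : X) (n : ℕ) (c : ℕ → X) : Prop :=
  c 0 = a ∧ c n = b ∧ ∀ k < n, ρ (c k) (c (k + 1)) ≤ (ε : ℝ≥0∞)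

/-- `d_ε`: the infimum of the lengths of the `ε`-chains joining two points. -/
def epsDist {X : Type} (ρ : X → X → ℝ≥0∞) (ε : ℝ≥0) (a b : X) : ℝ≥0∞ :=
  ⨅ (n : ℕ) (c : ℕ → X) (_ : IsEpsChain ρ ε a b n c), chainLength ρ n c

/-- `d₀ = sup_{ε > 0} d_ε`. -/
def zeroDist {X : Type} (ρ : X → X → ℝ≥0∞) (a b : X) : ℝ≥0∞ :=
  ⨆ (ε : ℝ≥0) (_ : 0 < ε), epsDist ρ ε a b

/-- The iterates: `d₀⁰ = d` and `d₀ⁿ⁺¹ = (d₀ⁿ)₀`. -/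
def iterDist {X : Type} (ρ : X → X → ℝ≥0∞) : ℕ → X → X → ℝ≥0∞
  | 0 => ρ
  | n + 1 => zeroDist (iterDist ρ n)

/-- `γ : [0,1] → X` is continuous with respect to `ρ`. -/
def IsPath {X : Type} (ρ : X → X → ℝ≥0∞) (γ : unitInterval → X) : Prop :=
  ∀ t, Filter.Tendsto (fun s => ρ (γ s) (γ t)) (nhds t) (nhds 0)

/-- The length of `γ`: the supremum over the partitions `0 = t₀ < t₁ < ⋯ < tₙ = 1` of the
lengths of the inscribed chains. -/
def pathLength {X : Type} (ρ : X → X → ℝ≥0∞) (γ : unitInterval → X) : ℝ≥0∞ :=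
  ⨆ (n : ℕ) (t : ℕ → unitInterval)
    (_ : t 0 = 0 ∧ t n = 1 ∧ StrictMonoOn t (Set.Iic n)),
    chainLength ρ n (fun k => γ (t k))

/-- The length metric `d̄` induced by `ρ`. -/
def lengthDist {X : Type} (ρ : X → X → ℝ≥0∞) (a b : X) : ℝ≥0∞ :=
  ⨅ (γ : unitInterval → X) (_ : IsPath ρ γ ∧ γ 0 = a ∧ γ 1 = b), pathLength ρ γ

/-! ### Spaces with two marked points -/

/-- A set with a distance function and two marked points `p`, `q`.  (Only a container for the
concrete spaces constructed below.) -/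
structure Bipointed where
  carrier : Type
  d : carrier → carrier → ℝ≥0∞
  p : carrier
  q : carrier

/-! ### The space `Y₁` -/

/-- The space `ℓ^∞` of bounded real sequences `(x₁, x₂, …)` with the supremum norm. -/
abbrev LInf : Type := lp (fun _ : ℕ+ => ℝ) ∞

/-- The sequence `(s, 0, …, 0, t, 0, …)` with `s` in the first and `t` in the `k`-th place
(for `k ≥ 2`). -/
def pt (k : ℕ+) (s t : ℝ) : LInf :=
  lp.single ∞ (1 : ℕ+) s + lp.single ∞ k t

/-- The broken line `S_k`, made of three segments. -/
def S (k : ℕ+) : Set LInf :=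
  {x | ∃ t ∈ Set.Icc (0 : ℝ) 1, x = pt k 1 t} ∪
  {x | ∃ t ∈ Set.Icc (1 / (k : ℝ)) 1, x = pt k t 1} ∪
  {x | ∃ t ∈ Set.Icc (0 : ℝ) 1, x = pt k (1 / (k : ℝ)) t}

/-- The set `{(0, 0, …)} ∪ ⋃_{k ≥ 2} S_k`. -/
def ySet : Set LInf :=
  {0} ∪ ⋃ (k : ℕ+) (_ : 2 ≤ k), S k

theorem zero_mem_ySet : (0 : LInf) ∈ ySet := Or.inl rfl

theorem single_mem_ySet : (lp.single ∞ (1 : ℕ+) (1 : ℝ) : LInf) ∈ ySet := by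
  refine Or.inr (Set.mem_iUnion₂.mpr ⟨2, le_refl _, Or.inl (Or.inl ⟨0, by simp, ?_⟩)⟩)
  simp [pt]

/-- The space `Y₁`, with the metric of `ℓ^∞`, `p = (0, 0, …)` and `q = (1, 0, 0, …)`. -/
def baseSpace : Bipointed where
  carrier := ySet
  d x y := edist (x : LInf) (y : LInf)
  p := ⟨0, zero_mem_ySet⟩
  q := ⟨lp.single ∞ (1 : ℕ+) (1 : ℝ), single_mem_ySet⟩

/-! ### Gluing -/

/-- The disjoint union of the copies `Z_m^j` of `X`, `m ≥ 1`.  The copies with a given `m` are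
numbered by `j = 0, …, m - 1`. -/
abbrev Copies (X : Bipointed) : Type := Σ m : ℕ+, Fin (m : ℕ) × X.carrier

/-- The pairs of points that are glued. -/
inductive GlueRel (X : Bipointed) : Copies X → Copies X → Prop
  /-- the point `q` of each copy to the point `p` of the next one -/
  | next (m : ℕ+) (j : ℕ) (h : j + 1 < (m : ℕ)) :
      GlueRel X ⟨m, ⟨j, Nat.lt_of_succ_lt h⟩, X.q⟩ ⟨m, ⟨j + 1, h⟩, X.p⟩
  /-- the points `p` of the first copies -/
  | first (m m' : ℕ+) :
      GlueRel X ⟨m, ⟨0, m.pos⟩, X.p⟩ ⟨m', ⟨0, m'.pos⟩, X.p⟩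
  /-- the points `q` of the last copies -/
  | last (m m' : ℕ+) :
      GlueRel X ⟨m, ⟨(m : ℕ) - 1, Nat.sub_lt m.pos Nat.one_pos⟩, X.q⟩
        ⟨m', ⟨(m' : ℕ) - 1, Nat.sub_lt m'.pos Nat.one_pos⟩, X.q⟩

/-- The quotient of the disjoint union by the equivalence relation generated by `GlueRel`. -/
abbrev Glued (X : Bipointed) : Type := Quot (GlueRel X)

/-- The image in the quotient of the point `x` of the copy with indices `m`, `j`. -/
def inCopy (X : Bipointed) (m : ℕ+) (j : Fin (m : ℕ)) (x : X.carrier) : Glued X :=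
  Quot.mk _ ⟨m, j, x⟩

/-- The distance of two points of the quotient measured inside a single copy `Z_m^j`, which
carries the distance of `X` divided by `m` (`∞` if there is no copy that contains both). -/
def stepDist (X : Bipointed) (a b : Glued X) : ℝ≥0∞ :=
  ⨅ (m : ℕ+) (j : Fin (m : ℕ)) (x : X.carrier) (y : X.carrier)
    (_ : inCopy X m j x = a ∧ inCopy X m j y = b), X.d x y / ((m : ℕ) : ℝ≥0∞)

/-- The quotient distance of the gluing: the infimum of the lengths of chains every step of which
is measured inside a single copy. -/
def gluedDist (X : Bipointed) (a b : Glued X) : ℝ≥0∞ :=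
  ⨅ (n : ℕ) (c : ℕ → Glued X) (_ : c 0 = a ∧ c n = b), chainLength (stepDist X) n c

/-- The inclusion of `X` in the glued space as the copy `Z_1^1`. -/
def incl (X : Bipointed) (x : X.carrier) : Glued X := inCopy X 1 ⟨0, Nat.one_pos⟩ x

/-- The space obtained from `X` by gluing. -/
def glue (X : Bipointed) : Bipointed where
  carrier := Glued X
  d := gluedDist X
  p := incl X X.p
  q := incl X X.q

/-- The sequence of spaces, numbered from `0`: `Y i` is the space `Y_{i+1}`. -/
def Y : ℕ → Bipointed
  | 0 => baseSpace
  | i + 1 => glue (Y i)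

/-! ### The union -/

/-- A point of `Y i` is identified with its image in `Y (i + 1)`. -/
inductive UnionRel : (Σ i : ℕ, (Y i).carrier) → (Σ i : ℕ, (Y i).carrier) → Prop
  | step (i : ℕ) (x : (Y i).carrier) : UnionRel ⟨i, x⟩ ⟨i + 1, incl (Y i) x⟩

/-- The set `Y_∞`, the union of the spaces `Y i` along the inclusions. -/
abbrev YUnion : Type := Quot UnionRel

/-- The canonical map of `Y i` to the union. -/
def toUnion (i : ℕ) (x : (Y i).carrier) : YUnion := Quot.mk _ ⟨i, x⟩

/-- The distance in `Y_∞`: that of any `Y i` which contains both points.  (It does not depend on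
`i`, since the inclusions are isometric, so the infimum is over equal numbers.) -/
def unionDist (a b : YUnion) : ℝ≥0∞ :=
  ⨅ (i : ℕ) (x : (Y i).carrier) (y : (Y i).carrier)
    (_ : toUnion i x = a ∧ toUnion i y = b), (Y i).d x y

end DiscreteLength

end

/-!
`IsPseudo ρ` allows infinite values, so that the iterates of `d ↦ d₀` are again of this kind, and
`d₀ᵏ ≤ d̄` always holds (`iterDist_le_lengthDist`). Everything rests on lower bounds for `d₀`, and
these come from three principles about chains. If no short step leaves a set, then `d₀` is infinite
across its boundary (`zeroDist_eq_top`). If short steps leave a set only near a point `w`, then `d₀`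
is additive at `w` (`zeroDist_add_le_of_cut`). A function that obeys the triangle inequality and is
bounded by `ρ` on short steps is bounded by `d₀` (`le_zeroDist_of_local`).

The spaces `Y_n` are treated by induction, with the invariant `StableAt X n`: the `n`-th iterate on
`X` is at least `d̄` away from `p`, and at least `3 + d̄(q, ·)` from `p`, while `d₀ⁿ(p, q) ≤ 3`. Here
`d̄` is replaced by `lipDist`, the infimum of the lengths of Lipschitz arcs, which is an upper bound
for `d̄` that behaves well under gluing. In `Y₁` (`stableAt_baseSpace`) the point `q` and the
corners of the lines `S_k` are cut points, which gives `d₀ ≥ lipDist` away from `p`; small steps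
from `p` lead to the ends `e₁/k` of the lines, each about `3` long, which gives `d₀(p, q) = 3`.

If `X` satisfies the invariant at `n`, then the glued space `G` satisfies it at `n + 1`
(`StableAt.glue`). The distance of `G` has an explicit form: within a row `Z_m^1, …, Z_m^m` it is
the average of the distances of the projections to the copies, and two rows communicate only through
`p` and `q`. Both facts pass to the iterates, the first at small scales
(`sum_iterDist_row_le`, `iterDist_row_separated`). Hence at small scales the `n`-th iterate on a
copy is that of `X` divided by `m`, in which `p` is at distance at least `3 / m` from everything
else: short steps of `d₀ⁿ` leave a copy, deprived of its initial point, only through `q` and only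
if it is the last copy of its row (`StableAt.exit_block`). So `d₀ⁿ⁺¹` is infinite across the other
gluing points, it is not less than `d̄` inside a copy, and it is additive at `q`. From `p` to `q`
the `m`-th row is a chain of `m` steps of length `3 / m`, so `d₀ⁿ⁺¹(p, q) ≤ 3`; the potential that
counts the copies passed shows that this is best possible. One more application of `d ↦ d₀`
isolates `p`, because `d₀ⁿ(p, y) ≥ 3` for `y ≠ p`, and the iterates have become `d̄`. If two
consecutive iterates agree, all later ones do, which yields the strict inequalities.

In `Y_∞` all iterates satisfy `d₀ⁿ(p, q) ≤ 3`. The union retracts to each `Y_n`, near `p` without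
increasing distances, so that every point other than `p` ends up at distance at least `1 / 4` from
`p` (`quarter_le_iterDist_p`), though there are points of `Y_{n+1}` arbitrarily close to `p` with
respect to `d₀ⁿ`: no two consecutive iterates agree. For the limit `l` this means that `p` is
isolated, so `l₀(p, q) = ∞`. But a bound by the length along paths is preserved by `d ↦ d₀`
(`zeroDist_le_arcLength`), so `d̄ ≥ l₀`, and `d̄(p, q) = ∞` while `l(p, q) ≤ 3`.
-/

open scoped ENNReal NNReal

noncomputable section

namespace DiscreteLength

/-! ### Pseudometrics and `ε`-chains -/

/-- `ρ` is a pseudometric, possibly with infinite values. -/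
structure IsPseudo {X : Type} (ρ : X → X → ℝ≥0∞) : Prop where
  self : ∀ x, ρ x x = 0
  symm : ∀ x y, ρ x y = ρ y x
  triangle : ∀ x y z, ρ x z ≤ ρ x y + ρ y z

theorem IsMetric.isPseudo {X : Type} {ρ : X → X → ℝ≥0∞} (h : IsMetric ρ) : IsPseudo ρ :=
  ⟨fun x => (h.eq_zero_iff x x).2 rfl, h.symm, h.triangle⟩

/-- `EpsPath ρ ε a b L`: some `ε`-chain from `a` to `b` has length `L`. This inductive form of
`IsEpsChain` is the one that supports structural induction. -/
inductive EpsPath {X : Type} (ρ : X → X → ℝ≥0∞) (ε : ℝ≥0∞) : X → X → ℝ≥0∞ → Prop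
  | nil (a : X) : EpsPath ρ ε a a 0
  | cons {a b c : X} {L : ℝ≥0∞} (h : ρ a b ≤ ε) (p : EpsPath ρ ε b c L) :
      EpsPath ρ ε a c (ρ a b + L)

section
variable {X : Type} {ρ : X → X → ℝ≥0∞}

theorem EpsPath.single {ε : ℝ≥0∞} {a b : X} (h : ρ a b ≤ ε) : EpsPath ρ ε a b (ρ a b) := by
  simpa using EpsPath.cons h (EpsPath.nil b)

theorem EpsPath.append {ε : ℝ≥0∞} {a b c : X} {L M : ℝ≥0∞} (p : EpsPath ρ ε a b L)
    (q : EpsPath ρ ε b c M) : EpsPath ρ ε a c (L + M) := by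
  induction p with
  | nil => simpa using q
  | cons h _ ih => simpa [add_assoc] using EpsPath.cons h (ih q)

theorem EpsPath.reverse (hs : ∀ x y, ρ x y = ρ y x) {ε : ℝ≥0∞} {a b : X} {L : ℝ≥0∞}
    (p : EpsPath ρ ε a b L) : EpsPath ρ ε b a L := by
  induction p with
  | nil => exact .nil _
  | @cons a b c L h _ ih =>
    rw [hs a b] at h ⊢
    rw [add_comm]
    exact ih.append (.single h)

theorem EpsPath.mono {ε ε' : ℝ≥0∞} (hε : ε ≤ ε') {a b : X} {L : ℝ≥0∞}
    (p : EpsPath ρ ε a b L) : EpsPath ρ ε' a b L := by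
  induction p with
  | nil => exact .nil _
  | cons h _ ih => exact .cons (h.trans hε) ih

theorem EpsPath.exists_chain {ε : ℝ≥0∞} {a b : X} {L : ℝ≥0∞} (p : EpsPath ρ ε a b L) :
    ∃ (n : ℕ) (c : ℕ → X), (c 0 = a ∧ c n = b ∧ ∀ k < n, ρ (c k) (c (k + 1)) ≤ ε) ∧
      chainLength ρ n c = L := by
  induction p with
  | nil a => exact ⟨0, fun _ => a, ⟨rfl, rfl, by simp⟩, by simp [chainLength]⟩
  | @cons a b c L h _ ih =>
    obtain ⟨n, f, ⟨h0, h1, h2⟩, hL⟩ := ih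
    refine ⟨n + 1, fun k => Nat.casesOn k a f, ⟨rfl, h1, ?_⟩, ?_⟩
    · rintro (_ | k) hk
      · simpa [h0] using h
      · exact h2 k (by omega)
    · rw [chainLength, Finset.sum_range_succ']
      change _ + ρ a (f 0) = _
      rw [h0, add_comm, ← hL, chainLength]

theorem EpsPath.of_chain {ε : ℝ≥0∞} {b : X} {n : ℕ} :
    ∀ {a : X} {c : ℕ → X}, (c 0 = a ∧ c n = b ∧ ∀ k < n, ρ (c k) (c (k + 1)) ≤ ε) →
      EpsPath ρ ε a b (chainLength ρ n c) := by
  induction n with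
  | zero =>
    rintro a c ⟨rfl, rfl, _⟩
    simpa [chainLength] using EpsPath.nil (c 0)
  | succ n ih =>
    rintro a c ⟨rfl, hb, h⟩
    have := EpsPath.cons (h 0 (by omega))
      (ih (a := c 1) (c := fun k => c (k + 1)) ⟨rfl, hb, fun k hk => h (k + 1) (by omega)⟩)
    rw [chainLength, Finset.sum_range_succ', add_comm]
    exact this

theorem EpsPath.epsDist_le {ε : ℝ≥0} {a b : X} {L : ℝ≥0∞} (p : EpsPath ρ ε a b L) :
    epsDist ρ ε a b ≤ L := by
  obtain ⟨n, c, h, rfl⟩ := p.exists_chain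
  exact iInf_le_of_le n (iInf_le_of_le c (iInf_le_of_le h le_rfl))

theorem le_epsDist {ε : ℝ≥0} {a b : X} {r : ℝ≥0∞} (h : ∀ L, EpsPath ρ ε a b L → r ≤ L) :
    r ≤ epsDist ρ ε a b :=
  le_iInf fun _ => le_iInf fun _ => le_iInf fun hc => h _ (.of_chain hc)

theorem exists_epsPath_of_epsDist_lt {ε : ℝ≥0} {a b : X} {r : ℝ≥0∞} (h : epsDist ρ ε a b < r) :
    ∃ L < r, EpsPath ρ ε a b L := by
  by_contra! H
  exact absurd h (not_lt.2 (le_epsDist fun L hL => not_lt.1 fun hlt => H L hlt hL))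

theorem epsDist_self (ρ : X → X → ℝ≥0∞) (ε : ℝ≥0) (a : X) : epsDist ρ ε a a = 0 :=
  le_antisymm (EpsPath.nil a).epsDist_le bot_le

theorem epsDist_le_of_le {ε : ℝ≥0} {a b : X} (h : ρ a b ≤ ε) : epsDist ρ ε a b ≤ ρ a b :=
  (EpsPath.single h).epsDist_le

theorem epsDist_eq_iInf (ρ : X → X → ℝ≥0∞) (ε : ℝ≥0) (a b : X) :
    epsDist ρ ε a b = ⨅ L : {L // EpsPath ρ ε a b L}, (L : ℝ≥0∞) :=
  le_antisymm (le_iInf fun L => L.2.epsDist_le) (le_epsDist fun L hL => iInf_le_of_le ⟨L, hL⟩ le_rfl)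

theorem epsDist_triangle (ρ : X → X → ℝ≥0∞) (ε : ℝ≥0) (a b c : X) :
    epsDist ρ ε a c ≤ epsDist ρ ε a b + epsDist ρ ε b c := by
  rw [epsDist_eq_iInf ρ ε a b, epsDist_eq_iInf ρ ε b c]
  exact ENNReal.le_iInf_add_iInf fun L M => (L.2.append M.2).epsDist_le

theorem epsDist_symm (hs : ∀ x y, ρ x y = ρ y x) (ε : ℝ≥0) (a b : X) :
    epsDist ρ ε a b = epsDist ρ ε b a :=
  le_antisymm (le_epsDist fun _ p => (p.reverse hs).epsDist_le)
    (le_epsDist fun _ p => (p.reverse hs).epsDist_le)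

theorem epsDist_anti {ε ε' : ℝ≥0} (h : ε ≤ ε') (a b : X) :
    epsDist ρ ε' a b ≤ epsDist ρ ε a b :=
  le_epsDist fun _ p => (p.mono (by exact_mod_cast h)).epsDist_le

/-- A function that satisfies the triangle inequality and is bounded by `ρ` on steps of size at
most `ε` is bounded by `ρ_ε`. -/
theorem le_epsDist_of_local {F : X → X → ℝ≥0∞} (h0 : ∀ x, F x x = 0)
    (ht : ∀ x y z, F x z ≤ F x y + F y z) {ε : ℝ≥0} (h : ∀ u v, ρ u v ≤ ε → F u v ≤ ρ u v)
    (a b : X) : F a b ≤ epsDist ρ ε a b := by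
  refine le_epsDist fun L p => ?_
  induction p with
  | nil => simp [h0]
  | cons hab _ ih => exact (ht _ _ _).trans (add_le_add (h _ _ hab) ih)

theorem epsDist_le_zeroDist {ε : ℝ≥0} (hε : 0 < ε) (a b : X) :
    epsDist ρ ε a b ≤ zeroDist ρ a b :=
  le_iSup₂_of_le ε hε le_rfl

theorem zeroDist_le {a b : X} {r : ℝ≥0∞} (h : ∀ ε : ℝ≥0, 0 < ε → epsDist ρ ε a b ≤ r) :
    zeroDist ρ a b ≤ r :=
  iSup₂_le h

theorem zeroDist_eq_iSup (ρ : X → X → ℝ≥0∞) (a b : X) :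
    zeroDist ρ a b = ⨆ ε : {ε : ℝ≥0 // 0 < ε}, epsDist ρ ε a b := by
  rw [zeroDist, iSup_subtype]

/-- Suprema over `ε` commute with finite sums, because the `ρ_ε` increase as `ε` decreases. -/
theorem sum_zeroDist_le {ι : Type} (s : Finset ι) (a b : ι → X) {r : ℝ≥0∞}
    (h : ∀ ε : ℝ≥0, 0 < ε → ∑ i ∈ s, epsDist ρ ε (a i) (b i) ≤ r) :
    ∑ i ∈ s, zeroDist ρ (a i) (b i) ≤ r := by
  simp only [zeroDist_eq_iSup]
  rw [ENNReal.finsetSum_iSup]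
  · exact iSup_le fun ε => h ε ε.2
  · exact fun i j => ⟨⟨min i j, lt_min i.2 j.2⟩, fun k =>
      ⟨epsDist_anti (min_le_left _ _) _ _, epsDist_anti (min_le_right _ _) _ _⟩⟩

theorem zeroDist_add_le {a b c d : X} {r : ℝ≥0∞}
    (h : ∀ ε : ℝ≥0, 0 < ε → epsDist ρ ε a b + epsDist ρ ε c d ≤ r) :
    zeroDist ρ a b + zeroDist ρ c d ≤ r := by
  have := sum_zeroDist_le (ρ := ρ) Finset.univ ![a, c] ![b, d] (r := r)
  simp only [Fin.sum_univ_two] at this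
  exact this h

/-- A function that satisfies the triangle inequality and is bounded by `ρ` on all sufficiently
small steps is bounded by `d₀`. -/
theorem le_zeroDist_of_local {F : X → X → ℝ≥0∞} (h0 : ∀ x, F x x = 0)
    (ht : ∀ x y z, F x z ≤ F x y + F y z)
    (h : ∃ ε : ℝ≥0, 0 < ε ∧ ∀ u v, ρ u v ≤ ε → F u v ≤ ρ u v) (a b : X) :
    F a b ≤ zeroDist ρ a b := by
  obtain ⟨ε, hε, h⟩ := h
  exact (le_epsDist_of_local h0 ht h a b).trans (epsDist_le_zeroDist hε a b)

theorem IsPseudo.zeroDist (h : IsPseudo ρ) : IsPseudo (zeroDist ρ) where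
  self x := le_antisymm (zeroDist_le fun ε _ => (epsDist_self ρ ε x).le) bot_le
  symm x y := by simp only [DiscreteLength.zeroDist, epsDist_symm h.symm _ x y]
  triangle x y z := zeroDist_le fun ε hε => (epsDist_triangle ρ ε x y z).trans
    (add_le_add (epsDist_le_zeroDist hε _ _) (epsDist_le_zeroDist hε _ _))

theorem IsPseudo.le_zeroDist (h : IsPseudo ρ) (a b : X) : ρ a b ≤ DiscreteLength.zeroDist ρ a b :=
  le_zeroDist_of_local h.self h.triangle ⟨1, one_pos, fun _ _ _ => le_rfl⟩ a b

theorem IsPseudo.iterDist (h : IsPseudo ρ) (k : ℕ) : IsPseudo (iterDist ρ k) := by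
  induction k with
  | zero => exact h
  | succ k ih => exact ih.zeroDist

theorem IsPseudo.iterDist_mono (h : IsPseudo ρ) {k l : ℕ} (hkl : k ≤ l) (a b : X) :
    DiscreteLength.iterDist ρ k a b ≤ DiscreteLength.iterDist ρ l a b := by
  induction l, hkl using Nat.le_induction with
  | base => exact le_rfl
  | succ l _ ih => exact ih.trans ((h.iterDist l).le_zeroDist a b)

theorem IsPseudo.le_iterDist (h : IsPseudo ρ) (k : ℕ) (a b : X) :
    ρ a b ≤ DiscreteLength.iterDist ρ k a b :=
  h.iterDist_mono (Nat.zero_le k) a b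

/-- Once two consecutive iterates agree, the sequence is constant. -/
theorem iterDist_eq_of_eq_succ {k : ℕ} (h : iterDist ρ k = iterDist ρ (k + 1)) {l : ℕ}
    (hkl : k ≤ l) : iterDist ρ l = iterDist ρ k := by
  induction l, hkl using Nat.le_induction with
  | base => rfl
  | succ l _ ih => rw [iterDist, ih]; exact h.symm

/-! ### Chains that leave a set -/

/-- An `ε`-chain from a set to its complement has a step that leaves the set. -/
theorem EpsPath.exists_crossing {ε : ℝ≥0∞} {A : Set X} {x y : X} {L : ℝ≥0∞}
    (p : EpsPath ρ ε x y L) (hx : x ∈ A) (hy : y ∉ A) :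
    ∃ u ∈ A, ∃ v ∉ A, ∃ L₁ L₂, EpsPath ρ ε x u L₁ ∧ ρ u v ≤ ε ∧ EpsPath ρ ε v y L₂ ∧
      L₁ + ρ u v + L₂ = L := by
  induction p with
  | nil => exact absurd hx hy
  | @cons a b c L h p ih =>
    by_cases hb : b ∈ A
    · obtain ⟨u, hu, v, hv, L₁, L₂, p₁, huv, p₂, rfl⟩ := ih hb hy
      exact ⟨u, hu, v, hv, _, _, .cons h p₁, huv, p₂, by simp only [add_assoc]⟩
    · exact ⟨a, hx, b, hb, 0, L, .nil _, h, p, by simp⟩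

/-- If no short step leaves `A`, then `d₀` is infinite between `A` and its complement. -/
theorem zeroDist_eq_top {A : Set X} {ε : ℝ≥0} (hε : 0 < ε)
    (h : ∀ u ∈ A, ∀ v ∉ A, ¬ ρ u v ≤ ε) {x y : X} (hx : x ∈ A) (hy : y ∉ A) :
    zeroDist ρ x y = ∞ := by
  refine top_le_iff.1 (le_trans (le_epsDist fun L p => ?_) (epsDist_le_zeroDist hε x y))
  obtain ⟨u, hu, v, hv, -, -, -, huv, -⟩ := p.exists_crossing hx hy
  exact absurd huv (h u hu v hv)

/-- If short steps leave `A` only near the point `w`, then `d₀` is additive at `w` between `A` and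
its complement. -/
theorem zeroDist_add_le_of_cut {A : Set X} {w : X}
    (h : ∀ η : ℝ≥0, 0 < η → ∃ ε : ℝ≥0, 0 < ε ∧
      ∀ u ∈ A, ∀ v ∉ A, ρ u v ≤ ε → ρ u w ≤ η ∧ ρ w v ≤ η)
    {x y : X} (hx : x ∈ A) (hy : y ∉ A) :
    zeroDist ρ x w + zeroDist ρ w y ≤ zeroDist ρ x y := by
  have key : ∀ η : ℝ≥0, 0 < η →
      epsDist ρ η x w + epsDist ρ η w y ≤ zeroDist ρ x y + 2 * η := by
    intro η hη
    obtain ⟨ε, hε, h⟩ := h η hη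
    have hm : 0 < min ε η := lt_min hε hη
    rw [← tsub_le_iff_right]
    refine le_trans (le_epsDist fun L p => ?_) (epsDist_le_zeroDist hm x y)
    rw [tsub_le_iff_right]
    obtain ⟨u, hu, v, hv, L₁, L₂, p₁, huv, p₂, rfl⟩ := p.exists_crossing hx hy
    have hmη : ((min ε η : ℝ≥0) : ℝ≥0∞) ≤ η := by exact_mod_cast min_le_right ε η
    obtain ⟨huw, hwv⟩ := h u hu v hv (huv.trans (by exact_mod_cast min_le_left ε η))
    calc epsDist ρ η x w + epsDist ρ η w y
        ≤ (L₁ + η) + (η + L₂) := add_le_add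
          (((p₁.mono hmη).append (.single huw)).epsDist_le.trans (by gcongr))
          ((EpsPath.cons hwv (p₂.mono hmη)).epsDist_le.trans (by gcongr))
      _ = L₁ + L₂ + 2 * η := by ring
      _ ≤ L₁ + ρ u v + L₂ + 2 * η := by gcongr; exact le_self_add
  refine zeroDist_add_le fun η₀ hη₀ => ENNReal.le_of_forall_pos_le_add fun δ hδ _ => ?_
  have hη : 0 < min η₀ (δ / 2) := lt_min hη₀ (half_pos hδ)
  calc epsDist ρ η₀ x w + epsDist ρ η₀ w y
      ≤ epsDist ρ (min η₀ (δ / 2)) x w + epsDist ρ (min η₀ (δ / 2)) w y :=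
        add_le_add (epsDist_anti (min_le_left _ _) _ _) (epsDist_anti (min_le_left _ _) _ _)
    _ ≤ zeroDist ρ x y + 2 * (min η₀ (δ / 2) : ℝ≥0) := key _ hη
    _ ≤ zeroDist ρ x y + δ := by
        gcongr
        calc (2 : ℝ≥0∞) * (min η₀ (δ / 2) : ℝ≥0) ≤ 2 * ((δ / 2 : ℝ≥0) : ℝ≥0∞) := by
              gcongr; exact min_le_right _ _
          _ = δ := by
              rw [← ENNReal.coe_ofNat, ← ENNReal.coe_mul, mul_div_cancel₀ _ two_ne_zero]

/-- If every step out of `A` passes through one of the points `p` and `q`, then the same holds for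
`d₀`. -/
theorem zeroDist_separated {A : Set X} {p q : X}
    (h : ∀ u ∈ A, ∀ v ∉ A, min (ρ u p + ρ p v) (ρ u q + ρ q v) ≤ ρ u v) :
    ∀ u ∈ A, ∀ v ∉ A,
      min (zeroDist ρ u p + zeroDist ρ p v) (zeroDist ρ u q + zeroDist ρ q v) ≤
        zeroDist ρ u v := by
  intro x hx y hy
  have via : ∀ {ε : ℝ≥0} {u v w : X} {L₁ L₂ : ℝ≥0∞}, EpsPath ρ ε x u L₁ → ρ u v ≤ ε →
      EpsPath ρ ε v y L₂ → ρ u w + ρ w v ≤ ρ u v →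
      epsDist ρ ε x w + epsDist ρ ε w y ≤ L₁ + ρ u v + L₂ := by
    intro ε u v w L₁ L₂ p₁ huv p₂ hw
    calc epsDist ρ ε x w + epsDist ρ ε w y
        ≤ (L₁ + ρ u w) + (ρ w v + L₂) := add_le_add
          (p₁.append (.single ((le_self_add.trans hw).trans huv))).epsDist_le
          (EpsPath.cons ((le_add_self.trans hw).trans huv) p₂).epsDist_le
      _ = L₁ + (ρ u w + ρ w v) + L₂ := by ring
      _ ≤ L₁ + ρ u v + L₂ := by gcongr
  have key : ∀ ε : ℝ≥0, 0 < ε → min (epsDist ρ ε x p + epsDist ρ ε p y)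
      (epsDist ρ ε x q + epsDist ρ ε q y) ≤ zeroDist ρ x y := by
    intro ε hε
    refine le_trans (le_epsDist fun L P => ?_) (epsDist_le_zeroDist hε x y)
    obtain ⟨u, hu, v, hv, L₁, L₂, p₁, huv, p₂, rfl⟩ := P.exists_crossing hx hy
    rcases min_le_iff.1 (h u hu v hv) with hw | hw
    · exact (min_le_left _ _).trans (via p₁ huv p₂ hw)
    · exact (min_le_right _ _).trans (via p₁ huv p₂ hw)
  rw [min_le_iff]
  by_contra! H
  -- both sums exceed `d₀ x y` at some scale, hence at the smaller of the two scales
  obtain ⟨ε₁, h₁, H₁⟩ : ∃ ε : ℝ≥0, 0 < ε ∧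
      zeroDist ρ x y < epsDist ρ ε x p + epsDist ρ ε p y := by
    by_contra! H'; exact absurd (zeroDist_add_le H') (not_le.2 H.1)
  obtain ⟨ε₂, h₂, H₂⟩ : ∃ ε : ℝ≥0, 0 < ε ∧
      zeroDist ρ x y < epsDist ρ ε x q + epsDist ρ ε q y := by
    by_contra! H'; exact absurd (zeroDist_add_le H') (not_le.2 H.2)
  rcases min_le_iff.1 (key (min ε₁ ε₂) (lt_min h₁ h₂)) with h | h
  · exact absurd h (not_le.2 (H₁.trans_le
      (add_le_add (epsDist_anti (min_le_left _ _) _ _) (epsDist_anti (min_le_left _ _) _ _))))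
  · exact absurd h (not_le.2 (H₂.trans_le
      (add_le_add (epsDist_anti (min_le_right _ _) _ _) (epsDist_anti (min_le_right _ _) _ _))))

theorem iterDist_separated {A : Set X} {p q : X}
    (h : ∀ u ∈ A, ∀ v ∉ A, min (ρ u p + ρ p v) (ρ u q + ρ q v) ≤ ρ u v) (k : ℕ) :
    ∀ u ∈ A, ∀ v ∉ A, min (iterDist ρ k u p + iterDist ρ k p v)
      (iterDist ρ k u q + iterDist ρ k q v) ≤ iterDist ρ k u v := by
  induction k with
  | zero => exact h
  | succ k ih => exact zeroDist_separated ih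

end

/-! ### Comparison of iterates along maps -/

/-- Let `U` be a set on which the maps `r i` do not increase distances in total, up to a factor
`K`. Then the same holds for the iterates of `d ↦ d₀`, as long as the points are so close that
short chains between them do not leave `U`. -/
theorem sum_iterDist_le {G X ι : Type} {ρ : G → G → ℝ≥0∞} {σ : X → X → ℝ≥0∞} (hρ : IsPseudo ρ)
    (s : Finset ι) (r : ι → G → X) (K : ℝ≥0) (U : Set G) (c₀ : ℝ≥0∞)
    (h : ∀ x ∈ U, ∀ y ∈ U, ρ x y < c₀ → ∑ i ∈ s, σ (r i x) (r i y) ≤ K * ρ x y) (k : ℕ) :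
    ∀ c ≤ c₀, ∀ x y, (∀ z, ρ x z < c → z ∈ U) → iterDist ρ k x y < c →
      ∑ i ∈ s, iterDist σ k (r i x) (r i y) ≤ K * iterDist ρ k x y := by
  induction k with
  | zero =>
    intro c hc x y hU hxy
    exact h x (hU x (by rw [hρ.self]; exact bot_le.trans_lt hxy)) y (hU y hxy) (hxy.trans_le hc)
  | succ k ih =>
    have path : ∀ (ε : ℝ≥0) (x y : G) (L : ℝ≥0∞), EpsPath (iterDist ρ k) ε x y L → ∀ c ≤ c₀,
        (∀ z, ρ x z < c → z ∈ U) → L < c →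
        ∑ i ∈ s, epsDist (iterDist σ k) (K * ε) (r i x) (r i y) ≤ K * L := by
      intro ε x y L p
      induction p with
      | nil => intros; simp [epsDist_self]
      | @cons a b y L hab p ihp =>
        intro c hc hU hL
        have hab_lt : iterDist ρ k a b < c := le_self_add.trans_lt hL
        have h₁ := ih c hc a b hU hab_lt
        -- what remains of the radius `c` after the first step serves the rest of the chain
        have h₂ := ihp (c - iterDist ρ k a b) (tsub_le_self.trans hc)
          (fun z hz => hU z (((hρ.triangle a b z).trans
            (add_le_add (hρ.le_iterDist k a b) le_rfl)).trans_lt (lt_tsub_iff_left.1 hz)))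
          (lt_tsub_iff_left.2 hL)
        have h₃ : ∀ i ∈ s, epsDist (iterDist σ k) (K * ε) (r i a) (r i b) ≤
            iterDist σ k (r i a) (r i b) := by
          intro i hi
          refine epsDist_le_of_le ?_
          rw [ENNReal.coe_mul]
          exact (Finset.single_le_sum (f := fun i => iterDist σ k (r i a) (r i b))
            (fun _ _ => bot_le) hi).trans (h₁.trans (by gcongr))
        calc ∑ i ∈ s, epsDist (iterDist σ k) (K * ε) (r i a) (r i y)
            ≤ ∑ i ∈ s, (iterDist σ k (r i a) (r i b)
                + epsDist (iterDist σ k) (K * ε) (r i b) (r i y)) :=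
              Finset.sum_le_sum fun i hi =>
                (epsDist_triangle _ _ _ (r i b) _).trans (add_le_add (h₃ i hi) le_rfl)
          _ ≤ K * iterDist ρ k a b + K * L := by
              rw [Finset.sum_add_distrib]; exact add_le_add h₁ h₂
          _ = K * (iterDist ρ k a b + L) := (mul_add _ _ _).symm
    intro c hc x y hU hxy
    refine sum_zeroDist_le s _ _ fun δ hδ => ?_
    obtain ⟨ε, hε, hKε⟩ : ∃ ε : ℝ≥0, 0 < ε ∧ K * ε ≤ δ := by
      refine ⟨δ / (K + 1), by positivity, ?_⟩
      rw [← mul_div_assoc, div_le_iff₀ (by positivity), mul_comm]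
      gcongr
      exact le_self_add
    have hlt : epsDist (iterDist ρ k) ε x y < c := (epsDist_le_zeroDist hε x y).trans_lt hxy
    calc ∑ i ∈ s, epsDist (iterDist σ k) δ (r i x) (r i y)
        ≤ ∑ i ∈ s, epsDist (iterDist σ k) (K * ε) (r i x) (r i y) :=
          Finset.sum_le_sum fun i _ => epsDist_anti hKε _ _
      _ ≤ K * epsDist (iterDist ρ k) ε x y := by
          refine ENNReal.le_of_forall_pos_le_add fun η hη _ => ?_
          have hη' : (0 : ℝ≥0∞) < (η / (K + 1) : ℝ≥0) := by
            rw [ENNReal.coe_pos]; positivity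
          obtain ⟨L, hL, p⟩ := exists_epsPath_of_epsDist_lt
            (lt_min hlt (ENNReal.lt_add_right (hlt.trans_le le_top).ne hη'.ne'))
          refine (path ε x y L p c hc hU (hL.trans_le (min_le_left _ _))).trans ?_
          calc (K : ℝ≥0∞) * L
              ≤ K * (epsDist (iterDist ρ k) ε x y + (η / (K + 1) : ℝ≥0)) := by
                gcongr; exact hL.le.trans (min_le_right _ _)
            _ ≤ K * epsDist (iterDist ρ k) ε x y + η := by
                rw [mul_add]
                gcongr
                rw [← ENNReal.coe_mul, ENNReal.coe_le_coe, ← mul_div_assoc,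
                  div_le_iff₀ (by positivity), mul_comm]
                gcongr
                exact le_self_add
      _ ≤ K * zeroDist (iterDist ρ k) x y := by gcongr; exact epsDist_le_zeroDist hε x y

/-- A Lipschitz map is Lipschitz for the iterates, with the same constant. -/
theorem iterDist_map_le {G X : Type} {ρ : G → G → ℝ≥0∞} {σ : X → X → ℝ≥0∞}
    (hσ : IsPseudo σ) (f : X → G) {K : ℝ≥0} (hK : K ≠ 0)
    (h : ∀ x y, ρ (f x) (f y) ≤ K * σ x y) (k : ℕ) (x y : X) :
    iterDist ρ k (f x) (f y) ≤ K * iterDist σ k x y := by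
  rcases eq_or_ne (iterDist σ k x y) ∞ with h' | h'
  · rw [h', ENNReal.mul_top (by simpa using hK)]
    exact le_top
  · simpa using sum_iterDist_le hσ (Finset.univ : Finset Unit) (fun _ => f) K Set.univ ∞
      (fun x _ y _ _ => by simpa using h x y) k ∞ le_rfl x y (fun _ _ => Set.mem_univ _)
      h'.lt_top

/-! ### Lengths of paths -/

section
variable {X : Type} {ρ : X → X → ℝ≥0∞}

/-- The pseudometric `ρ` as a Mathlib structure, to make the theory of `eVariationOn` available. -/
abbrev IsPseudo.toSpace (h : IsPseudo ρ) : PseudoEMetricSpace X where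
  edist := ρ
  edist_self := h.self
  edist_comm := h.symm
  edist_triangle := h.triangle

/-- The `ρ`-length of the restriction of `γ` to `[s, t]`. -/
def arcLength (h : IsPseudo ρ) (γ : unitInterval → X) (s t : unitInterval) : ℝ≥0∞ :=
  letI := h.toSpace
  eVariationOn γ (Set.Icc s t)

/-- Repetitions can be removed from a monotone sequence without changing the length of the
inscribed chain. -/
theorem exists_strictMonoOn_chainLength (h : IsPseudo ρ) (γ : unitInterval → X)
    {u : ℕ → unitInterval} (hu : Monotone u) (n : ℕ) :
    ∃ (m : ℕ) (v : ℕ → unitInterval), v 0 = u 0 ∧ v m = u n ∧ StrictMonoOn v (Set.Iic m) ∧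
      chainLength ρ m (fun k => γ (v k)) = chainLength ρ n (fun k => γ (u k)) := by
  induction n with
  | zero => exact ⟨0, u, rfl, rfl, by intro a ha b hb hab; simp at ha hb; omega, rfl⟩
  | succ n ih =>
    obtain ⟨m, v, h0, hm, hv, hl⟩ := ih
    rcases (hu (Nat.le_succ n)).eq_or_lt with he | hlt
    · refine ⟨m, v, h0, hm.trans he, hv, ?_⟩
      rw [hl, chainLength, chainLength, Finset.sum_range_succ, ← Nat.succ_eq_add_one n, ← he,
        h.self, add_zero]
    · refine ⟨m + 1, fun i => if i ≤ m then v i else u (n + 1), by simp [h0], by simp,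
        by grind [StrictMonoOn], ?_⟩
      rw [chainLength, chainLength, Finset.sum_range_succ, Finset.sum_range_succ]
      congr 1
      · change _ = chainLength ρ n (fun k => γ (u k))
        rw [← hl, chainLength]
        refine Finset.sum_congr rfl fun k hk => ?_
        have := Finset.mem_range.1 hk
        simp only [if_pos this.le, if_pos (Nat.succ_le_of_lt this)]
      · simp [hm]

theorem arcLength_zero_one_le (h : IsPseudo ρ) (γ : unitInterval → X) :
    arcLength h γ 0 1 ≤ pathLength ρ γ := by
  let _ := h.toSpace
  refine iSup_le ?_
  rintro ⟨n, u, hu, -⟩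
  -- the partition is completed by the end points `0` and `1`
  let w : ℕ → unitInterval := fun k => if k = 0 then 0 else if k ≤ n + 1 then u (k - 1) else 1
  have hw : Monotone w := by
    refine monotone_nat_of_le_succ fun k => ?_
    simp only [w]
    rcases Nat.eq_zero_or_pos k with rfl | hk
    · exact unitInterval.nonneg'
    · rw [if_neg hk.ne', if_neg (Nat.succ_ne_zero k)]
      by_cases h2 : k + 1 ≤ n + 1
      · rw [if_pos (by omega), if_pos h2]
        exact hu (by omega)
      · rw [if_neg h2]
        exact unitInterval.le_one'
  obtain ⟨m, v, h0, hm, hv, hl⟩ := exists_strictMonoOn_chainLength h γ hw (n + 2)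
  refine le_trans ?_ (le_iSup_of_le m (le_iSup_of_le v (le_iSup_of_le
    ⟨by rw [h0]; simp [w], by rw [hm]; simp [w], hv⟩ le_rfl)))
  rw [hl, chainLength, Finset.sum_range_succ, Finset.sum_range_succ']
  refine le_trans (le_trans (le_of_eq ?_) le_self_add) le_self_add
  refine Finset.sum_congr rfl fun k hk => ?_
  have := Finset.mem_range.1 hk
  simp only [w]
  rw [if_neg (by omega), if_pos (by omega), if_neg (by omega), if_pos (by omega)]
  exact h.symm _ _

theorem dist_le_arcLength (h : IsPseudo ρ) (γ : unitInterval → X) {s t : unitInterval}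
    (hst : s ≤ t) : ρ (γ s) (γ t) ≤ arcLength h γ s t := by
  let _ := h.toSpace
  exact eVariationOn.edist_le γ (Set.left_mem_Icc.2 hst) (Set.right_mem_Icc.2 hst)

/-- A path of finite length can be divided into pieces of small length. -/
theorem exists_arcLength_le (h : IsPseudo ρ) {γ : unitInterval → X} (hγ : IsPath ρ γ)
    (hfin : arcLength h γ 0 1 ≠ ∞) {ε : ℝ≥0∞} (hε : 0 < ε) :
    ∃ (n : ℕ) (t : ℕ → unitInterval), t 0 = 0 ∧ t n = 1 ∧ Monotone t ∧
      ∀ k, arcLength h γ (t k) (t (k + 1)) ≤ ε := by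
  let _ := h.toSpace
  have hbv : BoundedVariationOn γ Set.univ := by
    have : (Set.univ : Set unitInterval) = Set.Icc 0 1 := by
      ext x; simp [unitInterval.le_one']
    rw [BoundedVariationOn, this]; exact hfin
  have hc : Continuous γ := by
    rw [continuous_iff_continuousAt]
    intro t
    rw [ContinuousAt, tendsto_iff_edist_tendsto_0]
    exact hγ t
  have hε2 : (0 : ℝ≥0∞) < ε / 2 := ENNReal.half_pos hε.ne'
  have local_small : ∀ x : unitInterval, ∃ c : Set unitInterval, IsOpen c ∧ x ∈ c ∧
      ∀ y ∈ c, arcLength h γ y x ≤ ε / 2 ∧ arcLength h γ x y ≤ ε / 2 := by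
    intro x
    have h1 := hbv.tendsto_eVariationOn_Icc_zero_left (x := x) hc.continuousAt.continuousWithinAt
    have h2 := hbv.tendsto_eVariationOn_Icc_zero_right x hc.continuousAt.continuousWithinAt
    simp only [Set.univ_inter, nhdsWithin_univ] at h1 h2
    have := (h1.eventually (gt_mem_nhds hε2)).and (h2.eventually (gt_mem_nhds hε2))
    obtain ⟨c, hc, hco, hx⟩ := eventually_nhds_iff.1 this
    exact ⟨c, hco, hx, fun y hy => ⟨(hc y hy).1.le, (hc y hy).2.le⟩⟩
  choose c hco hxc hc' using local_small
  obtain ⟨t, h0, hmono, ⟨n, hn⟩, hsub⟩ :=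
    exists_monotone_Icc_subset_open_cover_unitInterval hco
      (fun x _ => Set.mem_iUnion.2 ⟨x, hxc x⟩)
  refine ⟨n, t, h0, hn n le_rfl, hmono, fun k => ?_⟩
  obtain ⟨x, hx⟩ := hsub k
  have hk := hmono (Nat.le_succ k)
  have ha := hc' x _ (hx (Set.left_mem_Icc.2 hk))
  have hb := hc' x _ (hx (Set.right_mem_Icc.2 hk))
  rcases le_total x (t k) with h1 | h1
  · exact (eVariationOn.mono γ (Set.Icc_subset_Icc_left h1)).trans
      (hb.2.trans ENNReal.half_le_self)
  rcases le_total (t (k + 1)) x with h2 | h2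
  · exact (eVariationOn.mono γ (Set.Icc_subset_Icc_right h2)).trans
      (ha.1.trans ENNReal.half_le_self)
  · have := eVariationOn.Icc_add_Icc γ (s := Set.univ) h1 h2 (Set.mem_univ x)
    simp only [Set.univ_inter] at this
    calc arcLength h γ (t k) (t (k + 1)) = _ := this.symm
      _ ≤ ε / 2 + ε / 2 := add_le_add ha.1 hb.2
      _ = ε := ENNReal.add_halves ε

/-- A bound by the arc length along a path is inherited by `d₀`. -/
theorem zeroDist_le_arcLength (h : IsPseudo ρ) {γ : unitInterval → X} (hγ : IsPath ρ γ)
    (hfin : arcLength h γ 0 1 ≠ ∞) {F : X → X → ℝ≥0∞}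
    (hF : ∀ s t, s ≤ t → F (γ s) (γ t) ≤ arcLength h γ s t) {s t : unitInterval} (hst : s ≤ t) :
    zeroDist F (γ s) (γ t) ≤ arcLength h γ s t := by
  let _ := h.toSpace
  refine zeroDist_le fun ε hε => ?_
  obtain ⟨n, τ, h0, h1, hmono, hsmall⟩ :=
    exists_arcLength_le h hγ hfin (ε := ε) (by exact_mod_cast hε)
  -- the partition of `[0, 1]` is projected to `[s, t]`
  let v : ℕ → unitInterval := fun k => max s (min t (τ k))
  have hv : Monotone v := fun i j hij => max_le_max le_rfl (min_le_min le_rfl (hmono hij))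
  have hv0 : v 0 = s := by simp [v, h0]
  have hv1 : v n = t := by simp [v, h1, unitInterval.le_one', hst]
  have hvs : ∀ k, arcLength h γ (v k) (v (k + 1)) ≤ ε := by
    intro k
    rcases (hv (Nat.le_succ k)).eq_or_lt with he | hlt
    · rw [Nat.succ_eq_add_one] at he
      rw [← he, arcLength, Set.Icc_self, eVariationOn.subsingleton _ Set.subsingleton_singleton]
      exact bot_le
    · refine (eVariationOn.mono γ (Set.Icc_subset_Icc ?_ ?_)).trans (hsmall k) <;>
        grind
  have hstep : ∀ k, F (γ (v k)) (γ (v (k + 1))) ≤ arcLength h γ (v k) (v (k + 1)) :=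
    fun k => hF _ _ (hv (Nat.le_succ k))
  have hp : EpsPath F ε (γ s) (γ t) (chainLength F n fun k => γ (v k)) :=
    .of_chain ⟨congrArg γ hv0, congrArg γ hv1, fun k _ => (hstep k).trans (hvs k)⟩
  calc epsDist F ε (γ s) (γ t) ≤ _ := hp.epsDist_le
    _ ≤ ∑ k ∈ Finset.range n, arcLength h γ (v k) (v (k + 1)) :=
        Finset.sum_le_sum fun k _ => hstep k
    _ = arcLength h γ s t := by
        rw [← hv0, ← hv1]; exact eVariationOn.sum' γ hv

theorem iterDist_le_arcLength (h : IsPseudo ρ) {γ : unitInterval → X} (hγ : IsPath ρ γ)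
    (hfin : arcLength h γ 0 1 ≠ ∞) (k : ℕ) {s t : unitInterval} (hst : s ≤ t) :
    iterDist ρ k (γ s) (γ t) ≤ arcLength h γ s t := by
  induction k generalizing s t with
  | zero => exact dist_le_arcLength h γ hst
  | succ k ih => exact zeroDist_le_arcLength h hγ hfin (fun s t hst => ih hst) hst

/-- A lower bound for `d̄` need only be tested on the paths of finite length. -/
theorem le_lengthDist (h : IsPseudo ρ) {r : ℝ≥0∞} {a b : X}
    (H : ∀ γ : unitInterval → X, IsPath ρ γ → arcLength h γ 0 1 ≠ ∞ → γ 0 = a → γ 1 = b →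
      r ≤ arcLength h γ 0 1) : r ≤ lengthDist ρ a b := by
  refine le_iInf₂ fun γ ⟨hγ, ha, hb⟩ => ?_
  refine le_trans ?_ (arcLength_zero_one_le h γ)
  by_cases hfin : arcLength h γ 0 1 = ∞
  · rw [hfin]; exact le_top
  · exact H γ hγ hfin ha hb

theorem iterDist_le_lengthDist (h : IsPseudo ρ) (k : ℕ) (a b : X) :
    iterDist ρ k a b ≤ lengthDist ρ a b := by
  refine le_lengthDist h fun γ hγ hfin ha hb => ?_
  rw [← ha, ← hb]
  exact iterDist_le_arcLength h hγ hfin k unitInterval.nonneg'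

/-! ### Arcs parametrized by length -/

/-- There is a `1`-Lipschitz map of `[0, L]` to `X` that takes the end points to `a` and `b`. -/
def IsArc (ρ : X → X → ℝ≥0∞) (a b : X) (L : ℝ≥0) : Prop :=
  ∃ f : ℝ → X, f 0 = a ∧ f L = b ∧
    ∀ s t : ℝ, 0 ≤ s → s ≤ t → t ≤ L → ρ (f s) (f t) ≤ ENNReal.ofReal (t - s)

/-- The infimum of the lengths `L` of Lipschitz arcs joining two points. It agrees with `lengthDist`
on the spaces considered here, and is easier to bound from above. -/
def lipDist (ρ : X → X → ℝ≥0∞) (a b : X) : ℝ≥0∞ :=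
  ⨅ (L : ℝ≥0) (_ : IsArc ρ a b L), (L : ℝ≥0∞)

theorem IsArc.lipDist_le {a b : X} {L : ℝ≥0} (h : IsArc ρ a b L) : lipDist ρ a b ≤ L :=
  iInf₂_le L h

theorem IsArc.trans (hρ : IsPseudo ρ) {a b c : X} {L M : ℝ≥0} (h : IsArc ρ a b L)
    (h' : IsArc ρ b c M) : IsArc ρ a c (L + M) := by
  obtain ⟨f, f0, f1, hf⟩ := h
  obtain ⟨g, g0, g1, hg⟩ := h'
  refine ⟨fun s => if s ≤ L then f s else g (s - L), by simp [f0], ?_, ?_⟩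
  · rcases eq_or_ne M 0 with rfl | hM
    · have : b = c := by rw [← g0, ← g1]; simp
      simp [f1, this]
    · have : ¬ ((L + M : ℝ≥0) : ℝ) ≤ L := by
        have : (0 : ℝ) < M := by positivity
        push_cast; linarith
      simp only [if_neg this, ← g1]; congr 1; push_cast; ring
  · intro s t hs hst ht
    push_cast at ht
    by_cases h1 : s ≤ L <;> by_cases h2 : t ≤ L <;> simp only [h1, h2, if_true, if_false]
    · exact hf s t hs hst h2
    · refine (hρ.triangle _ b _).trans ?_
      have e1 := hf s L hs h1 le_rfl
      have e2 := hg 0 (t - L) le_rfl (by linarith) (by linarith)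
      rw [f1] at e1
      rw [g0, sub_zero] at e2
      refine (add_le_add e1 e2).trans ?_
      rw [← ENNReal.ofReal_add (by linarith) (by linarith)]
      exact ENNReal.ofReal_le_ofReal (by linarith)
    · linarith
    · have := hg (s - L) (t - L) (by linarith) (by linarith) (by linarith)
      simpa using this

theorem IsArc.symm (hρ : IsPseudo ρ) {a b : X} {L : ℝ≥0} (h : IsArc ρ a b L) :
    IsArc ρ b a L := by
  obtain ⟨f, f0, f1, hf⟩ := h
  refine ⟨fun s => f (L - s), by simp [f1], by simp [f0], fun s t hs hst ht => ?_⟩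
  rw [hρ.symm]
  simpa using hf (L - t) (L - s) (by linarith) (by linarith) (by linarith)

theorem lipDist_triangle (hρ : IsPseudo ρ) (a b c : X) :
    lipDist ρ a c ≤ lipDist ρ a b + lipDist ρ b c := by
  simp only [lipDist, iInf_subtype']
  refine ENNReal.le_iInf_add_iInf fun L M => ?_
  refine iInf_le_of_le ⟨L + M, L.2.trans hρ M.2⟩ ?_
  push_cast; rfl

theorem lipDist_symm (hρ : IsPseudo ρ) (a b : X) : lipDist ρ a b = lipDist ρ b a :=
  le_antisymm (le_iInf₂ fun _ h => (h.symm hρ).lipDist_le)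
    (le_iInf₂ fun _ h => (h.symm hρ).lipDist_le)

theorem lipDist_self (hρ : IsPseudo ρ) (a : X) : lipDist ρ a a = 0 :=
  le_antisymm (IsArc.lipDist_le (L := 0) ⟨fun _ => a, rfl, rfl, fun _ _ _ _ _ => by
    rw [hρ.self]; exact bot_le⟩) bot_le

/-- The image of an arc under a map that scales distances by `1 / m`. -/
theorem lipDist_map_le {G : Type} {σ : G → G → ℝ≥0∞} (f : X → G) {m : ℕ} (hm : 0 < m)
    (hf : ∀ x y, σ (f x) (f y) ≤ ρ x y / m) (a b : X) :
    lipDist σ (f a) (f b) ≤ lipDist ρ a b / m := by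
  have hm' : (0 : ℝ) < m := by exact_mod_cast hm
  rw [ENNReal.le_div_iff_mul_le (Or.inl (by exact_mod_cast hm.ne')) (Or.inl (by simp))]
  refine le_iInf₂ fun L ⟨g, g0, g1, hg⟩ => ?_
  rw [← ENNReal.le_div_iff_mul_le (Or.inl (by exact_mod_cast hm.ne')) (Or.inl (by simp))]
  have harc : IsArc σ (f a) (f b) (L / m) := by
    refine ⟨fun s => f (g (s * m)), by simp [g0], ?_, fun s t hs hst ht => ?_⟩
    · simp only [NNReal.coe_div, NNReal.coe_natCast]
      rw [div_mul_cancel₀ _ hm'.ne', g1]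
    · push_cast at ht
      rw [le_div_iff₀ hm'] at ht
      refine (hf _ _).trans ?_
      rw [ENNReal.div_le_iff_le_mul (Or.inl (by exact_mod_cast hm.ne')) (Or.inl (by simp))]
      refine (hg _ _ (by positivity) (by gcongr) ht).trans (le_of_eq ?_)
      rw [← ENNReal.ofReal_natCast, ← ENNReal.ofReal_mul (by linarith)]
      congr 1; ring
  refine harc.lipDist_le.trans (le_of_eq ?_)
  rw [ENNReal.coe_div (by exact_mod_cast hm.ne')]
  simp

theorem lengthDist_le_lipDist (a b : X) (hρ : IsPseudo ρ) :
    lengthDist ρ a b ≤ lipDist ρ a b := by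
  refine le_iInf₂ fun L ⟨f, f0, f1, hf⟩ => ?_
  have hlip : ∀ s t : unitInterval, s ≤ t →
      ρ (f (L * s)) (f (L * t)) ≤ ENNReal.ofReal (L * (t - s)) := by
    intro s t hst
    have hst' : (s : ℝ) ≤ t := hst
    have := hf (L * s) (L * t) (mul_nonneg L.2 s.2.1) (mul_le_mul_of_nonneg_left hst' L.2)
      (mul_le_of_le_one_right L.2 t.2.2)
    rwa [← mul_sub] at this
  refine iInf₂_le_of_le (fun t : unitInterval => f (L * t)) ⟨fun t => ?_, by simp [f0], by
    simp [f1]⟩ ?_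
  · have hb : ∀ s : unitInterval, ρ (f (L * s)) (f (L * t)) ≤
        ENNReal.ofReal (L * |(t : ℝ) - s|) := by
      intro s
      rcases le_total s t with h | h <;> have h' := Subtype.coe_le_coe.2 h
      · rw [abs_of_nonneg (sub_nonneg.2 h')]; exact hlip s t h
      · rw [hρ.symm, abs_of_nonpos (sub_nonpos.2 h'), neg_sub]; exact hlip t s h
    refine tendsto_of_tendsto_of_tendsto_of_le_of_le tendsto_const_nhds ?_ (fun _ => bot_le) hb
    have : Filter.Tendsto (fun s : unitInterval => ENNReal.ofReal (L * |(t : ℝ) - s|)) (nhds t)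
        (nhds (ENNReal.ofReal (L * |(t : ℝ) - t|))) := by
      refine Continuous.tendsto ?_ t
      exact ENNReal.continuous_ofReal.comp (by fun_prop)
    simpa using this
  · refine iSup_le fun n => iSup_le fun t => iSup_le fun ⟨t0, t1, ht⟩ => ?_
    calc chainLength ρ n (fun k => f (L * t k))
        ≤ ∑ k ∈ Finset.range n, ENNReal.ofReal (L * ((t (k + 1) : ℝ) - t k)) := by
          refine Finset.sum_le_sum fun k hk => hlip _ _ ?_
          have := Finset.mem_range.1 hk
          exact (ht (Set.mem_Iic.2 (by omega)) (Set.mem_Iic.2 (by omega)) (Nat.lt_succ_self k)).le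
      _ = ENNReal.ofReal (∑ k ∈ Finset.range n, L * ((t (k + 1) : ℝ) - t k)) := by
          rw [ENNReal.ofReal_sum_of_nonneg]
          intro k hk
          have := Finset.mem_range.1 hk
          exact mul_nonneg L.2 (sub_nonneg.2
            (ht (Set.mem_Iic.2 (by omega)) (Set.mem_Iic.2 (by omega)) (Nat.lt_succ_self k)).le)
      _ = L := by
          rw [← Finset.mul_sum, Finset.sum_range_sub (fun k => (t k : ℝ)), t0, t1]
          simp

theorem iterDist_le_lipDist (h : IsPseudo ρ) (k : ℕ) (a b : X) :
    iterDist ρ k a b ≤ lipDist ρ a b :=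
  (iterDist_le_lengthDist h k a b).trans (lengthDist_le_lipDist a b h)

end

/-! ### The metric of the glued space -/

/-- The position in the copy number `l` of a row of the point `ξ` of the copy number `i`: the
projection to that copy collapses the copies before it to `p` and those after it to `q`. -/
def colPt (X : Bipointed) (l i : ℕ) (ξ : X.carrier) : X.carrier :=
  if i < l then X.p else if i = l then ξ else X.q

@[simp] theorem colPt_self (X : Bipointed) (l : ℕ) (ξ : X.carrier) : colPt X l l ξ = ξ := by
  simp [colPt]

theorem colPt_of_lt {X : Bipointed} {l i : ℕ} (h : i < l) (ξ : X.carrier) :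
    colPt X l i ξ = X.p := by
  simp [colPt, h]

theorem colPt_of_gt {X : Bipointed} {l i : ℕ} (h : l < i) (ξ : X.carrier) :
    colPt X l i ξ = X.q := by
  simp [colPt, not_lt.2 h.le, h.ne']

theorem colPt_zero_p (X : Bipointed) (l : ℕ) : colPt X l 0 X.p = X.p := by
  rcases Nat.eq_zero_or_pos l with rfl | h
  · simp
  · exact colPt_of_lt h _

theorem colPt_last_q (X : Bipointed) {m l : ℕ} (h : l < m) : colPt X l (m - 1) X.q = X.q := by
  rcases (Nat.le_sub_one_of_lt h).eq_or_lt with rfl | h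
  · simp
  · exact colPt_of_gt h _

theorem colPt_next (X : Bipointed) (l j : ℕ) : colPt X l j X.q = colPt X l (j + 1) X.p := by
  rcases lt_trichotomy j l with h | rfl | h
  · rw [colPt_of_lt h]
    rcases (Nat.succ_le_of_lt h).eq_or_lt with rfl | h'
    · simp
    · rw [colPt_of_lt h']
  · rw [colPt_self, colPt_of_gt (Nat.lt_succ_self _)]
  · rw [colPt_of_gt h, colPt_of_gt (by omega)]

section
variable (X : Bipointed)

/-- The projection of a point of a row to the copy number `l` of this row. -/
def proj (l : ℕ) (a : Copies X) : X.carrier := colPt X l a.2.1 a.2.2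

/-- The distance of two points of a row measured along this row. -/
def rowDist (a b : Copies X) : ℝ≥0∞ :=
  (∑ l ∈ Finset.range a.1, X.d (proj X l a) (proj X l b)) / (a.1 : ℕ)

/-- The distance to the initial point of the row. -/
def distP (a : Copies X) : ℝ≥0∞ :=
  (∑ l ∈ Finset.range a.1, X.d (proj X l a) X.p) / (a.1 : ℕ)

/-- The distance to the final point of the row. -/
def distQ (a : Copies X) : ℝ≥0∞ :=
  (∑ l ∈ Finset.range a.1, X.d (proj X l a) X.q) / (a.1 : ℕ)

/-- An explicit formula for the distance of the glued space: two points of the same row are joined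
along the row, and points of different rows through one of the two common points. -/
def copiesDist (a b : Copies X) : ℝ≥0∞ :=
  if a.1 = b.1 then rowDist X a b else min (distP X a + distP X b) (distQ X a + distQ X b)

variable {X} (hX : IsPseudo X.d)
include hX

theorem rowDist_triangle {a b c : Copies X} (h : a.1 = b.1) :
    rowDist X a c ≤ rowDist X a b + rowDist X b c := by
  rw [rowDist, rowDist, rowDist, ← h, ENNReal.div_add_div_same, ← Finset.sum_add_distrib]
  gcongr
  exact hX.triangle _ _ _

theorem rowDist_symm {a b : Copies X} (h : a.1 = b.1) : rowDist X a b = rowDist X b a := by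
  rw [rowDist, rowDist, ← h]
  simp only [hX.symm]

theorem distP_le {a b : Copies X} (h : a.1 = b.1) : distP X a ≤ rowDist X a b + distP X b := by
  rw [rowDist, distP, distP, ← h, ENNReal.div_add_div_same, ← Finset.sum_add_distrib]
  gcongr
  exact hX.triangle _ _ _

theorem distQ_le {a b : Copies X} (h : a.1 = b.1) : distQ X a ≤ rowDist X a b + distQ X b := by
  rw [rowDist, distQ, distQ, ← h, ENNReal.div_add_div_same, ← Finset.sum_add_distrib]
  gcongr
  exact hX.triangle _ _ _

theorem rowDist_le_distP {a b : Copies X} (h : a.1 = b.1) :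
    rowDist X a b ≤ distP X a + distP X b := by
  rw [rowDist, distP, distP, ← h, ENNReal.div_add_div_same, ← Finset.sum_add_distrib]
  gcongr
  rw [hX.symm (proj X _ b)]
  exact hX.triangle _ _ _

theorem rowDist_le_distQ {a b : Copies X} (h : a.1 = b.1) :
    rowDist X a b ≤ distQ X a + distQ X b := by
  rw [rowDist, distQ, distQ, ← h, ENNReal.div_add_div_same, ← Finset.sum_add_distrib]
  gcongr
  rw [hX.symm (proj X _ b)]
  exact hX.triangle _ _ _

variable (hpq : X.d X.p X.q = 1)

omit hX in
theorem sum_const_div (m : ℕ+) (r : ℝ≥0∞) :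
    (∑ _l ∈ Finset.range (m : ℕ), r) / ((m : ℕ) : ℝ≥0∞) = r := by
  rw [Finset.sum_const, Finset.card_range, nsmul_eq_mul]
  rw [mul_comm, ENNReal.mul_div_cancel_right (by simp) (by simp)]

include hpq

theorem one_le_distP_add_distQ (a : Copies X) : 1 ≤ distP X a + distQ X a := by
  rw [distP, distQ, ENNReal.div_add_div_same, ← Finset.sum_add_distrib, ← sum_const_div a.1 1]
  gcongr
  rw [← hpq, hX.symm _ X.p]
  exact hX.triangle _ _ _

theorem distP_le_distQ_add_one (a : Copies X) : distP X a ≤ distQ X a + 1 := by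
  rw [distP, distQ, ← sum_const_div a.1 1, ENNReal.div_add_div_same, ← Finset.sum_add_distrib]
  gcongr
  rw [← hpq, hX.symm X.p X.q]
  exact hX.triangle _ _ _

theorem distQ_le_distP_add_one (a : Copies X) : distQ X a ≤ distP X a + 1 := by
  rw [distP, distQ, ← sum_const_div a.1 1, ENNReal.div_add_div_same, ← Finset.sum_add_distrib]
  gcongr
  rw [← hpq]
  exact hX.triangle _ _ _

theorem copiesDist_isPseudo : IsPseudo (copiesDist X) where
  self a := by simp [copiesDist, rowDist, hX.self]
  symm a b := by
    unfold copiesDist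
    by_cases h : a.1 = b.1
    · rw [if_pos h, if_pos h.symm, rowDist_symm hX h]
    · rw [if_neg h, if_neg (Ne.symm h), add_comm, add_comm (distQ X a)]
  triangle a b c := by
    -- the distance is at most that of a connection through one of the common points
    have via : ∀ a b, copiesDist X a b ≤ min (distP X a + distP X b) (distQ X a + distQ X b) := by
      intro a b
      unfold copiesDist
      split_ifs with h
      · exact le_min (rowDist_le_distP hX h) (rowDist_le_distQ hX h)
      · exact le_rfl
    by_cases hab : a.1 = b.1 <;> by_cases hbc : b.1 = c.1
    · simp only [copiesDist, hab, hbc, if_true]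
      exact rowDist_triangle hX hab
    · simp only [copiesDist, hab, hbc, if_true, if_false]
      rw [← min_add_add_left]
      refine min_le_min ?_ ?_ <;> rw [← add_assoc] <;> gcongr
      · exact distP_le hX hab
      · exact distQ_le hX hab
    · have hac : a.1 ≠ c.1 := hbc ▸ hab
      simp only [copiesDist, hbc, hac, if_true, if_false]
      rw [← min_add_add_right]
      refine min_le_min ?_ ?_ <;> rw [add_assoc] <;> gcongr
      · rw [add_comm, rowDist_symm hX hbc]; exact distP_le hX hbc.symm
      · rw [add_comm, rowDist_symm hX hbc]; exact distQ_le hX hbc.symm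
    · refine (via a c).trans ?_
      rw [copiesDist, copiesDist, if_neg hab, if_neg hbc]
      have e1 := one_le_distP_add_distQ hX hpq b
      rcases min_choice (distP X a + distP X b) (distQ X a + distQ X b) with h1 | h1 <;>
        rcases min_choice (distP X b + distP X c) (distQ X b + distQ X c) with h2 | h2 <;>
        rw [h1, h2]
      · exact (min_le_left _ _).trans (add_le_add le_self_add le_add_self)
      · refine (min_le_left _ _).trans ?_
        calc distP X a + distP X c ≤ distP X a + (distQ X c + 1) := by
              gcongr; exact distP_le_distQ_add_one hX hpq c
          _ ≤ distP X a + (distQ X c + (distP X b + distQ X b)) := by gcongr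
          _ = _ := by ring
      · refine (min_le_right _ _).trans ?_
        calc distQ X a + distQ X c ≤ distQ X a + (distP X c + 1) := by
              gcongr; exact distQ_le_distP_add_one hX hpq c
          _ ≤ distQ X a + (distP X c + (distP X b + distQ X b)) := by gcongr
          _ = _ := by ring
      · exact (min_le_right _ _).trans (add_le_add le_self_add le_add_self)

omit hpq in
theorem copiesDist_glueRel {a b : Copies X} (h : GlueRel X a b) : copiesDist X a b = 0 := by
  cases h with
  | next m j h => simp [copiesDist, rowDist, proj, colPt_next, hX.self]
  | first m m' =>
    unfold copiesDist
    split_ifs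
    · simp [rowDist, proj, colPt_zero_p, hX.self]
    · simp [distP, proj, colPt_zero_p, hX.self]
  | last m m' =>
    have hp : ∀ m : ℕ+, distQ X ⟨m, ⟨(m : ℕ) - 1, Nat.sub_lt m.pos Nat.one_pos⟩, X.q⟩ = 0 := by
      intro m
      rw [distQ, Finset.sum_eq_zero, ENNReal.zero_div]
      intro l hl
      simp only [proj]
      rw [colPt_last_q X (Finset.mem_range.1 hl), hX.self]
    unfold copiesDist
    split_ifs with h
    · exact le_antisymm ((rowDist_le_distQ hX h).trans (by rw [hp, hp, add_zero])) bot_le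
    · exact le_antisymm ((min_le_right _ _).trans (by rw [hp, hp, add_zero])) bot_le

theorem copiesDist_eq_zero {a b : Copies X}
    (h : (Quot.mk (GlueRel X) a) = Quot.mk (GlueRel X) b) : copiesDist X a b = 0 := by
  have hD := copiesDist_isPseudo hX hpq
  have h' := Quot.eqvGen_exact h
  clear h
  induction h' with
  | rel a b h => exact copiesDist_glueRel hX h
  | refl a => exact hD.self a
  | symm a b _ ih => rw [hD.symm]; exact ih
  | trans a b c _ _ ih1 ih2 =>
    refine le_antisymm ((hD.triangle a b c).trans ?_) bot_le
    rw [ih1, ih2, add_zero]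

end

theorem gluedDist_eq_iInf (X : Bipointed) (a b : Glued X) :
    gluedDist X a b = ⨅ L : {L // EpsPath (stepDist X) ∞ a b L}, (L : ℝ≥0∞) := by
  refine le_antisymm (le_iInf fun ⟨L, p⟩ => ?_) ?_
  · obtain ⟨n, c, ⟨h0, h1, -⟩, rfl⟩ := p.exists_chain
    exact iInf_le_of_le n (iInf_le_of_le c (iInf_le_of_le ⟨h0, h1⟩ le_rfl))
  · refine le_iInf fun n => le_iInf fun c => le_iInf fun h => ?_
    exact iInf_le_of_le ⟨_, .of_chain ⟨h.1, h.2, fun _ _ => le_top⟩⟩ le_rfl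

theorem stepDist_symm {X : Bipointed} (hX : IsPseudo X.d) (a b : Glued X) :
    stepDist X a b = stepDist X b a := by
  have : ∀ a b, stepDist X a b ≤ stepDist X b a := fun a b =>
    le_iInf fun m => le_iInf fun j => le_iInf fun x => le_iInf fun y => le_iInf fun h =>
      iInf_le_of_le m (iInf_le_of_le j (iInf_le_of_le y (iInf_le_of_le x
        (iInf_le_of_le h.symm (by rw [hX.symm])))))
  exact le_antisymm (this a b) (this b a)

theorem gluedDist_isPseudo {X : Bipointed} (hX : IsPseudo X.d) : IsPseudo (gluedDist X) where
  self a := by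
    rw [gluedDist_eq_iInf]
    exact le_antisymm (iInf_le_of_le ⟨0, .nil a⟩ le_rfl) bot_le
  symm a b := by
    have : ∀ a b, gluedDist X a b ≤ gluedDist X b a := by
      intro a b
      rw [gluedDist_eq_iInf, gluedDist_eq_iInf]
      exact le_iInf fun L => iInf_le_of_le ⟨L, L.2.reverse (stepDist_symm hX)⟩ le_rfl
    exact le_antisymm (this a b) (this b a)
  triangle a b c := by
    simp only [gluedDist_eq_iInf]
    exact ENNReal.le_iInf_add_iInf fun L M => iInf_le_of_le ⟨_, L.2.append M.2⟩ le_rfl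

theorem gluedDist_inCopy_le (X : Bipointed) (m : ℕ+) (j : Fin m) (x y : X.carrier) :
    gluedDist X (inCopy X m j x) (inCopy X m j y) ≤ X.d x y / (m : ℕ) := by
  rw [gluedDist_eq_iInf]
  refine iInf_le_of_le ⟨_, .single le_top⟩ ?_
  exact iInf_le_of_le m (iInf_le_of_le j (iInf_le_of_le x (iInf_le_of_le y
    (iInf_le_of_le ⟨rfl, rfl⟩ le_rfl))))

section
variable {X : Bipointed}

theorem inCopy_next (m : ℕ+) (j : ℕ) (h : j + 1 < (m : ℕ)) :
    inCopy X m ⟨j, Nat.lt_of_succ_lt h⟩ X.q = inCopy X m ⟨j + 1, h⟩ X.p :=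
  Quot.sound (.next m j h)

theorem inCopy_zero_p (m : ℕ+) : inCopy X m ⟨0, m.pos⟩ X.p = (incl X X.p) :=
  Quot.sound (.first m 1)

theorem inCopy_last_q (m : ℕ+) :
    inCopy X m ⟨(m : ℕ) - 1, Nat.sub_lt m.pos Nat.one_pos⟩ X.q = (incl X X.q) :=
  Quot.sound (.last m 1)

theorem exists_inCopy (u : Glued X) : ∃ m i ξ, u = inCopy X m i ξ := by
  induction u using Quot.ind with
  | mk a => exact ⟨a.1, a.2.1, a.2.2, rfl⟩

variable (hX : IsPseudo X.d)
include hX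

/-- Two points of the same copy differ only in the position in this copy. -/
theorem sum_colPt_same {m j : ℕ} (hj : j < m) (x y : X.carrier) :
    ∑ l ∈ Finset.range m, X.d (colPt X l j x) (colPt X l j y) = X.d x y := by
  rw [Finset.sum_eq_single j]
  · simp
  · intro l _ hl
    rcases lt_or_gt_of_ne hl with h | h
    · simp [colPt_of_gt h, hX.self]
    · simp [colPt_of_lt h, hX.self]
  · intro h; exact absurd (Finset.mem_range.2 hj) h

theorem gluedDist_le_rowDist_aux (m : ℕ+) (i j : Fin m) (ξ ζ : X.carrier) (l : ℕ) (hil : i ≤ l)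
    (hlj : l ≤ j) :
    gluedDist X (inCopy X m i ξ) (inCopy X m ⟨l, hlj.trans_lt j.2⟩ (colPt X l j ζ)) ≤
      (∑ k ∈ Finset.range (l + 1), X.d (colPt X k i ξ) (colPt X k j ζ)) / (m : ℕ) := by
  have hG := gluedDist_isPseudo hX
  induction l, hil using Nat.le_induction with
  | base =>
    refine (gluedDist_inCopy_le X m i ξ _).trans ?_
    gcongr
    rw [Finset.sum_range_succ, colPt_self]
    exact le_add_self
  | succ l hil ih =>
    have h1 := ih (by omega)
    refine (hG.triangle _ _ _).trans ((add_le_add h1 ?_).trans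
      (le_of_eq (by rw [ENNReal.div_add_div_same, ← Finset.sum_range_succ])))
    rw [colPt_of_gt (show l < (j : ℕ) by omega), inCopy_next m l (by omega),
      colPt_of_lt (show (i : ℕ) < l + 1 by omega)]
    exact gluedDist_inCopy_le X m _ _ _

theorem gluedDist_le_rowDist (a b : Copies X) (h : a.1 = b.1) :
    gluedDist X (Quot.mk _ a) (Quot.mk _ b) ≤ rowDist X a b := by
  have hG := gluedDist_isPseudo hX
  have key : ∀ (m : ℕ+) (i j : Fin m) (ξ ζ : X.carrier), i ≤ j →
      gluedDist X (inCopy X m i ξ) (inCopy X m j ζ) ≤ rowDist X ⟨m, i, ξ⟩ ⟨m, j, ζ⟩ := by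
    intro m i j ξ ζ hij
    have := gluedDist_le_rowDist_aux hX m i j ξ ζ j hij le_rfl
    simp only [colPt_self] at this
    refine this.trans ?_
    rw [rowDist]
    refine ENNReal.div_le_div_right (Finset.sum_le_sum_of_subset ?_) _
    exact Finset.range_subset_range.2 (Nat.succ_le_of_lt j.2)
  obtain ⟨m, i, ξ⟩ := a
  obtain ⟨m', j, ζ⟩ := b
  obtain rfl : m = m' := h
  rcases le_total i j with hij | hij
  · exact key m i j ξ ζ hij
  · rw [hG.symm, rowDist_symm hX (a := ⟨m, i, ξ⟩) (b := ⟨m, j, ζ⟩) rfl]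
    exact key m j i ζ ξ hij

theorem gluedDist_le_distP (a : Copies X) :
    gluedDist X (Quot.mk _ a) (incl X X.p) ≤ distP X a := by
  rw [← inCopy_zero_p a.1]
  refine (gluedDist_le_rowDist hX a ⟨a.1, ⟨0, a.1.pos⟩, X.p⟩ rfl).trans (le_of_eq ?_)
  simp [rowDist, distP, proj, colPt_zero_p]

theorem gluedDist_le_distQ (a : Copies X) :
    gluedDist X (Quot.mk _ a) (incl X X.q) ≤ distQ X a := by
  rw [← inCopy_last_q a.1]
  refine (gluedDist_le_rowDist hX a ⟨a.1, ⟨a.1 - 1, Nat.sub_lt a.1.pos Nat.one_pos⟩, X.q⟩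
    rfl).trans (le_of_eq ?_)
  rw [rowDist, distQ]
  congr 1
  refine Finset.sum_congr rfl fun l hl => ?_
  simp only [proj]
  rw [colPt_last_q X (Finset.mem_range.1 hl)]

variable (hpq : X.d X.p X.q = 1)
include hpq

theorem gluedDist_mk (a b : Copies X) :
    gluedDist X (Quot.mk _ a) (Quot.mk _ b) = copiesDist X a b := by
  have hG := gluedDist_isPseudo hX
  have hD := copiesDist_isPseudo hX hpq
  have hout : ∀ a b : Copies X,
      copiesDist X a b ≤ copiesDist X (Quot.mk (GlueRel X) a).out (Quot.mk (GlueRel X) b).out := by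
    intro a b
    have e1 := copiesDist_eq_zero hX hpq (Quot.out_eq (Quot.mk (GlueRel X) a))
    have e2 := copiesDist_eq_zero hX hpq (Quot.out_eq (Quot.mk (GlueRel X) b))
    rw [hD.symm] at e1
    refine (hD.triangle a (Quot.mk (GlueRel X) a).out b).trans ?_
    rw [e1, zero_add]
    refine (hD.triangle _ (Quot.mk (GlueRel X) b).out b).trans ?_
    rw [e2, add_zero]
  have hout' : ∀ a b : Copies X,
      copiesDist X (Quot.mk (GlueRel X) a).out (Quot.mk (GlueRel X) b).out ≤ copiesDist X a b := by
    intro a b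
    have e1 := copiesDist_eq_zero hX hpq (Quot.out_eq (Quot.mk (GlueRel X) a))
    have e2 := copiesDist_eq_zero hX hpq (Quot.out_eq (Quot.mk (GlueRel X) b))
    rw [hD.symm] at e2
    refine (hD.triangle _ a _).trans ?_
    rw [e1, zero_add]
    refine (hD.triangle a b _).trans ?_
    rw [e2, add_zero]
  refine le_antisymm ?_ ((hout a b).trans ?_)
  · unfold copiesDist
    split_ifs with h
    · exact gluedDist_le_rowDist hX a b h
    · refine le_min ?_ ?_
      · refine (hG.triangle _ (incl X X.p) _).trans (add_le_add (gluedDist_le_distP hX a) ?_)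
        rw [hG.symm _ (Quot.mk _ b)]; exact gluedDist_le_distP hX b
      · refine (hG.triangle _ (incl X X.q) _).trans (add_le_add (gluedDist_le_distQ hX a) ?_)
        rw [hG.symm _ (Quot.mk _ b)]; exact gluedDist_le_distQ hX b
  · rw [gluedDist_eq_iInf]
    refine le_iInf fun ⟨L, p⟩ => ?_
    have : ∀ (u v : Glued X) (L : ℝ≥0∞), EpsPath (stepDist X) ∞ u v L →
        copiesDist X u.out v.out ≤ L := by
      intro u v L p
      induction p with
      | nil => rw [hD.self]
      | cons h _ ih =>
        refine (hD.triangle _ _ _).trans (add_le_add ?_ ih)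
        · refine le_iInf fun m => le_iInf fun j => le_iInf fun x => le_iInf fun y =>
            le_iInf fun h => ?_
          obtain ⟨rfl, rfl⟩ := h
          refine (hout' ⟨m, j, x⟩ ⟨m, j, y⟩).trans ?_
          simp only [copiesDist, if_true, rowDist]
          gcongr
          exact (sum_colPt_same hX j.2 x y).le
    exact this _ _ _ p

theorem gluedDist_row (m : ℕ+) (i j : Fin m) (ξ ζ : X.carrier) :
    gluedDist X (inCopy X m i ξ) (inCopy X m j ζ) =
      (∑ l ∈ Finset.range m, X.d (colPt X l i ξ) (colPt X l j ζ)) / (m : ℕ) := by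
  refine (gluedDist_mk hX hpq ⟨m, i, ξ⟩ ⟨m, j, ζ⟩).trans ?_
  simp [copiesDist, rowDist, proj]

theorem gluedDist_inCopy (m : ℕ+) (i : Fin m) (ξ ζ : X.carrier) :
    gluedDist X (inCopy X m i ξ) (inCopy X m i ζ) = X.d ξ ζ / (m : ℕ) := by
  rw [gluedDist_row hX hpq, sum_colPt_same hX i.2]

theorem gluedDist_incl (x y : X.carrier) : gluedDist X (incl X x) (incl X y) = X.d x y := by
  rw [incl, incl, gluedDist_inCopy hX hpq]
  simp

theorem gluedDist_distP (a : Copies X) :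
    gluedDist X (Quot.mk _ a) (incl X X.p) = distP X a := by
  refine le_antisymm (gluedDist_le_distP hX a) ?_
  rw [← inCopy_zero_p a.1]
  refine le_of_eq (Eq.trans ?_ (gluedDist_mk hX hpq a ⟨a.1, ⟨0, a.1.pos⟩, X.p⟩).symm)
  simp [copiesDist, rowDist, distP, proj, colPt_zero_p]

theorem gluedDist_distQ (a : Copies X) :
    gluedDist X (Quot.mk _ a) (incl X X.q) = distQ X a := by
  refine le_antisymm (gluedDist_le_distQ hX a) ?_
  rw [← inCopy_last_q a.1]
  refine le_of_eq (Eq.trans ?_ (gluedDist_mk hX hpq a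
    ⟨a.1, ⟨a.1 - 1, Nat.sub_lt a.1.pos Nat.one_pos⟩, X.q⟩).symm)
  simp only [copiesDist, rowDist, distQ, proj, if_true]
  congr 1
  refine Finset.sum_congr rfl fun l hl => ?_
  rw [colPt_last_q X (Finset.mem_range.1 hl)]

/-- The row number `m` of the glued space. -/
def row (X : Bipointed) (m : ℕ+) : Set (Glued X) := {u | ∃ i ξ, u = inCopy X m i ξ}

omit hX hpq in
theorem inCopy_mem_row (m : ℕ+) (i : Fin m) (ξ : X.carrier) : inCopy X m i ξ ∈ row X m :=
  ⟨i, ξ, rfl⟩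

omit hX hpq in
theorem incl_p_mem_row (m : ℕ+) : incl X X.p ∈ row X m := ⟨_, _, (inCopy_zero_p m).symm⟩

omit hX hpq in
theorem incl_q_mem_row (m : ℕ+) : incl X X.q ∈ row X m := ⟨_, _, (inCopy_last_q m).symm⟩

/-- The common points of the rows separate each row from the others. -/
theorem gluedDist_separated (m : ℕ+) : ∀ u ∈ row X m, ∀ v ∉ row X m,
    min (gluedDist X u (incl X X.p) + gluedDist X (incl X X.p) v)
      (gluedDist X u (incl X X.q) + gluedDist X (incl X X.q) v) ≤ gluedDist X u v := by
  rintro u ⟨i, ξ, rfl⟩ v hv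
  have hG := gluedDist_isPseudo hX
  obtain ⟨m', j, ζ, rfl⟩ := exists_inCopy v
  have hm : m ≠ m' := by rintro rfl; exact hv (inCopy_mem_row _ _ _)
  rw [hG.symm (incl X X.p), hG.symm (incl X X.q)]
  unfold inCopy
  rw [gluedDist_distP hX hpq, gluedDist_distQ hX hpq, gluedDist_distP hX hpq,
    gluedDist_distQ hX hpq, gluedDist_mk hX hpq, copiesDist, if_neg hm]

theorem gluedDist_p_q : gluedDist X (incl X X.p) (incl X X.q) = 1 := by
  rw [gluedDist_incl hX hpq, hpq]

end

/-- A point of a row is determined by its projections to the copies. -/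
theorem inCopy_eq_of_colPt_eq {X : Bipointed} (hne : X.p ≠ X.q) {m : ℕ+} {i j : Fin m}
    {ξ ζ : X.carrier} (h : ∀ l < (m : ℕ), colPt X l i ξ = colPt X l j ζ) :
    inCopy X m i ξ = inCopy X m j ζ := by
  have key : ∀ (i j : Fin m) (ξ ζ : X.carrier), i < j →
      (∀ l < (m : ℕ), colPt X l i ξ = colPt X l j ζ) → inCopy X m i ξ = inCopy X m j ζ := by
    intro i j ξ ζ hij h
    have hij' : (i : ℕ) < j := hij
    have h1 := h i i.2
    rw [colPt_self, colPt_of_gt hij'] at h1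
    have h2 := h j j.2
    rw [colPt_self, colPt_of_lt hij'] at h2
    have h3 : (i : ℕ) + 1 = j := by
      by_contra hne'
      have h4 := h (i + 1) (by omega)
      rw [colPt_of_lt (Nat.lt_succ_self _), colPt_of_gt (by omega)] at h4
      exact hne h4
    subst h1 h2
    have := inCopy_next (X := X) m i (by omega)
    rw [this]
    congr 1
    exact Fin.ext h3
  rcases lt_trichotomy i j with hij | rfl | hij
  · exact key i j ξ ζ hij h
  · have := h i i.2
    rw [colPt_self, colPt_self] at this
    rw [this]
  · exact (key j i ζ ξ hij fun l hl => (h l hl).symm).symm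

theorem gluedDist_isMetric {X : Bipointed} (hX : IsMetric X.d) (hpq : X.d X.p X.q = 1) :
    IsMetric (gluedDist X) where
  finite u v := by
    induction u using Quot.ind with | mk a => ?_
    induction v using Quot.ind with | mk b => ?_
    have hfin : ∀ (m : ℕ+) (f g : ℕ → X.carrier),
        (∑ l ∈ Finset.range m, X.d (f l) (g l)) / ((m : ℕ) : ℝ≥0∞) ≠ ∞ := fun m f g =>
      ENNReal.div_ne_top (ENNReal.sum_ne_top.2 fun l _ => hX.finite _ _) (by simp)
    rw [gluedDist_mk hX.isPseudo hpq, copiesDist]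
    split_ifs
    · exact hfin _ _ _
    · exact ne_top_of_le_ne_top (ENNReal.add_ne_top.2
        ⟨hfin a.1 (fun l => proj X l a) fun _ => X.p, hfin b.1 (fun l => proj X l b) fun _ => X.p⟩)
        (min_le_left _ _)
  eq_zero_iff u v := by
    have hne : X.p ≠ X.q := by
      intro h
      rw [h, hX.isPseudo.self] at hpq
      exact zero_ne_one hpq
    refine ⟨fun h => ?_, fun h => h ▸ (gluedDist_isPseudo hX.isPseudo).self u⟩
    have hrow : ∀ {m : ℕ+} {i j : Fin m} {ξ ζ : X.carrier},
        gluedDist X (inCopy X m i ξ) (inCopy X m j ζ) = 0 → inCopy X m i ξ = inCopy X m j ζ := by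
      intro m i j ξ ζ h
      rw [gluedDist_row hX.isPseudo hpq, ENNReal.div_eq_zero_iff, Finset.sum_eq_zero_iff] at h
      refine inCopy_eq_of_colPt_eq hne fun l hl => (hX.eq_zero_iff _ _).1 ?_
      exact (h.resolve_right (by simp)) l (Finset.mem_range.2 hl)
    have hcommon : ∀ {w : Glued X}, (∀ m, w ∈ row X m) → ∀ u, gluedDist X u w = 0 → u = w := by
      intro w hw u hu
      obtain ⟨m, i, ξ, rfl⟩ := exists_inCopy u
      obtain ⟨j, ζ, rfl⟩ := hw m
      exact hrow hu
    obtain ⟨m, i, ξ, rfl⟩ := exists_inCopy u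
    by_cases hv : v ∈ row X m
    · obtain ⟨j, ζ, rfl⟩ := hv
      exact hrow h
    · have hs := gluedDist_separated hX.isPseudo hpq m _ (inCopy_mem_row m i ξ) v hv
      rw [h] at hs
      have hv' := (gluedDist_isPseudo hX.isPseudo).symm v
      rcases min_le_iff.1 hs with hs | hs <;>
        rw [nonpos_iff_eq_zero, add_eq_zero] at hs
      · rw [hcommon incl_p_mem_row _ hs.1, hcommon incl_p_mem_row v (by rw [hv', hs.2])]
      · rw [hcommon incl_q_mem_row _ hs.1, hcommon incl_q_mem_row v (by rw [hv', hs.2])]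
  symm := (gluedDist_isPseudo hX.isPseudo).symm
  triangle := (gluedDist_isPseudo hX.isPseudo).triangle

/-! ### Completeness -/

/-- It suffices to find cluster points of those Cauchy sequences that stay away from two given
points, by more than the diameter of the sequence. -/
theorem isComplete_of_far {X : Type} {ρ : X → X → ℝ≥0∞} (hρ : IsPseudo ρ) (p q : X)
    (h : ∀ (u : ℕ → X) (δ : ℝ≥0∞), 0 < δ →
      (∀ ε : ℝ≥0∞, 0 < ε → ∃ N : ℕ, ∀ i ≥ N, ∀ j ≥ N, ρ (u i) (u j) < ε) →
      (∀ i, δ ≤ ρ (u i) p) → (∀ i, δ ≤ ρ (u i) q) → (∀ i j, ρ (u i) (u j) < δ) →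
      ∃ x, ∀ ε : ℝ≥0∞, 0 < ε → ∀ N, ∃ i ≥ N, ρ (u i) x < ε) : IsComplete ρ := by
  intro u hu
  have cluster : ∀ x, (∀ ε : ℝ≥0∞, 0 < ε → ∀ N, ∃ i ≥ N, ρ (u i) x < ε) →
      Filter.Tendsto (fun i => ρ (u i) x) Filter.atTop (nhds 0) := by
    intro x hx
    rw [ENNReal.tendsto_nhds_zero]
    intro ε hε
    obtain ⟨N, hN⟩ := hu (ε / 2) (ENNReal.half_pos hε.ne')
    obtain ⟨j, hj, hjx⟩ := hx (ε / 2) (ENNReal.half_pos hε.ne') N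
    filter_upwards [Filter.eventually_ge_atTop N] with i hi
    calc ρ (u i) x ≤ ρ (u i) (u j) + ρ (u j) x := hρ.triangle _ _ _
      _ ≤ ε / 2 + ε / 2 := add_le_add (hN i hi j hj).le hjx.le
      _ = ε := ENNReal.add_halves ε
  by_cases hp : ∀ ε : ℝ≥0∞, 0 < ε → ∀ N, ∃ i ≥ N, ρ (u i) p < ε
  · exact ⟨p, cluster p hp⟩
  by_cases hq : ∀ ε : ℝ≥0∞, 0 < ε → ∀ N, ∃ i ≥ N, ρ (u i) q < ε
  · exact ⟨q, cluster q hq⟩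
  push Not at hp hq
  obtain ⟨δ₁, hδ₁, N₁, h₁⟩ := hp
  obtain ⟨δ₂, hδ₂, N₂, h₂⟩ := hq
  obtain ⟨N₃, h₃⟩ := hu (min δ₁ δ₂) (lt_min hδ₁ hδ₂)
  obtain ⟨x, hx⟩ := h (fun i => u (i + (N₁ + N₂ + N₃))) (min δ₁ δ₂) (lt_min hδ₁ hδ₂)
    (fun ε hε => by
      obtain ⟨N, hN⟩ := hu ε hε
      exact ⟨N, fun i hi j hj => hN _ (by omega) _ (by omega)⟩)
    (fun i => (min_le_left _ _).trans (h₁ _ (by omega)))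
    (fun i => (min_le_right _ _).trans (h₂ _ (by omega)))
    (fun i j => h₃ _ (by omega) _ (by omega))
  refine ⟨x, cluster x fun ε hε N => ?_⟩
  obtain ⟨i, hi, hix⟩ := hx ε hε N
  exact ⟨_, by omega, hix⟩

theorem gluedDist_isComplete {X : Bipointed} (hX : IsMetric X.d) (hpq : X.d X.p X.q = 1)
    (hc : IsComplete X.d) : IsComplete (gluedDist X) := by
  have hG := gluedDist_isPseudo hX.isPseudo
  refine isComplete_of_far hG (incl X X.p) (incl X X.q) fun u δ hδ hu hp hq hd => ?_
  obtain ⟨m, hm⟩ : ∃ m, u 0 ∈ row X m := by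
    obtain ⟨m, i, ξ, h⟩ := exists_inCopy (u 0)
    exact ⟨m, i, ξ, h⟩
  have hrow : ∀ i, u i ∈ row X m := by
    intro i
    by_contra hi
    refine absurd (hd 0 i) (not_lt.2 (le_trans (le_min ?_ ?_)
      (gluedDist_separated hX.isPseudo hpq m _ hm _ hi)))
    · exact (hp 0).trans le_self_add
    · exact (hq 0).trans le_self_add
  choose col ξ hξ using hrow
  -- one of the finitely many copies of the row contains a subsequence
  obtain ⟨l, hl⟩ : ∃ l, ∃ᶠ i in Filter.atTop, col i = l := by
    by_contra! H
    obtain ⟨i, hi⟩ := (Filter.eventually_all.2 H).exists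
    exact hi _ rfl
  obtain ⟨φ, hφ, hl⟩ := Filter.extraction_of_frequently_atTop hl
  have hm0 : ((m : ℕ) : ℝ≥0∞) ≠ 0 := by simp
  obtain ⟨x, hx⟩ := hc (fun k => ξ (φ k)) (by
    intro ε hε
    obtain ⟨N, hN⟩ := hu (ε / (m : ℕ)) (ENNReal.div_pos hε.ne' (by simp))
    refine ⟨N, fun i hi j hj => ?_⟩
    have := hN (φ i) (hi.trans (hφ.id_le i)) (φ j) (hj.trans (hφ.id_le j))
    rw [hξ (φ i), hξ (φ j), hl i, hl j, gluedDist_inCopy hX.isPseudo hpq] at this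
    exact (ENNReal.div_lt_div_iff_left hm0 (by simp)).1 this)
  refine ⟨inCopy X m l x, fun ε hε N => ?_⟩
  rw [ENNReal.tendsto_nhds_zero] at hx
  obtain ⟨ε', hε', hlt⟩ := exists_between hε
  obtain ⟨k, hk, hkN⟩ := ((hx ε' hε').and (Filter.eventually_ge_atTop N)).exists
  refine ⟨φ k, hkN.trans (hφ.id_le k), lt_of_le_of_lt ?_ hlt⟩
  rw [hξ (φ k), hl k, gluedDist_inCopy hX.isPseudo hpq]
  refine (ENNReal.div_le_of_le_mul ?_).trans hk
  exact le_mul_of_one_le_right bot_le (by exact_mod_cast m.2)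

/-! ### Iterated distances of the glued space inside one row -/

section
variable {X : Bipointed}

theorem p_ne_q (hX : IsPseudo X.d) (hpq : X.d X.p X.q = 1) : X.p ≠ X.q := by
  intro h
  rw [h, hX.self] at hpq
  exact zero_ne_one hpq

open Classical in
/-- A retraction of the glued space to the copy number `l` of the row `m`, which is well behaved
near this row: points of the other rows are sent to `p` or `q`, whichever side they are on. -/
def rowProj (X : Bipointed) (m : ℕ+) (l : ℕ) (u : Glued X) : X.carrier :=
  if h : u ∈ row X m then colPt X l h.choose h.choose_spec.choose
  else if gluedDist X u (incl X X.p) < (1 / 2 : ℝ≥0) then X.p else X.q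

variable (hX : IsMetric X.d) (hpq : X.d X.p X.q = 1)
include hX hpq

theorem rowProj_inCopy {m : ℕ+} {l : ℕ} (hl : l < m) (i : Fin m) (ξ : X.carrier) :
    rowProj X m l (inCopy X m i ξ) = colPt X l i ξ := by
  have h : inCopy X m i ξ ∈ row X m := inCopy_mem_row m i ξ
  rw [rowProj, dif_pos h]
  have h0 := (gluedDist_isPseudo hX.isPseudo).self (inCopy X m i ξ)
  conv at h0 => enter [1, 2]; rw [h.choose_spec.choose_spec]
  rw [gluedDist_row hX.isPseudo hpq, ENNReal.div_eq_zero_iff, Finset.sum_eq_zero_iff] at h0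
  exact (hX.eq_zero_iff _ _).1 (h0.resolve_right (by simp) l (Finset.mem_range.2 hl))

theorem sum_rowProj {m : ℕ+} {u v : Glued X} (hu : u ∈ row X m) (hv : v ∈ row X m) :
    ∑ l ∈ Finset.range m, X.d (rowProj X m l u) (rowProj X m l v) =
      (m : ℕ) * gluedDist X u v := by
  obtain ⟨i, ξ, rfl⟩ := hu
  obtain ⟨j, ζ, rfl⟩ := hv
  rw [gluedDist_row hX.isPseudo hpq, ENNReal.mul_div_cancel (by simp) (by simp)]
  refine Finset.sum_congr rfl fun l hl => ?_
  rw [rowProj_inCopy hX hpq (Finset.mem_range.1 hl), rowProj_inCopy hX hpq (Finset.mem_range.1 hl)]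

theorem rowProj_p {m : ℕ+} {l : ℕ} (hl : l < m) : rowProj X m l (incl X X.p) = X.p := by
  rw [← inCopy_zero_p m, rowProj_inCopy hX hpq hl, colPt_zero_p]

theorem rowProj_q {m : ℕ+} {l : ℕ} (hl : l < m) : rowProj X m l (incl X X.q) = X.q := by
  rw [← inCopy_last_q m, rowProj_inCopy hX hpq hl, colPt_last_q X hl]

theorem not_near_p_and_q {r s : ℝ≥0} (hrs : r + s ≤ 1) {u : Glued X}
    (hp : gluedDist X u (incl X X.p) < r) : (s : ℝ≥0∞) ≤ gluedDist X u (incl X X.q) := by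
  by_contra! hq
  have hG := gluedDist_isPseudo hX.isPseudo
  have h1 := hG.triangle (incl X X.p) u (incl X X.q)
  rw [gluedDist_p_q hX.isPseudo hpq, hG.symm _ u] at h1
  have h2 := h1.trans_lt (ENNReal.add_lt_add hp hq)
  rw [← ENNReal.coe_add, ← ENNReal.coe_one, ENNReal.coe_lt_coe] at h2
  exact absurd h2 (not_lt.2 hrs)

/-- The `1 / 4`-neighbourhood of the row `m`: points outside the row are close to it only if they
are close to `p` or `q`. -/
def rowNhd (X : Bipointed) (m : ℕ+) : Set (Glued X) :=
  {u | u ∈ row X m ∨ gluedDist X u (incl X X.p) < (1 / 4 : ℝ≥0) ∨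
    gluedDist X u (incl X X.q) < (1 / 4 : ℝ≥0)}

/-- Near the row `m`, the retractions to its copies do not increase distances in total, apart
from the scaling. -/
theorem sum_rowProj_le (m : ℕ+) : ∀ u ∈ rowNhd X m, ∀ v ∈ rowNhd X m,
    gluedDist X u v < (1 / 2 : ℝ≥0) →
    ∑ l ∈ Finset.range m, X.d (rowProj X m l u) (rowProj X m l v) ≤
      ((m : ℕ) : ℝ≥0) * gluedDist X u v := by
  have hG := gluedDist_isPseudo hX.isPseudo
  have hq_of : (1 / 2 : ℝ≥0) + 1 / 4 ≤ 1 := by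
    rw [← NNReal.coe_le_coe]; push_cast; norm_num
  -- the side of a point outside the row
  have near_p : ∀ {u l}, u ∉ row X m → gluedDist X u (incl X X.p) < (1 / 4 : ℝ≥0) →
      rowProj X m l u = X.p := by
    intro u l hu hp
    rw [rowProj, dif_neg hu, if_pos]
    refine hp.trans_le ?_
    rw [ENNReal.coe_le_coe, ← NNReal.coe_le_coe]; push_cast; norm_num
  have near_q : ∀ {u l}, u ∉ row X m → gluedDist X u (incl X X.q) < (1 / 4 : ℝ≥0) →
      rowProj X m l u = X.q := by
    intro u l hu hq
    rw [rowProj, dif_neg hu, if_neg]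
    exact fun hp => absurd hq (not_lt.2 (not_near_p_and_q hX hpq hq_of hp))
  have mixed : ∀ u ∈ row X m, ∀ v ∈ rowNhd X m, v ∉ row X m → gluedDist X u v < (1 / 2 : ℝ≥0) →
      ∑ l ∈ Finset.range m, X.d (rowProj X m l u) (rowProj X m l v) ≤
        ((m : ℕ) : ℝ≥0) * gluedDist X u v := by
    intro u hu v hv hvr huv
    have hs := gluedDist_separated hX.isPseudo hpq m u hu v hvr
    simp only [ENNReal.coe_natCast]
    rcases hv with hv | hv | hv
    · exact absurd hv hvr
    · have hle : gluedDist X u (incl X X.p) ≤ gluedDist X u v := by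
        rcases min_le_iff.1 hs with hs | hs
        · exact le_self_add.trans hs
        · have h1 : gluedDist X v (incl X X.q) < (1 / 2 : ℝ≥0) := by
            rw [hG.symm]; exact (le_add_self.trans hs).trans_lt huv
          refine absurd h1 (not_lt.2 (not_near_p_and_q hX hpq (r := 1 / 4) (s := 1 / 2) ?_ hv))
          rw [add_comm]; exact hq_of
      refine le_trans (le_of_eq ?_) (mul_le_mul_right hle _)
      rw [← sum_rowProj hX hpq hu (incl_p_mem_row m)]
      refine Finset.sum_congr rfl fun l hl => ?_
      rw [near_p hvr hv, rowProj_p hX hpq (Finset.mem_range.1 hl)]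
    · have hle : gluedDist X u (incl X X.q) ≤ gluedDist X u v := by
        rcases min_le_iff.1 hs with hs | hs
        · have h1 : gluedDist X v (incl X X.p) < (1 / 2 : ℝ≥0) := by
            rw [hG.symm]; exact (le_add_self.trans hs).trans_lt huv
          exact absurd hv (not_lt.2 (not_near_p_and_q hX hpq hq_of h1))
        · exact le_self_add.trans hs
      refine le_trans (le_of_eq ?_) (mul_le_mul_right hle _)
      rw [← sum_rowProj hX hpq hu (incl_q_mem_row m)]
      refine Finset.sum_congr rfl fun l hl => ?_
      rw [near_q hvr hv, rowProj_q hX hpq (Finset.mem_range.1 hl)]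
  have apart : ∀ u v, gluedDist X u (incl X X.p) < (1 / 4 : ℝ≥0) →
      gluedDist X v (incl X X.q) < (1 / 4 : ℝ≥0) → ¬ gluedDist X u v < (1 / 2 : ℝ≥0) := by
    intro u v hu hv huv
    refine absurd hv (not_lt.2 (not_near_p_and_q hX hpq (r := 3 / 4) ?_ ?_))
    · rw [← NNReal.coe_le_coe]; push_cast; norm_num
    · refine (hG.triangle v u _).trans_lt ?_
      rw [hG.symm v u]
      refine (ENNReal.add_lt_add huv hu).trans_le ?_
      rw [← ENNReal.coe_add, ENNReal.coe_le_coe, ← NNReal.coe_le_coe]; push_cast; norm_num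
  intro u hu v hv huv
  by_cases hur : u ∈ row X m <;> by_cases hvr : v ∈ row X m
  · rw [sum_rowProj hX hpq hur hvr]; simp
  · exact mixed u hur v hv hvr huv
  · rw [hG.symm] at huv ⊢
    simp only [hX.symm (rowProj X m _ u)]
    exact mixed v hvr u hu hur huv
  · have hzero : (∀ l, rowProj X m l u = rowProj X m l v) →
        ∑ l ∈ Finset.range m, X.d (rowProj X m l u) (rowProj X m l v) ≤
          ((m : ℕ) : ℝ≥0) * gluedDist X u v := by
      intro h
      simp only [h, hX.isPseudo.self, Finset.sum_const_zero]
      exact bot_le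
    rcases hu.resolve_left hur with hu | hu <;> rcases hv.resolve_left hvr with hv | hv
    · exact hzero fun l => by rw [near_p hur hu, near_p hvr hv]
    · exact absurd huv (apart u v hu hv)
    · rw [hG.symm] at huv
      exact absurd huv (apart v u hv hu)
    · exact hzero fun l => by rw [near_q hur hu, near_q hvr hv]

/-- At small scales the iterated distances of the glued space are additive along a row, and in each
copy they are bounded below by the scaled iterated distances of `X`. -/
theorem sum_iterDist_row_le (k : ℕ) (m : ℕ+) (i j : Fin m) (ξ ζ : X.carrier)
    (h : iterDist (gluedDist X) k (inCopy X m i ξ) (inCopy X m j ζ) < (1 / 4 : ℝ≥0)) :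
    ∑ l ∈ Finset.range m, iterDist X.d k (colPt X l i ξ) (colPt X l j ζ) ≤
      (m : ℕ) * iterDist (gluedDist X) k (inCopy X m i ξ) (inCopy X m j ζ) := by
  have hG := gluedDist_isPseudo hX.isPseudo
  have key := sum_iterDist_le hG (σ := X.d) (Finset.range m) (rowProj X m) (m : ℕ) (rowNhd X m)
    (1 / 2 : ℝ≥0) (sum_rowProj_le hX hpq m) k (1 / 4 : ℝ≥0) (by
      rw [ENNReal.coe_le_coe, ← NNReal.coe_le_coe]; push_cast; norm_num)
    (inCopy X m i ξ) (inCopy X m j ζ) (by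
      intro z hz
      by_cases hzr : z ∈ row X m
      · exact Or.inl hzr
      · have hs := gluedDist_separated hX.isPseudo hpq m _ (inCopy_mem_row m i ξ) z hzr
        rcases min_le_iff.1 hs with hs | hs
        · refine Or.inr (Or.inl ?_)
          rw [hG.symm]; exact (le_add_self.trans hs).trans_lt hz
        · refine Or.inr (Or.inr ?_)
          rw [hG.symm]; exact (le_add_self.trans hs).trans_lt hz) h
  simp only [ENNReal.coe_natCast] at key
  refine le_trans (le_of_eq (Finset.sum_congr rfl fun l hl => ?_)) key
  rw [rowProj_inCopy hX hpq (Finset.mem_range.1 hl), rowProj_inCopy hX hpq (Finset.mem_range.1 hl)]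

theorem iterDist_colPt_le (k : ℕ) (m : ℕ+) (i j : Fin m) (ξ ζ : X.carrier)
    (h : iterDist (gluedDist X) k (inCopy X m i ξ) (inCopy X m j ζ) < (1 / 4 : ℝ≥0))
    {l : ℕ} (hl : l < m) :
    iterDist X.d k (colPt X l i ξ) (colPt X l j ζ) ≤
      (m : ℕ) * iterDist (gluedDist X) k (inCopy X m i ξ) (inCopy X m j ζ) :=
  (Finset.single_le_sum (f := fun l => iterDist X.d k (colPt X l i ξ) (colPt X l j ζ))
    (fun _ _ => bot_le) (Finset.mem_range.2 hl)).trans (sum_iterDist_row_le hX hpq k m i j ξ ζ h)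

theorem iterDist_row_separated (k : ℕ) (m : ℕ+) : ∀ u ∈ row X m, ∀ v ∉ row X m,
    min (iterDist (gluedDist X) k u (incl X X.p) + iterDist (gluedDist X) k (incl X X.p) v)
      (iterDist (gluedDist X) k u (incl X X.q) + iterDist (gluedDist X) k (incl X X.q) v) ≤
    iterDist (gluedDist X) k u v :=
  iterDist_separated (gluedDist_separated hX.isPseudo hpq m) k

omit hpq in
theorem iterDist_inCopy_le (k : ℕ) (m : ℕ+) (i : Fin m) (ξ ζ : X.carrier) :
    iterDist (gluedDist X) k (inCopy X m i ξ) (inCopy X m i ζ) ≤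
      iterDist X.d k ξ ζ / (m : ℕ) := by
  have h := iterDist_map_le (ρ := gluedDist X) hX.isPseudo (inCopy X m i) (K := ((m : ℕ) : ℝ≥0)⁻¹)
    (by simp) (fun x y => by
      refine (gluedDist_inCopy_le X m i x y).trans (le_of_eq ?_)
      rw [ENNReal.coe_inv (by simp), mul_comm, div_eq_mul_inv]; simp) k ξ ζ
  refine h.trans (le_of_eq ?_)
  rw [ENNReal.coe_inv (by simp), mul_comm, div_eq_mul_inv]; simp

end

/-! ### Passing from `X` to the glued space -/

/-- What is known about the `n`-th iterate on the `n`-th space: up to the comparison of `lipDist`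
with `lengthDist`, it is `d̄` away from `p`, while `p` is at distance `3` before `q`. -/
structure StableAt (X : Bipointed) (n : ℕ) : Prop where
  metric : IsMetric X.d
  complete : IsComplete X.d
  dist_p_q : X.d X.p X.q = 1
  iter_p_q_le : iterDist X.d n X.p X.q ≤ 3
  le_iter_p : ∀ y, y ≠ X.p → 3 + lipDist X.d X.q y ≤ iterDist X.d n X.p y
  le_iter : ∀ x y, x ≠ X.p → y ≠ X.p → lipDist X.d x y ≤ iterDist X.d n x y

/-- The scale below which steps do not leave a copy of the row `m` except through its end: it is
less than `3 / m`, the least distance from the initial point of a copy after `n` iterations, and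
less than the scale `1 / 4` at which rows are well behaved. -/
def rowScale (m : ℕ+) : ℝ≥0 := 1 / (8 * (m : ℕ))

theorem rowScale_pos (m : ℕ+) : 0 < rowScale m := by unfold rowScale; positivity

theorem rowScale_lt (m : ℕ+) : rowScale m < 1 / 4 := by
  have h : (1 : ℝ≥0) ≤ (m : ℕ) := by exact_mod_cast m.2
  unfold rowScale
  rw [div_lt_div_iff₀ (by positivity) (by positivity)]
  calc (1 : ℝ≥0) * 4 < 8 * 1 := by norm_num
    _ ≤ 8 * (m : ℕ) := by gcongr
    _ = _ := by ring

theorem mul_rowScale (m : ℕ+) : ((m : ℕ) : ℝ≥0∞) * rowScale m < 3 := by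
  have : ((m : ℕ) : ℝ≥0) * rowScale m < 3 := by
    unfold rowScale
    rw [mul_one_div, mul_comm, ← div_div, div_self (by simp)]
    norm_num
  exact_mod_cast this

/-- The points of the copy `i` of the row `m` other than its initial point. -/
def block (X : Bipointed) (m : ℕ+) (i : Fin m) : Set (Glued X) :=
  {u | ∃ ξ, ξ ≠ X.p ∧ u = inCopy X m i ξ}

theorem mem_block {X : Bipointed} {m : ℕ+} {i : Fin m} {ξ : X.carrier} (h : ξ ≠ X.p) :
    inCopy X m i ξ ∈ block X m i := ⟨ξ, h, rfl⟩

theorem exists_mem_block {X : Bipointed} (hne : X.p ≠ X.q) {u : Glued X} (hu : u ≠ incl X X.p) :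
    ∃ m i, u ∈ block X m i := by
  obtain ⟨m, i, ξ, rfl⟩ := exists_inCopy u
  by_cases h : ξ = X.p
  · subst h
    obtain ⟨i, hi⟩ := i
    rcases i with _ | i
    · exact absurd (inCopy_zero_p m) hu
    · rw [← inCopy_next m i hi]
      exact ⟨m, _, mem_block hne.symm⟩
  · exact ⟨m, i, mem_block h⟩

section
variable {X : Bipointed} {n : ℕ} (hS : StableAt X n)
include hS

theorem StableAt.p_ne_q : X.p ≠ X.q := DiscreteLength.p_ne_q hS.metric.isPseudo hS.dist_p_q

theorem StableAt.three_le {y : X.carrier} (hy : y ≠ X.p) : 3 ≤ iterDist X.d n X.p y :=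
  le_self_add.trans (hS.le_iter_p y hy)

/-- A short step inside a row does not change which projections are equal to `p`. -/
theorem StableAt.colPt_eq_p_iff {m : ℕ+} {i j : Fin m} {ξ ζ : X.carrier}
    (h : iterDist (gluedDist X) n (inCopy X m i ξ) (inCopy X m j ζ) ≤ rowScale m) {l : ℕ}
    (hl : l < m) : colPt X l i ξ = X.p ↔ colPt X l j ζ = X.p := by
  have h1 := iterDist_colPt_le hS.metric hS.dist_p_q n m i j ξ ζ
    (h.trans_lt (by exact_mod_cast rowScale_lt m)) hl
  have h2 : iterDist X.d n (colPt X l i ξ) (colPt X l j ζ) < 3 :=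
    (h1.trans (mul_le_mul_right h _)).trans_lt (mul_rowScale m)
  constructor <;> intro h3 <;> by_contra h4
  · rw [h3] at h2
    exact absurd h2 (not_lt.2 (hS.three_le h4))
  · rw [h3, (hS.metric.isPseudo.iterDist n).symm] at h2
    exact absurd h2 (not_lt.2 (hS.three_le h4))

theorem StableAt.mem_block_of_row {m : ℕ+} {i : Fin m} {u v : Glued X} (hu : u ∈ block X m i)
    (hv : v ∈ row X m) (huv : iterDist (gluedDist X) n u v ≤ rowScale m) : v ∈ block X m i := by
  obtain ⟨ξ, hξ, rfl⟩ := hu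
  obtain ⟨j, ζ, rfl⟩ := hv
  have hne := hS.p_ne_q
  have key := fun {l : ℕ} (hl : l < (m : ℕ)) => hS.colPt_eq_p_iff huv hl
  rcases lt_trichotomy (j : ℕ) i with hij | hij | hij
  · have := (key i.2).2 (colPt_of_lt hij ζ)
    rw [colPt_self] at this
    exact absurd this hξ
  · have hij : j = i := Fin.ext hij
    subst hij
    refine mem_block fun h => hξ ?_
    have := key j.2
    rw [colPt_self, colPt_self] at this
    exact this.2 h
  · have hl : (i : ℕ) + 1 < m := by omega
    have h1 := (key hl).1 (colPt_of_lt (Nat.lt_succ_self _) ξ)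
    rcases (Nat.succ_le_of_lt hij).eq_or_lt with he | hlt
    · have he' : j = ⟨i + 1, hl⟩ := Fin.ext he.symm
      subst he'
      rw [colPt_self] at h1
      rw [h1, ← inCopy_next m i hl]
      exact mem_block hne.symm
    · rw [colPt_of_gt hlt] at h1
      exact absurd h1.symm hne

theorem StableAt.p_notMem_block (m : ℕ+) (i : Fin m) : incl X X.p ∉ block X m i := by
  rintro ⟨ξ, hξ, h⟩
  have h1 : iterDist (gluedDist X) n (inCopy X m i ξ) (inCopy X m ⟨0, m.pos⟩ X.p) ≤
      rowScale m := by
    rw [inCopy_zero_p, ← h, ((gluedDist_isPseudo hS.metric.isPseudo).iterDist n).self]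
    exact bot_le
  have := (hS.colPt_eq_p_iff h1 i.2).2 (colPt_zero_p X i)
  rw [colPt_self] at this
  exact hξ this

/-- Short steps leave a block only from the last copy of a row and through the point `q`. -/
theorem StableAt.exit_block {m : ℕ+} {i : Fin m} {u v : Glued X} (hu : u ∈ block X m i)
    (hv : v ∉ block X m i) (huv : iterDist (gluedDist X) n u v ≤ rowScale m) :
    (i : ℕ) + 1 = m ∧ iterDist (gluedDist X) n u (incl X X.q) +
      iterDist (gluedDist X) n (incl X X.q) v ≤ iterDist (gluedDist X) n u v := by
  have hvr : v ∉ row X m := fun h => hv (hS.mem_block_of_row hu h huv)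
  have hur : u ∈ row X m := by
    obtain ⟨ξ, -, rfl⟩ := hu; exact inCopy_mem_row m i ξ
  rcases min_le_iff.1 (iterDist_row_separated hS.metric hS.dist_p_q n m u hur v hvr) with h | h
  · exact absurd (hS.mem_block_of_row hu (incl_p_mem_row m) ((le_self_add.trans h).trans huv))
      (hS.p_notMem_block m i)
  · refine ⟨?_, h⟩
    by_contra hi
    obtain ⟨ξ, hξ, rfl⟩ := hu
    have hq := (le_self_add.trans h).trans huv
    rw [← inCopy_last_q m] at hq
    have hl : (i : ℕ) + 1 < m := by omega
    have := (hS.colPt_eq_p_iff hq hl).1 (colPt_of_lt (Nat.lt_succ_self _) ξ)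
    rw [colPt_last_q X hl] at this
    exact hS.p_ne_q this.symm

/-- The points at which a row passes from one copy to the next cannot be crossed. -/
theorem StableAt.iterDist_eq_top {m : ℕ+} {i : Fin m} (hi : (i : ℕ) + 1 < m) {u v : Glued X}
    (hu : u ∈ block X m i) (hv : v ∉ block X m i) :
    iterDist (gluedDist X) (n + 1) u v = ∞ :=
  zeroDist_eq_top (rowScale_pos m)
    (fun _ hu' _ hv' h => hi.ne (hS.exit_block hu' hv' h).1) hu hv

theorem StableAt.iterDist_cut (m : ℕ+) (i : Fin m) {u v : Glued X}
    (hu : u ∈ block X m i) (hv : v ∉ block X m i) :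
    iterDist (gluedDist X) (n + 1) u (incl X X.q) +
      iterDist (gluedDist X) (n + 1) (incl X X.q) v ≤ iterDist (gluedDist X) (n + 1) u v := by
  refine zeroDist_add_le_of_cut (A := block X m i) (fun η hη => ?_) hu hv
  refine ⟨min (rowScale m) η, lt_min (rowScale_pos m) hη, fun u' hu' v' hv' h => ?_⟩
  have h1 := (hS.exit_block hu' hv' (h.trans (by exact_mod_cast min_le_left _ _))).2.trans
    (h.trans (show ((min (rowScale m) η : ℝ≥0) : ℝ≥0∞) ≤ η by exact_mod_cast min_le_right _ _))
  exact ⟨le_self_add.trans h1, le_add_self.trans h1⟩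

open Classical in
/-- The retraction of the glued space to a copy that sends all points outside of it to `q`. -/
def blockProj (X : Bipointed) (m : ℕ+) (i : Fin m) (u : Glued X) : X.carrier :=
  if h : u ∈ block X m i then h.choose else X.q

theorem StableAt.blockProj_inCopy (m : ℕ+) (i : Fin m) {ξ : X.carrier} (hξ : ξ ≠ X.p) :
    blockProj X m i (inCopy X m i ξ) = ξ := by
  have h : inCopy X m i ξ ∈ block X m i := mem_block hξ
  rw [blockProj, dif_pos h]
  have h0 := (gluedDist_isPseudo hS.metric.isPseudo).self (inCopy X m i ξ)
  conv at h0 => enter [1, 2]; rw [h.choose_spec.2]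
  rw [gluedDist_inCopy hS.metric.isPseudo hS.dist_p_q, ENNReal.div_eq_zero_iff] at h0
  exact (hS.metric.eq_zero_iff _ _).1 (h0.resolve_right (by simp))

/-- Inside a copy, taking `d₀` once more does not lose anything compared with `X`. -/
theorem StableAt.le_iterDist_inCopy (m : ℕ+) (i : Fin m) {ξ ζ : X.carrier} (hξ : ξ ≠ X.p)
    (hζ : ζ ≠ X.p) : iterDist X.d n ξ ζ / (m : ℕ) ≤
      iterDist (gluedDist X) (n + 1) (inCopy X m i ξ) (inCopy X m i ζ) := by
  have hτ := hS.metric.isPseudo.iterDist n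
  have hρ := (gluedDist_isPseudo hS.metric.isPseudo).iterDist n
  have small : ∀ {r : ℝ≥0∞}, r ≤ rowScale m → r < (1 / 4 : ℝ≥0) := fun h =>
    h.trans_lt (by exact_mod_cast rowScale_lt m)
  have exit : ∀ u ∈ block X m i, ∀ v ∉ block X m i,
      iterDist (gluedDist X) n u v ≤ rowScale m →
      iterDist X.d n (blockProj X m i u) X.q ≤ (m : ℕ) * iterDist (gluedDist X) n u v := by
    intro u hu v hv huv
    obtain ⟨hi, h⟩ := hS.exit_block hu hv huv
    obtain ⟨ξ, hξ, rfl⟩ := hu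
    have h' := le_self_add.trans h
    refine le_trans ?_ (mul_le_mul_right h' _)
    have hq := iterDist_colPt_le hS.metric hS.dist_p_q n m i ⟨m - 1, Nat.sub_lt m.pos Nat.one_pos⟩
      ξ X.q (by rw [inCopy_last_q]; exact small (h'.trans huv)) i.2
    rw [inCopy_last_q, colPt_self, colPt_last_q X i.2] at hq
    rwa [hS.blockProj_inCopy m i hξ]
  have key := le_zeroDist_of_local (ρ := iterDist (gluedDist X) n)
    (F := fun u v => iterDist X.d n (blockProj X m i u) (blockProj X m i v) / (m : ℕ))
    (fun u => by simp [hτ.self])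
    (fun u v w => by
      rw [ENNReal.div_add_div_same]; gcongr; exact hτ.triangle _ _ _)
    ⟨rowScale m, rowScale_pos m, fun u v huv => by
      refine ENNReal.div_le_of_le_mul' ?_
      by_cases hu : u ∈ block X m i <;> by_cases hv : v ∈ block X m i
      · obtain ⟨ξ, hξ, rfl⟩ := hu
        obtain ⟨ζ, hζ, rfl⟩ := hv
        rw [hS.blockProj_inCopy m i hξ, hS.blockProj_inCopy m i hζ]
        have := iterDist_colPt_le hS.metric hS.dist_p_q n m i i ξ ζ (small huv) i.2
        rwa [colPt_self, colPt_self] at this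
      · have hv' : blockProj X m i v = X.q := by rw [blockProj, dif_neg hv]
        rw [hv']
        exact exit u hu v hv huv
      · have hu' : blockProj X m i u = X.q := by rw [blockProj, dif_neg hu]
        rw [hu', hτ.symm, hρ.symm]
        rw [hρ.symm] at huv
        exact exit v hv u hu huv
      · rw [blockProj, blockProj, dif_neg hu, dif_neg hv, hτ.self]
        exact bot_le⟩
    (inCopy X m i ξ) (inCopy X m i ζ)
  simp only [hS.blockProj_inCopy m i hξ, hS.blockProj_inCopy m i hζ] at key
  exact key

theorem StableAt.lipDist_le_of_block {m : ℕ+} {i : Fin m} {u v : Glued X}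
    (hu : u ∈ block X m i) (hv : v ∈ block X m i) :
    lipDist (gluedDist X) u v ≤ iterDist (gluedDist X) (n + 1) u v := by
  obtain ⟨ξ, hξ, rfl⟩ := hu
  obtain ⟨ζ, hζ, rfl⟩ := hv
  calc lipDist (gluedDist X) (inCopy X m i ξ) (inCopy X m i ζ)
      ≤ lipDist X.d ξ ζ / (m : ℕ) :=
        lipDist_map_le (inCopy X m i) m.pos (gluedDist_inCopy_le X m i) ξ ζ
    _ ≤ iterDist X.d n ξ ζ / (m : ℕ) := by gcongr; exact hS.le_iter ξ ζ hξ hζ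
    _ ≤ _ := hS.le_iterDist_inCopy m i hξ hζ

theorem StableAt.q_mem_block {m : ℕ+} {i : Fin m} (hi : (i : ℕ) + 1 = m) :
    incl X X.q ∈ block X m i := by
  have : i = ⟨m - 1, Nat.sub_lt m.pos Nat.one_pos⟩ := Fin.ext (by simp; omega)
  subst this
  rw [← inCopy_last_q m]
  exact mem_block hS.p_ne_q.symm

theorem StableAt.lipDist_q_le {v : Glued X} (hv : v ≠ incl X X.p) :
    lipDist (gluedDist X) (incl X X.q) v ≤ iterDist (gluedDist X) (n + 1) (incl X X.q) v := by
  have hG := gluedDist_isPseudo hS.metric.isPseudo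
  obtain ⟨m, i, hv⟩ := exists_mem_block hS.p_ne_q hv
  by_cases hq : incl X X.q ∈ block X m i
  · exact hS.lipDist_le_of_block hq hv
  · have hi : (i : ℕ) + 1 < m := by
      have := i.2
      have : (i : ℕ) + 1 ≠ m := fun h => hq (hS.q_mem_block h)
      omega
    rw [(hG.iterDist (n + 1)).symm, hS.iterDist_eq_top hi hv hq]
    exact le_top

theorem StableAt.lipDist_le {u v : Glued X} (hu : u ≠ incl X X.p) (hv : v ≠ incl X X.p) :
    lipDist (gluedDist X) u v ≤ iterDist (gluedDist X) (n + 1) u v := by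
  have hG := gluedDist_isPseudo hS.metric.isPseudo
  obtain ⟨m, i, hu'⟩ := exists_mem_block hS.p_ne_q hu
  by_cases hvb : v ∈ block X m i
  · exact hS.lipDist_le_of_block hu' hvb
  · refine (lipDist_triangle hG u (incl X X.q) v).trans
      (le_trans (add_le_add ?_ (hS.lipDist_q_le hv)) (hS.iterDist_cut m i hu' hvb))
    rw [lipDist_symm hG, (hG.iterDist (n + 1)).symm]
    exact hS.lipDist_q_le hu

end

open Classical in
/-- The function on `X` that is `0` at `p` and `3` elsewhere. -/
def jumpAtP (X : Bipointed) (x : X.carrier) : ℝ≥0∞ := if x = X.p then 0 else 3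

/-- The value on the copies of the potential `gluePotential`. -/
def copiesPotential (X : Bipointed) (a : Copies X) : ℝ≥0∞ :=
  (∑ l ∈ Finset.range a.1, jumpAtP X (proj X l a)) / (a.1 : ℕ)

theorem copiesPotential_p (X : Bipointed) (m : ℕ+) :
    copiesPotential X ⟨m, ⟨0, m.pos⟩, X.p⟩ = 0 := by
  simp [copiesPotential, proj, colPt_zero_p, jumpAtP]

theorem copiesPotential_q {X : Bipointed} (hne : X.p ≠ X.q) (m : ℕ+) :
    copiesPotential X ⟨m, ⟨m - 1, Nat.sub_lt m.pos Nat.one_pos⟩, X.q⟩ = 3 := by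
  refine Eq.trans ?_ (sum_const_div m 3)
  rw [copiesPotential]
  congr 1
  refine Finset.sum_congr rfl fun l hl => ?_
  simp only [proj]
  rw [colPt_last_q X (Finset.mem_range.1 hl), jumpAtP, if_neg hne.symm]

/-- A potential on the glued space that takes the values `0` at `p` and `3` at `q` and jumps by
`3 / m` at the initial point of each copy of the row `m`. -/
def gluePotential (X : Bipointed) (hne : X.p ≠ X.q) : Glued X → ℝ≥0∞ :=
  Quot.lift (copiesPotential X) (by
    intro a b h
    cases h with
    | next m j h => simp [copiesPotential, proj, colPt_next]
    | first m m' => rw [copiesPotential_p, copiesPotential_p]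
    | last m m' => rw [copiesPotential_q hne, copiesPotential_q hne])

section
variable {X : Bipointed} {n : ℕ} (hS : StableAt X n)
include hS

theorem StableAt.jumpAtP_le (x y : X.carrier) :
    jumpAtP X y ≤ jumpAtP X x + iterDist X.d n x y := by
  unfold jumpAtP
  by_cases h1 : y = X.p
  · rw [if_pos h1]; exact zero_le
  · rw [if_neg h1]
    by_cases h2 : x = X.p
    · rw [if_pos h2, h2, zero_add]
      exact hS.three_le h1
    · rw [if_neg h2]; exact le_self_add

theorem StableAt.gluePotential_row {m : ℕ+} {u v : Glued X} (hu : u ∈ row X m)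
    (hv : v ∈ row X m) (huv : iterDist (gluedDist X) n u v < (1 / 4 : ℝ≥0)) :
    gluePotential X hS.p_ne_q v - gluePotential X hS.p_ne_q u ≤
      iterDist (gluedDist X) n u v := by
  obtain ⟨i, ξ, rfl⟩ := hu
  obtain ⟨j, ζ, rfl⟩ := hv
  have hm : ((m : ℕ) : ℝ≥0∞) ≠ 0 := by simp
  have h := sum_iterDist_row_le hS.metric hS.dist_p_q n m i j ξ ζ huv
  rw [tsub_le_iff_left]
  change copiesPotential X ⟨m, j, ζ⟩ ≤ copiesPotential X ⟨m, i, ξ⟩ + _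
  rw [mul_comm, ← ENNReal.div_le_iff_le_mul (Or.inl hm) (Or.inl (by simp))] at h
  refine le_trans ?_ (add_le_add le_rfl h)
  rw [copiesPotential, copiesPotential, ENNReal.div_add_div_same, ← Finset.sum_add_distrib]
  gcongr with l hl
  exact hS.jumpAtP_le _ _

/-- The potential `gluePotential` bounds the length of chains with small steps from below, since a
step between two rows can be divided at `p` or `q`. -/
theorem StableAt.three_le_iterDist_glue :
    3 ≤ iterDist (gluedDist X) (n + 1) (incl X X.p) (incl X X.q) := by
  have hne := hS.p_ne_q
  have hlt : ∀ {r : ℝ≥0∞}, r ≤ (1 / 8 : ℝ≥0) → r < (1 / 4 : ℝ≥0) := fun h =>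
    h.trans_lt (by
      rw [ENNReal.coe_lt_coe, ← NNReal.coe_lt_coe]; push_cast; norm_num)
  have htri : ∀ a b c : ℝ≥0∞, c - a ≤ (b - a) + (c - b) := fun a b c => by
    rw [add_comm]; exact tsub_le_tsub_add_tsub
  have key := le_zeroDist_of_local (ρ := iterDist (gluedDist X) n)
    (F := fun u v => gluePotential X hne v - gluePotential X hne u)
    (fun u => tsub_self _) (fun u v w => htri _ _ _)
    ⟨1 / 8, by positivity, fun u v huv => by
      obtain ⟨m, i, ξ, rfl⟩ := exists_inCopy u
      have hu := inCopy_mem_row m i ξ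
      by_cases hv : v ∈ row X m
      · exact hS.gluePotential_row hu hv (hlt huv)
      · obtain ⟨m', j, ζ, rfl⟩ := exists_inCopy v
        have hv' := inCopy_mem_row m' j ζ
        rcases min_le_iff.1 (iterDist_row_separated hS.metric hS.dist_p_q n m _ hu _ hv) with h | h
        · refine (htri _ (gluePotential X hne (incl X X.p)) _).trans (le_trans ?_ h)
          exact add_le_add
            (hS.gluePotential_row hu (incl_p_mem_row m) (hlt ((le_self_add.trans h).trans huv)))
            (hS.gluePotential_row (incl_p_mem_row m') hv'
              (hlt ((le_add_self.trans h).trans huv)))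
        · refine (htri _ (gluePotential X hne (incl X X.q)) _).trans (le_trans ?_ h)
          exact add_le_add
            (hS.gluePotential_row hu (incl_q_mem_row m) (hlt ((le_self_add.trans h).trans huv)))
            (hS.gluePotential_row (incl_q_mem_row m') hv'
              (hlt ((le_add_self.trans h).trans huv)))⟩
    (incl X X.p) (incl X X.q)
  refine le_trans (le_of_eq ?_) key
  have hp : gluePotential X hne (incl X X.p) = 0 := copiesPotential_p X 1
  have hq : gluePotential X hne (incl X X.q) = 3 := copiesPotential_q hne 1
  simp only [hp, hq, tsub_zero]

theorem StableAt.iterDist_inCopy_p_q_le (m : ℕ+) (i : Fin m) :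
    iterDist (gluedDist X) n (inCopy X m i X.p) (inCopy X m i X.q) ≤ 3 / (m : ℕ) :=
  (iterDist_inCopy_le hS.metric n m i _ _).trans (by gcongr; exact hS.iter_p_q_le)

/-- A long row gives a chain of small steps from `p` to `q` of total length `3`. -/
theorem StableAt.iterDist_glue_le_three :
    iterDist (gluedDist X) (n + 1) (incl X X.p) (incl X X.q) ≤ 3 := by
  refine zeroDist_le fun ε hε => ?_
  obtain ⟨m, hm⟩ : ∃ m : ℕ+, (3 : ℝ≥0∞) / (m : ℕ) ≤ ε := by
    obtain ⟨k, hk⟩ := exists_nat_ge (3 / ε)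
    refine ⟨⟨k + 1, k.succ_pos⟩, ENNReal.div_le_of_le_mul ?_⟩
    have : (3 : ℝ≥0) ≤ ε * ((k + 1 : ℕ) : ℝ≥0) := by
      rw [div_le_iff₀ hε, mul_comm] at hk
      refine hk.trans ?_
      gcongr
      exact Nat.le_succ k
    exact_mod_cast this
  have step : ∀ i : Fin m, epsDist (iterDist (gluedDist X) n) ε (inCopy X m i X.p)
      (inCopy X m i X.q) ≤ 3 / (m : ℕ) := fun i =>
    (epsDist_le_of_le ((hS.iterDist_inCopy_p_q_le m i).trans hm)).trans
      (hS.iterDist_inCopy_p_q_le m i)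
  have key : ∀ (j : ℕ) (hj : j < m), epsDist (iterDist (gluedDist X) n) ε (incl X X.p)
      (inCopy X m ⟨j, hj⟩ X.q) ≤ (j + 1 : ℕ) * (3 / (m : ℕ)) := by
    intro j
    induction j with
    | zero =>
      intro hj
      rw [← inCopy_zero_p m]
      simpa using step ⟨0, hj⟩
    | succ j ih =>
      intro hj
      refine (epsDist_triangle _ _ _ (inCopy X m ⟨j, Nat.lt_of_succ_lt hj⟩ X.q) _).trans ?_
      rw [Nat.cast_succ, add_mul, one_mul]
      refine add_le_add (ih _) ?_
      rw [inCopy_next m j hj]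
      exact step ⟨j + 1, hj⟩
  have h := key (m - 1) (Nat.sub_lt m.pos Nat.one_pos)
  rw [inCopy_last_q, Nat.sub_add_cancel m.pos] at h
  exact h.trans (le_of_eq (ENNReal.mul_div_cancel (by simp) (by simp)))

theorem StableAt.le_iterDist_glue_p {y : Glued X} (hy : y ≠ incl X X.p) :
    3 + lipDist (gluedDist X) (incl X X.q) y ≤
      iterDist (gluedDist X) (n + 1) (incl X X.p) y := by
  have hsymm := ((gluedDist_isPseudo hS.metric.isPseudo).iterDist (n + 1)).symm
  obtain ⟨m, i, hyb⟩ := exists_mem_block hS.p_ne_q hy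
  have hcut := hS.iterDist_cut m i hyb (hS.p_notMem_block m i)
  rw [hsymm y (incl X X.p), hsymm y (incl X X.q), hsymm (incl X X.q) (incl X X.p), add_comm] at hcut
  exact (add_le_add hS.three_le_iterDist_glue (hS.lipDist_q_le hy)).trans hcut

theorem StableAt.glue : StableAt (glue X) (n + 1) where
  metric := gluedDist_isMetric hS.metric hS.dist_p_q
  complete := gluedDist_isComplete hS.metric hS.dist_p_q hS.complete
  dist_p_q := gluedDist_p_q hS.metric.isPseudo hS.dist_p_q
  iter_p_q_le := hS.iterDist_glue_le_three
  le_iter_p _ hy := hS.le_iterDist_glue_p hy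
  le_iter _ _ hx hy := hS.lipDist_le hx hy

end

/-! ### The space `Y₁`: coordinates and distances -/

section
variable {k l : ℕ+}

theorem ne_one_of_two_le (hk : 2 ≤ k) : k ≠ 1 := by rintro rfl; exact absurd hk (by decide)

theorem pt_apply_one (hk : k ≠ 1) (s t : ℝ) : pt k s t 1 = s := by
  simp [pt, lp.single_apply, hk.symm]

theorem pt_apply_self (hk : k ≠ 1) (s t : ℝ) : pt k s t k = t := by
  simp [pt, lp.single_apply, hk]

theorem pt_apply_of_ne (hl : l ≠ 1) (hlk : l ≠ k) (s t : ℝ) : pt k s t l = 0 := by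
  simp [pt, lp.single_apply, hl, hlk]

theorem pt_zero_right (k : ℕ+) (s : ℝ) : pt k s 0 = lp.single ∞ (1 : ℕ+) s := by simp [pt]

theorem abs_apply_sub_le (x y : LInf) (j : ℕ+) : |x j - y j| ≤ dist x y := by
  rw [dist_eq_norm]
  exact lp.norm_apply_le_norm ENNReal.top_ne_zero (x - y) j

theorem dist_pt_right (k : ℕ+) (a s t : ℝ) : dist (pt k a s) (pt k a t) = |s - t| := by
  rw [dist_eq_norm, pt, pt, add_sub_add_left_eq_sub, ← lp.single_sub,
    lp.norm_single ENNReal.zero_lt_top, Real.norm_eq_abs]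

theorem dist_pt_left (k : ℕ+) (a b s : ℝ) : dist (pt k a s) (pt k b s) = |a - b| := by
  rw [dist_eq_norm, pt, pt, add_sub_add_right_eq_sub, ← lp.single_sub,
    lp.norm_single ENNReal.zero_lt_top, Real.norm_eq_abs]

/-- The first coordinate `1 / k` of the last segment of `S_k`. -/
theorem inv_pos_and_le_half (hk : 2 ≤ k) : (0 : ℝ) < 1 / (k : ℝ) ∧ (1 : ℝ) / k ≤ 1 / 2 := by
  have : (2 : ℝ) ≤ (k : ℝ) := by exact_mod_cast (show (2 : ℕ) ≤ k from hk)
  exact ⟨by positivity, one_div_le_one_div_of_le two_pos this⟩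

/-- Half the distance from `1 / k` to `1 / (k + 1)`: at this scale the last segment of `S_k` is
separated from those of the other broken lines. -/
def lineScale (k : ℕ+) : ℝ := 1 / (2 * k * (k + 1))

theorem lineScale_pos (k : ℕ+) : 0 < lineScale k := by unfold lineScale; positivity

theorem lineScale_lt_inv (k : ℕ+) : lineScale k < 1 / k := by
  have : (1 : ℝ) ≤ k := by exact_mod_cast k.2
  unfold lineScale
  exact one_div_lt_one_div_of_lt (by positivity) (by nlinarith)

theorem lineScale_lt_half (hk : 2 ≤ k) : lineScale k < 1 / 2 :=
  (lineScale_lt_inv k).trans_le (inv_pos_and_le_half hk).2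

theorem lineScale_lt_sub (h : k ≠ l) : lineScale k < |1 / (k : ℝ) - 1 / l| := by
  have hk : (1 : ℝ) ≤ k := by exact_mod_cast k.2
  have hl : (1 : ℝ) ≤ l := by exact_mod_cast l.2
  rw [div_sub_div _ _ (by positivity) (by positivity), abs_div,
    abs_of_pos (show (0 : ℝ) < k * l by positivity), lineScale,
    div_lt_div_iff₀ (by positivity) (by positivity)]
  rcases lt_or_gt_of_ne h with h | h
  · have : (k : ℝ) + 1 ≤ l := by exact_mod_cast (show (k : ℕ) + 1 ≤ l from h)
    rw [abs_of_nonneg (by linarith)]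
    nlinarith [mul_nonneg (sub_nonneg.2 this) (show (0 : ℝ) ≤ k by linarith),
      mul_pos (show (0 : ℝ) < k by linarith) (show (0 : ℝ) < l by linarith),
      mul_nonneg (mul_nonneg (sub_nonneg.2 this) (show (0 : ℝ) ≤ k by linarith))
        (show (0 : ℝ) ≤ k by linarith)]
  · have : (l : ℝ) + 1 ≤ k := by exact_mod_cast (show (l : ℕ) + 1 ≤ k from h)
    rw [abs_of_nonpos (by linarith)]
    nlinarith [mul_nonneg (sub_nonneg.2 this) (show (0 : ℝ) ≤ k by linarith),
      mul_pos (show (0 : ℝ) < k by linarith) (show (0 : ℝ) < l by linarith)]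

end

/-! ### The segments of the broken lines -/

/-- The distance of `Y₁`; by definition `baseSpace` consists of `ySet`, `yDist`, `yP` and `yQ`. -/
def yDist (x y : ySet) : ℝ≥0∞ := edist (x : LInf) (y : LInf)

/-- The point `p` of `Y₁`. -/
def yP : ySet := ⟨0, zero_mem_ySet⟩

/-- The point `q` of `Y₁`. -/
def yQ : ySet := ⟨lp.single ∞ (1 : ℕ+) (1 : ℝ), single_mem_ySet⟩

/-- The segment of `S_k` that starts at `q`. -/
def segA (k : ℕ+) : Set ySet := {x | ∃ t ∈ Set.Icc (0 : ℝ) 1, (x : LInf) = pt k 1 t}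

/-- The middle segment of `S_k`. -/
def segB (k : ℕ+) : Set ySet := {x | ∃ t ∈ Set.Icc (1 / (k : ℝ)) 1, (x : LInf) = pt k t 1}

/-- The segment of `S_k` that ends near `p`. -/
def segC (k : ℕ+) : Set ySet := {x | ∃ t ∈ Set.Icc (0 : ℝ) 1, (x : LInf) = pt k (1 / (k : ℝ)) t}

theorem mem_S_iff {k : ℕ+} {x : ySet} : (x : LInf) ∈ S k ↔ x ∈ segA k ∨ x ∈ segB k ∨ x ∈ segC k := by
  simp only [S, segA, segB, segC, Set.mem_union, Set.mem_ofPred_eq, or_assoc]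

theorem exists_mem_S {x : ySet} (hx : x ≠ yP) : ∃ k : ℕ+, 2 ≤ k ∧ (x : LInf) ∈ S k := by
  rcases x.2 with h | h
  · exact absurd (Subtype.ext (Set.mem_singleton_iff.1 h)) hx
  · simpa using h

theorem S_subset_ySet {k : ℕ+} (hk : 2 ≤ k) : S k ⊆ ySet := fun _ hx =>
  Or.inr (Set.mem_iUnion₂.2 ⟨k, hk, hx⟩)

/-- Close points of `Y₁`, only one of which belongs to `S_k`, lie on initial segments near `q`. -/
theorem near_q {k : ℕ+} (hk : 2 ≤ k) {u v : LInf} (hu : u ∈ S k) (hv : v ∈ ySet) (hvk : v ∉ S k)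
    {ε : ℝ} (hε : ε ≤ lineScale k) (huv : dist u v ≤ ε) :
    ∃ s t, ∃ l : ℕ+, 0 ≤ s ∧ s ≤ ε ∧ u = pt k 1 s ∧ 0 ≤ t ∧ t ≤ ε ∧ v = pt l 1 t := by
  have hk1 := ne_one_of_two_le hk
  have hk2 := inv_pos_and_le_half hk
  have e1 := lineScale_lt_inv k
  have e2 := lineScale_lt_half hk
  have c1 := (abs_le.1 ((abs_apply_sub_le u v 1).trans huv))
  have ck := (abs_le.1 ((abs_apply_sub_le u v k).trans huv))
  rcases hv with rfl | hv
  · simp only [lp.coeFn_zero, Pi.zero_apply, sub_zero] at c1 ck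
    rcases hu with (⟨s, hs, rfl⟩ | ⟨s, hs, rfl⟩) | ⟨s, hs, rfl⟩ <;>
      rw [pt_apply_one hk1] at c1 <;> rw [pt_apply_self hk1] at ck <;> linarith
  · obtain ⟨l, hl, hv⟩ := Set.mem_iUnion₂.1 hv
    have hkl : k ≠ l := by rintro rfl; exact hvk hv
    have hl1 := ne_one_of_two_le hl
    have hl2 := inv_pos_and_le_half hl
    have cl := (abs_le.1 ((abs_apply_sub_le u v l).trans huv))
    have e3 := lineScale_lt_sub hkl
    rcases hu with (⟨s, hs, rfl⟩ | ⟨s, hs, rfl⟩) | ⟨s, hs, rfl⟩ <;>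
      rcases hv with (⟨t, ht, rfl⟩ | ⟨t, ht, rfl⟩) | ⟨t, ht, rfl⟩ <;>
      rw [pt_apply_one hk1, pt_apply_one hl1] at c1 <;>
      rw [pt_apply_self hk1, pt_apply_of_ne hk1 hkl] at ck <;>
      rw [pt_apply_self hl1, pt_apply_of_ne hl1 hkl.symm] at cl <;>
      first
        | linarith
        | exact ⟨s, t, l, hs.1, by linarith, rfl, ht.1, by linarith, rfl⟩
        | exact absurd (abs_le.2 c1) (not_le.2 (hε.trans_lt e3))

/-- The cut property of `zeroDist_add_le_of_cut` for the norm distance of `ySet`. -/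
theorem cut_of_dist {A : Set ySet} {w : ySet}
    (h : ∀ η : ℝ, 0 < η → ∃ ε : ℝ, 0 < ε ∧ ∀ u ∈ A, ∀ v ∉ A, dist u v ≤ ε →
      dist u w ≤ η ∧ dist w v ≤ η) {x y : ySet} (hx : x ∈ A) (hy : y ∉ A) :
    zeroDist yDist x w + zeroDist yDist w y ≤ zeroDist yDist x y := by
  have hd : ∀ (a b : ySet) (r : ℝ≥0), yDist a b ≤ r ↔ dist a b ≤ r := fun a b r => by
    change edist a b ≤ r ↔ _
    rw [edist_nndist, ENNReal.coe_le_coe, ← NNReal.coe_le_coe, coe_nndist]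
  refine zeroDist_add_le_of_cut (ρ := yDist) (A := A) (fun η hη => ?_) hx hy
  obtain ⟨ε, hε, h⟩ := h η hη
  refine ⟨⟨ε, hε.le⟩, hε, fun u hu v hv huv => ?_⟩
  obtain ⟨h1, h2⟩ := h u hu v hv ((hd _ _ _).1 huv)
  exact ⟨(hd _ _ _).2 h1, (hd _ _ _).2 h2⟩

theorem yDist_isPseudo : IsPseudo yDist where
  self := edist_self (α := ySet)
  symm := edist_comm (α := ySet)
  triangle := edist_triangle (α := ySet)

/-- The corner between the first two segments of `S_k`. -/
def cornerAB {k : ℕ+} (hk : 2 ≤ k) : ySet :=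
  ⟨pt k 1 1, S_subset_ySet hk (Or.inl (Or.inl ⟨1, by simp, rfl⟩))⟩

/-- The corner between the last two segments of `S_k`. -/
def cornerBC {k : ℕ+} (hk : 2 ≤ k) : ySet :=
  ⟨pt k (1 / k) 1, S_subset_ySet hk (Or.inr ⟨1, by simp, rfl⟩)⟩

theorem cut_q {k : ℕ+} (hk : 2 ≤ k) {x y : ySet} (hx : (x : LInf) ∈ S k)
    (hy : (y : LInf) ∉ S k) :
    zeroDist yDist x yQ + zeroDist yDist yQ y ≤
      zeroDist yDist x y := by
  refine cut_of_dist (A := {u : ySet | (u : LInf) ∈ S k}) (w := yQ) (fun η hη => ?_) hx hy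
  refine ⟨min η (lineScale k), lt_min hη (lineScale_pos k), fun u hu v hv huv => ?_⟩
  obtain ⟨s, t, l, hs, hs', hu', ht, ht', hv'⟩ := near_q hk hu v.2 hv (min_le_right _ _) huv
  have hη' := min_le_left η (lineScale k)
  constructor
  · change dist (u : LInf) (lp.single ∞ (1 : ℕ+) (1 : ℝ)) ≤ η
    rw [hu', ← pt_zero_right k, dist_pt_right, sub_zero, abs_of_nonneg hs]
    linarith
  · change dist (lp.single ∞ (1 : ℕ+) (1 : ℝ)) (v : LInf) ≤ η
    rw [hv', ← pt_zero_right l, dist_pt_right, zero_sub, abs_neg, abs_of_nonneg ht]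
    linarith

/-- The middle and last segments of `S_k` meet no point off `S_k` at small scales. -/
theorem not_near_of_segBC {k : ℕ+} (hk : 2 ≤ k) {u v : ySet} (hu : u ∈ segB k ∨ u ∈ segC k)
    (hv : (v : LInf) ∉ S k) : ¬ dist u v ≤ lineScale k := by
  intro huv
  have hk1 := ne_one_of_two_le hk
  have hk2 := inv_pos_and_le_half hk
  have e2 := lineScale_lt_half hk
  obtain ⟨s, -, -, hs, hs', hu', -⟩ :=
    near_q hk (mem_S_iff.2 (Or.inr hu)) v.2 hv le_rfl huv
  rcases hu with ⟨r, hr, h⟩ | ⟨r, hr, h⟩ <;> rw [h] at hu'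
  · have := congrArg (fun x : LInf => x k) hu'
    simp only [pt_apply_self hk1] at this
    linarith
  · have := congrArg (fun x : LInf => x 1) hu'
    simp only [pt_apply_one hk1] at this
    linarith

theorem cut_cornerAB {k : ℕ+} (hk : 2 ≤ k) {x y : ySet} (hx : x ∈ segB k ∨ x ∈ segC k)
    (hy : ¬ (y ∈ segB k ∨ y ∈ segC k)) :
    zeroDist yDist x (cornerAB hk) + zeroDist yDist (cornerAB hk) y ≤
      zeroDist yDist x y := by
  have hk1 := ne_one_of_two_le hk
  have hk2 := inv_pos_and_le_half hk
  refine cut_of_dist (A := {u | u ∈ segB k ∨ u ∈ segC k}) (fun η hη => ?_) hx hy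
  refine ⟨min η (lineScale k), lt_min hη (lineScale_pos k), fun u hu v hv huv => ?_⟩
  have hη' := huv.trans (min_le_left η (lineScale k))
  have hε := huv.trans (min_le_right η (lineScale k))
  have e2 := lineScale_lt_half hk
  by_cases hvS : (v : LInf) ∈ S k
  · obtain ⟨t, ht, hv'⟩ := (mem_S_iff.1 hvS).resolve_right hv
    have c1 := abs_le.1 (abs_apply_sub_le (u : LInf) v 1)
    have ck := abs_le.1 (abs_apply_sub_le (u : LInf) v k)
    rw [← Subtype.dist_eq, hv', pt_apply_one hk1] at c1
    rw [← Subtype.dist_eq, hv', pt_apply_self hk1] at ck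
    rcases hu with ⟨s, hs, hu'⟩ | ⟨s, hs, hu'⟩
    · rw [hu', pt_apply_one hk1] at c1
      rw [hu', pt_apply_self hk1] at ck
      rw [Subtype.dist_eq, Subtype.dist_eq, hu', hv']
      change dist (pt k s 1) (pt k 1 1) ≤ η ∧ dist (pt k 1 1) (pt k 1 t) ≤ η
      rw [dist_pt_left, dist_pt_right, abs_le, abs_le]
      constructor <;> constructor <;> linarith
    · rw [hu', pt_apply_one hk1] at c1
      linarith
  · exact absurd hε (not_near_of_segBC hk hu hvS)

theorem cut_cornerBC {k : ℕ+} (hk : 2 ≤ k) {x y : ySet} (hx : x ∈ segC k) (hy : y ∉ segC k) :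
    zeroDist yDist x (cornerBC hk) + zeroDist yDist (cornerBC hk) y ≤
      zeroDist yDist x y := by
  have hk1 := ne_one_of_two_le hk
  have hk2 := inv_pos_and_le_half hk
  refine cut_of_dist (A := segC k) (fun η hη => ?_) hx hy
  refine ⟨min η (lineScale k), lt_min hη (lineScale_pos k), fun u hu v hv huv => ?_⟩
  have hη' := huv.trans (min_le_left η (lineScale k))
  have hε := huv.trans (min_le_right η (lineScale k))
  have e2 := lineScale_lt_half hk
  by_cases hvS : (v : LInf) ∈ S k
  · have c1 := abs_le.1 (abs_apply_sub_le (u : LInf) v 1)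
    have ck := abs_le.1 (abs_apply_sub_le (u : LInf) v k)
    rw [← Subtype.dist_eq] at c1 ck
    obtain ⟨s, hs, hu'⟩ := hu
    rw [hu', pt_apply_one hk1] at c1
    rw [hu', pt_apply_self hk1] at ck
    rcases mem_S_iff.1 hvS with ⟨t, ht, hv'⟩ | ⟨t, ht, hv'⟩ | hvC
    · rw [hv', pt_apply_one hk1] at c1
      linarith
    · rw [hv', pt_apply_one hk1] at c1
      rw [hv', pt_apply_self hk1] at ck
      rw [Subtype.dist_eq, Subtype.dist_eq, hu', hv']
      change dist (pt k (1 / k) s) (pt k (1 / k) 1) ≤ η ∧ dist (pt k (1 / k) 1) (pt k t 1) ≤ η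
      rw [dist_pt_left, dist_pt_right, abs_le, abs_le]
      constructor <;> constructor <;> linarith
    · exact absurd hvC hv
  · exact absurd hε (not_near_of_segBC hk (Or.inr hu) hvS)

/-- The distance of two points on an isometrically embedded interval is the length of an arc. -/
theorem lipDist_le_of_interval {X : Type} {ρ : X → X → ℝ≥0∞} (hρ : IsPseudo ρ) {α β : ℝ}
    (f : Set.Icc α β → X) (hf : ∀ s t, ρ (f s) (f t) = ENNReal.ofReal |(s : ℝ) - t|)
    (s t : Set.Icc α β) : lipDist ρ (f s) (f t) ≤ ρ (f s) (f t) := by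
  have key : ∀ s t : Set.Icc α β, s ≤ t → lipDist ρ (f s) (f t) ≤ ρ (f s) (f t) := by
    intro s t hst
    have hst' : (s : ℝ) ≤ t := hst
    have hαβ : α ≤ β := s.2.1.trans s.2.2
    have hL : ((Real.toNNReal (t - s) : ℝ≥0) : ℝ) = t - s := Real.coe_toNNReal _ (by linarith)
    have : IsArc ρ (f s) (f t) (Real.toNNReal (t - s)) := by
      refine ⟨fun r => f (Set.projIcc α β hαβ (s + r)), ?_, ?_, fun a b ha hab hb => ?_⟩
      · simp
      · simp only [hL, add_sub_cancel]
        rw [Set.projIcc_val]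
      · rw [hL] at hb
        have h1 := s.2
        have h2 := t.2
        rw [hf, Set.projIcc_of_mem hαβ (show (s : ℝ) + a ∈ Set.Icc α β from
          ⟨by linarith [h1.1], by linarith [h2.2]⟩), Set.projIcc_of_mem hαβ
          (show (s : ℝ) + b ∈ Set.Icc α β from ⟨by linarith [h1.1], by linarith [h2.2]⟩),
          add_sub_add_left_eq_sub, abs_sub_comm, abs_of_nonneg (by linarith)]
    refine this.lipDist_le.trans (le_of_eq ?_)
    rw [hf, abs_sub_comm, abs_of_nonneg (by linarith)]
    rfl
  rcases le_total s t with h | h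
  · exact key s t h
  · rw [lipDist_symm hρ, hρ.symm]
    exact key t s h

theorem yDist_eq (x y : ySet) : yDist x y = ENNReal.ofReal (dist (x : LInf) y) :=
  edist_dist (x : LInf) y

theorem lipDist_le_of_segA {k : ℕ+} (hk : 2 ≤ k) {x y : ySet} (hx : x ∈ segA k)
    (hy : y ∈ segA k) : lipDist yDist x y ≤ yDist x y := by
  obtain ⟨x, hx'⟩ := x
  obtain ⟨y, hy'⟩ := y
  obtain ⟨s, hs, rfl⟩ := hx
  obtain ⟨t, ht, rfl⟩ := hy
  exact lipDist_le_of_interval yDist_isPseudo (α := 0) (β := 1)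
    (fun s => (⟨pt k 1 s, S_subset_ySet hk (Or.inl (Or.inl ⟨s, s.2, rfl⟩))⟩ : ySet))
    (fun s t => by rw [yDist_eq, dist_pt_right]) ⟨s, hs⟩ ⟨t, ht⟩

theorem lipDist_le_of_segB {k : ℕ+} (hk : 2 ≤ k) {x y : ySet} (hx : x ∈ segB k)
    (hy : y ∈ segB k) : lipDist yDist x y ≤ yDist x y := by
  obtain ⟨x, hx'⟩ := x
  obtain ⟨y, hy'⟩ := y
  obtain ⟨s, hs, rfl⟩ := hx
  obtain ⟨t, ht, rfl⟩ := hy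
  exact lipDist_le_of_interval yDist_isPseudo (α := 1 / (k : ℝ)) (β := 1)
    (fun s => (⟨pt k s 1, S_subset_ySet hk (Or.inl (Or.inr ⟨s, s.2, rfl⟩))⟩ : ySet))
    (fun s t => by rw [yDist_eq, dist_pt_left]) ⟨s, hs⟩ ⟨t, ht⟩

theorem lipDist_le_of_segC {k : ℕ+} (hk : 2 ≤ k) {x y : ySet} (hx : x ∈ segC k)
    (hy : y ∈ segC k) : lipDist yDist x y ≤ yDist x y := by
  obtain ⟨x, hx'⟩ := x
  obtain ⟨y, hy'⟩ := y
  obtain ⟨s, hs, rfl⟩ := hx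
  obtain ⟨t, ht, rfl⟩ := hy
  exact lipDist_le_of_interval yDist_isPseudo (α := 0) (β := 1)
    (fun s => (⟨pt k (1 / k) s, S_subset_ySet hk (Or.inr ⟨s, s.2, rfl⟩)⟩ : ySet))
    (fun s t => by rw [yDist_eq, dist_pt_right]) ⟨s, hs⟩ ⟨t, ht⟩

/-! ### The space `Y₁`: comparison of `d₀` with the length of arcs -/

theorem p_notMem_S {k : ℕ+} (hk : 2 ≤ k) : (yP : LInf) ∉ S k := by
  have hk1 := ne_one_of_two_le hk
  have hk2 := inv_pos_and_le_half hk
  have h0 : ∀ s t : ℝ, (yP : LInf) = pt k s t → s = 0 := fun s t h => by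
    rw [← pt_apply_one hk1 s t, ← h]; rfl
  rw [mem_S_iff]
  rintro (⟨t, ht, h⟩ | ⟨t, ht, h⟩ | ⟨t, ht, h⟩) <;> have := h0 _ _ h <;> linarith [ht.1]

theorem q_mem_segA (k : ℕ+) : yQ ∈ segA k :=
  ⟨0, by simp, (pt_zero_right k 1).symm⟩

theorem q_mem_S (k : ℕ+) : (yQ : LInf) ∈ S k := mem_S_iff.2 (Or.inl (q_mem_segA k))

section
variable {k : ℕ+} (hk : 2 ≤ k)

theorem cornerAB_mem_segA : cornerAB hk ∈ segA k := ⟨1, by simp, rfl⟩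

theorem cornerAB_mem_segB : cornerAB hk ∈ segB k :=
  ⟨1, ⟨by linarith [(inv_pos_and_le_half hk).2], le_rfl⟩, rfl⟩

theorem cornerBC_mem_segB : cornerBC hk ∈ segB k :=
  ⟨1 / k, ⟨le_rfl, by linarith [(inv_pos_and_le_half hk).2]⟩, rfl⟩

theorem cornerBC_mem_segC : cornerBC hk ∈ segC k := ⟨1, by simp, rfl⟩

end

/-- An inequality `d̄ ≤ d₀` passes through a cut point. -/
theorem lipDist_le_zeroDist_of_cut {x y w : ySet}
    (hcut : zeroDist yDist x w + zeroDist yDist w y ≤ zeroDist yDist x y)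
    (hx : lipDist yDist x w ≤ zeroDist yDist x w)
    (hy : lipDist yDist w y ≤ zeroDist yDist w y) :
    lipDist yDist x y ≤ zeroDist yDist x y :=
  (lipDist_triangle yDist_isPseudo x w y).trans ((add_le_add hx hy).trans hcut)

theorem lipDist_le_zeroDist_symm {x y : ySet}
    (h : lipDist yDist x y ≤ zeroDist yDist x y) :
    lipDist yDist y x ≤ zeroDist yDist y x := by
  rwa [lipDist_symm yDist_isPseudo y x, yDist_isPseudo.zeroDist.symm y x]

theorem lipDist_le_zeroDist_of_segBC {k : ℕ+} (hk : 2 ≤ k) {x y : ySet}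
    (hx : x ∈ segB k ∨ x ∈ segC k) (hy : y ∈ segB k ∨ y ∈ segC k) :
    lipDist yDist x y ≤ zeroDist yDist x y := by
  have hB {x y : ySet} (hx : x ∈ segB k) (hy : y ∈ segB k) :
      lipDist yDist x y ≤ zeroDist yDist x y :=
    (lipDist_le_of_segB hk hx hy).trans (yDist_isPseudo.le_zeroDist x y)
  have hC {x y : ySet} (hx : x ∈ segC k) (hy : y ∈ segC k) :
      lipDist yDist x y ≤ zeroDist yDist x y :=
    (lipDist_le_of_segC hk hx hy).trans (yDist_isPseudo.le_zeroDist x y)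
  have hCB {x y : ySet} (hx : x ∈ segC k) (hy' : y ∉ segC k) (hy : y ∈ segB k) :
      lipDist yDist x y ≤ zeroDist yDist x y :=
    lipDist_le_zeroDist_of_cut (cut_cornerBC hk hx hy') (hC hx (cornerBC_mem_segC hk))
      (hB (cornerBC_mem_segB hk) hy)
  by_cases hx' : x ∈ segC k <;> by_cases hy' : y ∈ segC k
  · exact hC hx' hy'
  · exact hCB hx' hy' (hy.resolve_right hy')
  · exact lipDist_le_zeroDist_symm (hCB hy' hx' (hx.resolve_right hx'))
  · exact hB (hx.resolve_right hx') (hy.resolve_right hy')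

theorem lipDist_le_zeroDist_of_mem_S {k : ℕ+} (hk : 2 ≤ k) {x y : ySet} (hx : (x : LInf) ∈ S k)
    (hy : (y : LInf) ∈ S k) : lipDist yDist x y ≤ zeroDist yDist x y := by
  rw [mem_S_iff] at hx hy
  have hA {x y : ySet} (hx : x ∈ segA k) (hy : y ∈ segA k) :
      lipDist yDist x y ≤ zeroDist yDist x y :=
    (lipDist_le_of_segA hk hx hy).trans (yDist_isPseudo.le_zeroDist x y)
  have hBA {x y : ySet} (hx : x ∈ segB k ∨ x ∈ segC k) (hy' : ¬ (y ∈ segB k ∨ y ∈ segC k))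
      (hy : y ∈ segA k) : lipDist yDist x y ≤ zeroDist yDist x y :=
    lipDist_le_zeroDist_of_cut (cut_cornerAB hk hx hy')
      (lipDist_le_zeroDist_of_segBC hk hx (Or.inl (cornerAB_mem_segB hk)))
      (hA (cornerAB_mem_segA hk) hy)
  by_cases hx' : x ∈ segB k ∨ x ∈ segC k <;> by_cases hy' : y ∈ segB k ∨ y ∈ segC k
  · exact lipDist_le_zeroDist_of_segBC hk hx' hy'
  · exact hBA hx' hy' (hy.resolve_right hy')
  · exact lipDist_le_zeroDist_symm (hBA hy' hx' (hx.resolve_right hx'))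
  · exact hA (hx.resolve_right hx') (hy.resolve_right hy')

theorem yDist_lipDist_le_zeroDist {x y : ySet} (hx : x ≠ yP) (hy : y ≠ yP) :
    lipDist yDist x y ≤ zeroDist yDist x y := by
  obtain ⟨k, hk, hxk⟩ := exists_mem_S hx
  obtain ⟨l, hl, hyl⟩ := exists_mem_S hy
  by_cases hyk : (y : LInf) ∈ S k
  · exact lipDist_le_zeroDist_of_mem_S hk hxk hyk
  · exact lipDist_le_zeroDist_of_cut (cut_q hk hxk hyk)
      (lipDist_le_zeroDist_of_mem_S hk hxk (q_mem_S k))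
      (lipDist_le_zeroDist_of_mem_S hl (q_mem_S l) hyl)

/-! ### The space `Y₁`: the distance `d₀(p, q) = 3` -/

theorem yDist_zeroDist_p_q_le : zeroDist yDist yP yQ ≤ 3 := by
  refine zeroDist_le fun ε hε => ?_
  obtain ⟨n, hn⟩ := exists_nat_one_div_lt (show (0 : ℝ) < ε from hε)
  obtain ⟨k, hk, hkε⟩ : ∃ k : ℕ+, 2 ≤ k ∧ 1 / (k : ℝ) ≤ ε := by
    refine ⟨⟨n + 2, by omega⟩, PNat.coe_le_coe _ _ |>.1 (by simp), le_trans ?_ hn.le⟩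
    simp only [PNat.mk_coe]
    push_cast
    exact one_div_le_one_div_of_le (by positivity) (by linarith)
  have hk2 := inv_pos_and_le_half hk
  let c : ySet := ⟨pt k (1 / k) 0, S_subset_ySet hk (Or.inr ⟨0, by simp, rfl⟩)⟩
  have hc : c ∈ segC k := ⟨0, by simp, rfl⟩
  have h1 : yDist yP c = ENNReal.ofReal (1 / k) := by
    rw [yDist_eq]
    have : (yP : LInf) = pt k 0 0 := by simp [pt]; rfl
    rw [this, dist_pt_left, zero_sub, abs_neg, abs_of_pos hk2.1]
  have h2 : yDist c (cornerBC hk) = ENNReal.ofReal 1 := by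
    rw [yDist_eq]
    change ENNReal.ofReal (dist (pt k (1 / k) 0) (pt k (1 / k) 1)) = _
    rw [dist_pt_right]
    norm_num
  have h3 : yDist (cornerBC hk) (cornerAB hk) = ENNReal.ofReal (1 - 1 / k) := by
    rw [yDist_eq]
    change ENNReal.ofReal (dist (pt k (1 / k) 1) (pt k 1 1)) = _
    rw [dist_pt_left, abs_sub_comm, abs_of_nonneg (by linarith)]
  have h4 : yDist (cornerAB hk) yQ = ENNReal.ofReal 1 := by
    rw [yDist_eq]
    change ENNReal.ofReal (dist (pt k 1 1) (lp.single ∞ (1 : ℕ+) (1 : ℝ))) = _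
    rw [← pt_zero_right k, dist_pt_right]
    norm_num
  have h5 : lipDist yDist c yQ ≤
      yDist c (cornerBC hk) + yDist (cornerBC hk) (cornerAB hk) + yDist (cornerAB hk) yQ := by
    refine (lipDist_triangle yDist_isPseudo _ (cornerAB hk) _).trans (add_le_add
      ((lipDist_triangle yDist_isPseudo _ (cornerBC hk) _).trans (add_le_add ?_ ?_)) ?_)
    · exact lipDist_le_of_segC hk hc (cornerBC_mem_segC hk)
    · exact lipDist_le_of_segB hk (cornerBC_mem_segB hk) (cornerAB_mem_segB hk)
    · exact lipDist_le_of_segA hk (cornerAB_mem_segA hk) (q_mem_segA k)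
  rw [h2, h3, h4] at h5
  have h6 : yDist yP c ≤ ε := by
    rw [h1]
    exact ENNReal.ofReal_le_of_le_toReal (by simpa using hkε)
  calc epsDist yDist ε yP yQ
      ≤ epsDist yDist ε yP c + epsDist yDist ε c yQ :=
        epsDist_triangle _ _ _ _ _
    _ ≤ ENNReal.ofReal (1 / k) +
        (ENNReal.ofReal 1 + ENNReal.ofReal (1 - 1 / k) + ENNReal.ofReal 1) :=
        add_le_add ((epsDist_le_of_le h6).trans h1.le) ((epsDist_le_zeroDist hε _ _).trans
          ((iterDist_le_lipDist yDist_isPseudo 1 _ _).trans h5))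
    _ = ENNReal.ofReal 3 := by
        rw [← ENNReal.ofReal_add zero_le_one (by linarith),
          ← ENNReal.ofReal_add (by linarith) zero_le_one,
          ← ENNReal.ofReal_add hk2.1.le (by linarith)]
        congr 1; ring
    _ = 3 := by simp

/-- The identity of `[0, 1]`, flattened near both ends: it is `0` on `[0, ε]` and `1 - 2ε` on
`[1 - ε, 1]`. -/
def clamp (ε s : ℝ) : ℝ := max 0 (min s (1 - ε) - ε)

theorem clamp_of_le {ε s : ℝ} (h : s ≤ ε) : clamp ε s = 0 :=
  max_eq_left (by linarith [min_le_left s (1 - ε)])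

theorem clamp_of_ge {ε s : ℝ} (hε : ε ≤ 1 / 2) (h : 1 - ε ≤ s) : clamp ε s = 1 - 2 * ε := by
  rw [clamp, min_eq_right h, max_eq_right (by linarith)]; ring

theorem clamp_sub_le {ε s t d : ℝ} (h : |s - t| ≤ d) : clamp ε t - clamp ε s ≤ d := by
  have h' := abs_le.1 h
  have h1 : min t (1 - ε) ≤ min s (1 - ε) + d := by
    rcases le_total s (1 - ε) with hs | hs
    · rw [min_eq_left hs]; linarith [min_le_left t (1 - ε)]
    · rw [min_eq_right hs]; linarith [min_le_right t (1 - ε)]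
  have h2 := le_max_left 0 (min s (1 - ε) - ε)
  have h3 := le_max_right 0 (min s (1 - ε) - ε)
  rw [sub_le_iff_le_add]
  exact max_le (by unfold clamp; linarith) (by unfold clamp; linarith)

/-- A function of the first coordinate `a` and of the norm `s` of the remaining ones, which increases
by almost `3` along the way from `p` by any broken line to `q`. Being flattened at the corners and
at the ends, it does not exceed the distance on small steps. -/
def potential (ε a s : ℝ) : ℝ := if a = 1 then 3 - 4 * ε - clamp ε s else a + clamp ε s

/-- What is needed of the coordinates of a point `pt k a s` of `Y₁`: it lies on one of the three
segments of `S_k`, or is `p`. -/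
def IsCoord (k : ℕ+) (a s : ℝ) : Prop :=
  2 ≤ k ∧ 0 ≤ s ∧ (a = 1 ∨ (s = 1 ∧ 0 ≤ a) ∨ a = 1 / k ∨ (a = 0 ∧ s = 0))

theorem exists_isCoord (x : ySet) : ∃ k a s, IsCoord k a s ∧ (x : LInf) = pt k a s := by
  by_cases hx : x = yP
  · refine ⟨2, 0, 0, ⟨le_rfl, le_rfl, by simp⟩, ?_⟩
    rw [hx]; simp [pt]; rfl
  · obtain ⟨k, hk, hxk⟩ := exists_mem_S hx
    have := (inv_pos_and_le_half hk).1
    rcases mem_S_iff.1 hxk with ⟨t, ht, h⟩ | ⟨t, ht, h⟩ | ⟨t, ht, h⟩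
    · exact ⟨k, 1, t, ⟨hk, ht.1, Or.inl rfl⟩, h⟩
    · exact ⟨k, t, 1, ⟨hk, zero_le_one, Or.inr (Or.inl ⟨rfl, this.le.trans ht.1⟩)⟩, h⟩
    · exact ⟨k, 1 / k, t, ⟨hk, ht.1, by simp⟩, h⟩

theorem IsCoord.dist_bounds {k l : ℕ+} {a b s t d : ℝ} (hx : IsCoord k a s) (hy : IsCoord l b t)
    (hd : dist (pt k a s) (pt l b t) ≤ d) :
    |a - b| ≤ d ∧ |s - t| ≤ d ∧ (k = l ∨ (s ≤ d ∧ t ≤ d)) := by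
  have hk1 := ne_one_of_two_le hx.1
  have hl1 := ne_one_of_two_le hy.1
  have h1 := (abs_apply_sub_le _ _ 1).trans hd
  have hk := (abs_apply_sub_le _ _ k).trans hd
  have hl := (abs_apply_sub_le _ _ l).trans hd
  rw [pt_apply_one hk1, pt_apply_one hl1] at h1
  refine ⟨h1, ?_⟩
  by_cases hkl : k = l
  · subst hkl
    rw [pt_apply_self hk1, pt_apply_self hk1] at hk
    exact ⟨hk, Or.inl rfl⟩
  · rw [pt_apply_self hk1, pt_apply_of_ne hk1 hkl] at hk
    rw [pt_apply_self hl1, pt_apply_of_ne hl1 (Ne.symm hkl)] at hl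
    have hk := abs_le.1 hk
    have hl := abs_le.1 hl
    have := hx.2.1
    have := hy.2.1
    exact ⟨abs_le.2 ⟨by linarith, by linarith⟩, Or.inr ⟨by linarith, by linarith⟩⟩

theorem IsCoord.potential_sub_le {k l : ℕ+} {a b s t d ε : ℝ} (hx : IsCoord k a s)
    (hy : IsCoord l b t) (hε : ε ≤ 1 / 8) (hdε : d ≤ ε)
    (hd : dist (pt k a s) (pt l b t) ≤ d) : potential ε b t - potential ε a s ≤ d := by
  obtain ⟨hab, hst, hkl⟩ := hx.dist_bounds hy hd
  have hab' := abs_le.1 hab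
  have hst' := abs_le.1 hst
  have hC := clamp_sub_le (ε := ε) hst
  have hC' := clamp_sub_le (ε := ε) ((abs_sub_comm t s).trans_le hst)
  have hx0 := hx.2.1
  have hy0 := hy.2.1
  have hk2 := inv_pos_and_le_half hx.1
  have hl2 := inv_pos_and_le_half hy.1
  -- the two plateaus of `clamp`
  have big : ∀ r, 1 - ε ≤ r → clamp ε r = 1 - 2 * ε := fun r hr => clamp_of_ge (by linarith) hr
  have small : ∀ r, r ≤ ε → clamp ε r = 0 := fun r hr => clamp_of_le hr
  unfold potential
  obtain ⟨hk, -, hx⟩ := hx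
  obtain ⟨hl, -, hy⟩ := hy
  by_cases ha : a = 1 <;> by_cases hb : b = 1
  · simp only [ha, hb, if_true]; linarith
  · rcases hy.resolve_left hb with h | h | h
    · rw [if_pos ha, if_neg hb, big s (by linarith), big t (by linarith)]; linarith
    · exfalso; linarith
    · exfalso; linarith
  · rcases hx.resolve_left ha with h | h | h
    · rw [if_neg ha, if_pos hb, big s (by linarith), big t (by linarith)]; linarith
    · exfalso; linarith
    · exfalso; linarith
  · rw [if_neg ha, if_neg hb]
    -- either the first coordinates agree, or the contributions of the others do
    have key : a = b ∨ clamp ε s = clamp ε t := by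
      have large (h : 1 - ε ≤ s ∧ 1 - ε ≤ t) : clamp ε s = clamp ε t := by
        rw [big s h.1, big t h.2]
      have little (h : s ≤ ε ∧ t ≤ ε) : clamp ε s = clamp ε t := by
        rw [small s h.1, small t h.2]
      rcases hx.resolve_left ha with ⟨h, -⟩ | h | ⟨-, h⟩
      · exact Or.inr (large ⟨by linarith, by linarith⟩)
      · rcases hy.resolve_left hb with ⟨h', -⟩ | h' | ⟨-, h'⟩
        · exact Or.inr (large ⟨by linarith, by linarith⟩)
        · rcases hkl with rfl | hkl
          · exact Or.inl (h.trans h'.symm)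
          · exact Or.inr (little ⟨by linarith, by linarith⟩)
        · exact Or.inr (little ⟨by linarith, by linarith⟩)
      · exact Or.inr (little ⟨by linarith, by linarith⟩)
    rcases key with h | h
    · linarith
    · linarith

theorem three_le_yDist_zeroDist_p_q : 3 ≤ zeroDist yDist yP yQ := by
  have key : ∀ ε : ℝ, 0 < ε → ε ≤ 1 / 8 →
      ENNReal.ofReal (3 - 4 * ε) ≤ zeroDist yDist yP yQ := by
    intro ε hε hε8
    let T : ySet → ℝ := fun x => ‖(x : LInf) - lp.single ∞ (1 : ℕ+) ((x : LInf) 1)‖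
    let f : ySet → ℝ := fun x => potential ε ((x : LInf) 1) (T x)
    have hf : ∀ (x : ySet) k a s, IsCoord k a s → (x : LInf) = pt k a s → f x = potential ε a s := by
      intro x k a s h hx
      simp only [f, T, hx, pt_apply_one (ne_one_of_two_le h.1)]
      rw [pt, add_sub_cancel_left, lp.norm_single ENNReal.zero_lt_top, Real.norm_eq_abs,
        abs_of_nonneg h.2.1]
    have hp : f yP = 0 := by
      rw [hf _ 2 0 0 ⟨le_rfl, le_rfl, by simp⟩ (by simp [pt]; rfl), potential, if_neg zero_ne_one,
        clamp_of_le hε.le, add_zero]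
    have hq : f yQ = 3 - 4 * ε := by
      rw [hf _ 2 1 0 ⟨le_rfl, le_rfl, by simp⟩ (pt_zero_right 2 1).symm, potential, if_pos rfl,
        clamp_of_le hε.le, sub_zero]
    have := le_zeroDist_of_local (ρ := yDist) (F := fun x y => ENNReal.ofReal (f y - f x))
      (fun x => by simp) (fun x y z => ?_) ⟨⟨ε, hε.le⟩, hε, fun u v huv => ?_⟩ yP yQ
    · simpa only [hp, hq, sub_zero] using this
    · refine le_trans (ENNReal.ofReal_le_ofReal (le_of_eq ?_)) ENNReal.ofReal_add_le
      ring
    · obtain ⟨k, a, s, hu, hu'⟩ := exists_isCoord u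
      obtain ⟨l, b, t, hv, hv'⟩ := exists_isCoord v
      simp only [hf u k a s hu hu', hf v l b t hv hv']
      rw [yDist_eq, hu', hv'] at huv ⊢
      refine ENNReal.ofReal_le_ofReal (hu.potential_sub_le hv hε8 ?_ le_rfl)
      exact (ENNReal.ofReal_le_iff_le_toReal ENNReal.coe_ne_top).1 huv
  refine ENNReal.le_of_forall_pos_le_add fun η hη _ => ?_
  have hη' : (0 : ℝ) < η := hη
  have h1 := key (min (η / 4) (1 / 8)) (by positivity) (min_le_right _ _)
  calc (3 : ℝ≥0∞) = ENNReal.ofReal 3 := by simp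
    _ ≤ ENNReal.ofReal ((3 - 4 * min ((η : ℝ) / 4) (1 / 8)) + η) :=
        ENNReal.ofReal_le_ofReal (by linarith [min_le_left ((η : ℝ) / 4) (1 / 8)])
    _ ≤ ENNReal.ofReal (3 - 4 * min ((η : ℝ) / 4) (1 / 8)) + ENNReal.ofReal η :=
        ENNReal.ofReal_add_le
    _ ≤ _ := add_le_add h1 (by simp)

/-! ### The space `Y₁`: completeness -/

theorem isCompact_S (k : ℕ+) : IsCompact (S k) := by
  have hr : ∀ a : ℝ, Continuous fun t : ℝ => pt k a t := fun a =>
    (LipschitzWith.of_dist_le_mul (K := 1) fun s t => by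
      rw [dist_pt_right, NNReal.coe_one, one_mul, Real.dist_eq]).continuous
  have hl : ∀ a : ℝ, Continuous fun t : ℝ => pt k t a := fun a =>
    (LipschitzWith.of_dist_le_mul (K := 1) fun s t => by
      rw [dist_pt_left, NNReal.coe_one, one_mul, Real.dist_eq]).continuous
  have himg : ∀ (f : ℝ → LInf) (I : Set ℝ), {x | ∃ t ∈ I, x = f t} = f '' I := fun f I => by
    ext x; simp [eq_comm]
  unfold S
  rw [himg (pt k 1), himg (fun t => pt k t 1), himg (pt k (1 / k))]
  exact ((isCompact_Icc.image (hr 1)).union (isCompact_Icc.image (hl 1))).union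
    (isCompact_Icc.image (hr _))

/-- Away from `p` and `q` the broken lines are uniformly separated. -/
theorem mem_S_of_far {k : ℕ+} (hk : 2 ≤ k) {u v : ySet} (hu : (u : LInf) ∈ S k) {δ : ℝ}
    (hδ : 0 < δ) (hδ1 : δ ≤ 1) (hp : δ ≤ dist u yP) (hq : δ ≤ dist u yQ)
    (huv : dist u v < δ ^ 2 / 16) : (v : LInf) ∈ S k := by
  by_contra hv
  have hk1 := ne_one_of_two_le hk
  have hδ2 : δ ^ 2 / 16 < δ / 2 := by nlinarith
  have hQ : ∀ s, dist (pt k 1 s) (yQ : LInf) = |s| := fun s => by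
    change dist (pt k 1 s) (lp.single ∞ (1 : ℕ+) (1 : ℝ)) = _
    rw [← pt_zero_right k, dist_pt_right, sub_zero]
  by_cases hks : δ ^ 2 / 16 ≤ lineScale k
  · obtain ⟨s, -, -, hs, hs', hu', -⟩ := near_q hk hu v.2 hv hks huv.le
    rw [Subtype.dist_eq, hu', hQ, abs_of_nonneg hs] at hq
    linarith
  · -- the last segment of `S_k` starts close to `p`, so the `k`-th coordinate of `u` is large
    have hkδ : 1 / (k : ℝ) < δ / 2 := by
      by_contra! h
      have h1 : (1 : ℝ) ≤ k := by exact_mod_cast k.2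
      have h2 : δ / 4 ≤ 1 / ((k : ℝ) + 1) := by
        rw [le_div_iff₀ (by positivity)] at h ⊢
        nlinarith
      refine hks ?_
      calc δ ^ 2 / 16 = 1 / 2 * (δ / 2 * (δ / 4)) := by ring
        _ ≤ 1 / 2 * (1 / k * (1 / ((k : ℝ) + 1))) := by gcongr
        _ = lineScale k := by unfold lineScale; field_simp
    have hu' : δ / 2 ≤ (u : LInf) k := by
      rcases mem_S_iff.1 hu with ⟨s, hs, h⟩ | ⟨s, hs, h⟩ | ⟨s, hs, h⟩
      · rw [Subtype.dist_eq, h, hQ, abs_of_nonneg hs.1] at hq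
        rw [h, pt_apply_self hk1]
        linarith
      · rw [h, pt_apply_self hk1]
        linarith
      · rw [h, pt_apply_self hk1]
        rw [Subtype.dist_eq, h] at hp
        have := dist_triangle (pt k (1 / k) s) (pt k 0 s) (pt k 0 0)
        rw [dist_pt_left, dist_pt_right, sub_zero, sub_zero, abs_of_nonneg hs.1,
          abs_of_pos (inv_pos_and_le_half hk).1] at this
        have h0 : (yP : LInf) = pt k 0 0 := by simp [pt]; rfl
        rw [← h0] at this
        linarith
    have hv' : (v : LInf) k = 0 := by
      by_cases h : v = yP
      · rw [h]; rfl
      · obtain ⟨l, hl, hvl⟩ := exists_mem_S h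
        have hkl : k ≠ l := by rintro rfl; exact hv hvl
        rcases mem_S_iff.1 hvl with ⟨s, hs, h⟩ | ⟨s, hs, h⟩ | ⟨s, hs, h⟩ <;>
          rw [h, pt_apply_of_ne hk1 hkl]
    have := (abs_le.1 (abs_apply_sub_le (u : LInf) v k)).2
    rw [hv', ← Subtype.dist_eq] at this
    linarith

theorem yDist_isComplete : IsComplete yDist := by
  refine isComplete_of_far yDist_isPseudo yP yQ fun u δ hδ hu hp hq _ => ?_
  obtain ⟨r, hr, hrδ⟩ : ∃ r : ℝ, 0 < r ∧ ENNReal.ofReal r ≤ min δ 1 := by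
    refine ⟨(min δ 1).toReal, ENNReal.toReal_pos (lt_min hδ one_pos).ne' ?_,
      ENNReal.ofReal_toReal_le⟩
    exact (min_le_right _ _).trans_lt ENNReal.one_lt_top |>.ne
  have hr1 : r ≤ 1 := by
    simpa using hrδ.trans (min_le_right _ _)
  have hfar : ∀ i, ∀ w : ySet, δ ≤ yDist (u i) w → r ≤ dist (u i) w := fun i w h => by
    rw [yDist_eq] at h
    exact (ENNReal.ofReal_le_ofReal_iff dist_nonneg).1 ((hrδ.trans (min_le_left _ _)).trans h)
  have hcau : CauchySeq u := EMetric.cauchySeq_iff.2 fun ε hε => by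
    obtain ⟨N, hN⟩ := hu ε hε
    exact ⟨N, fun i hi j hj => hN i hi j hj⟩
  obtain ⟨N, hN⟩ := Metric.cauchySeq_iff'.1 hcau (r ^ 2 / 16) (by positivity)
  have hNp : u N ≠ yP := fun h => by
    have := hfar N _ (hp N)
    rw [h, dist_self] at this
    linarith
  obtain ⟨k, hk, hNk⟩ := exists_mem_S hNp
  have hS : ∀ i ≥ N, (u i : LInf) ∈ S k := fun i hi =>
    mem_S_of_far hk hNk hr hr1 (hfar N _ (hp N)) (hfar N _ (hq N))
      ((dist_comm _ _).trans_lt (hN i hi))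
  have hcau' : CauchySeq fun i => (u (i + N) : LInf) :=
    (uniformContinuous_subtype_val.comp_cauchySeq hcau).comp_tendsto
      (Filter.tendsto_add_atTop_nat N)
  obtain ⟨x, hx, hlim⟩ := cauchySeq_tendsto_of_isComplete (isCompact_S k).isComplete
    (fun i => hS (i + N) (Nat.le_add_left N i)) hcau'
  refine ⟨⟨x, S_subset_ySet hk hx⟩, fun ε hε M => ?_⟩
  obtain ⟨i, hi⟩ := EMetric.tendsto_atTop.1 hlim ε hε
  exact ⟨max i M + N, (le_max_right i M).trans (Nat.le_add_right _ _), hi _ (le_max_left i M)⟩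

theorem yDist_isMetric : IsMetric yDist where
  finite x y := edist_ne_top (x : LInf) y
  eq_zero_iff _ _ := edist_eq_zero.trans Subtype.ext_iff.symm
  symm := yDist_isPseudo.symm
  triangle := yDist_isPseudo.triangle

theorem stableAt_baseSpace : StableAt baseSpace 1 where
  metric := yDist_isMetric
  complete := yDist_isComplete
  dist_p_q := by
    change yDist yP yQ = 1
    rw [yDist_eq]
    change ENNReal.ofReal (dist (0 : LInf) (lp.single ∞ (1 : ℕ+) (1 : ℝ))) = 1
    rw [dist_zero_left, lp.norm_single ENNReal.zero_lt_top]
    simp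
  iter_p_q_le := yDist_zeroDist_p_q_le
  le_iter_p y hy := by
    change (y : ySet) ≠ yP at hy
    change 3 + lipDist yDist yQ y ≤ zeroDist yDist yP y
    have hQ : yQ ≠ yP := fun h => p_notMem_S (k := 2) le_rfl (h ▸ q_mem_S 2)
    obtain ⟨k, hk, hyk⟩ := exists_mem_S hy
    have := cut_q hk hyk (p_notMem_S hk)
    rw [yDist_isPseudo.zeroDist.symm y yP, yDist_isPseudo.zeroDist.symm yQ yP, add_comm,
      yDist_isPseudo.zeroDist.symm y yQ] at this
    exact (add_le_add three_le_yDist_zeroDist_p_q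
      (yDist_lipDist_le_zeroDist hQ hy)).trans this
  le_iter _ _ hx hy := yDist_lipDist_le_zeroDist hx hy

theorem stableAt_Y (i : ℕ) : StableAt (Y i) (i + 1) := by
  induction i with
  | zero => exact stableAt_baseSpace
  | succ i ih => exact ih.glue

/-! ### The union: points and distances -/

theorem Y_isMetric (i : ℕ) : IsMetric (Y i).d := (stableAt_Y i).metric

theorem Y_isPseudo (i : ℕ) : IsPseudo (Y i).d := (Y_isMetric i).isPseudo

/-- The inclusion of `Y i` in `Y j` for `i ≤ j`. -/
def up {i j : ℕ} (h : i ≤ j) (x : (Y i).carrier) : (Y j).carrier :=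
  Nat.leRecOn (C := fun k => (Y k).carrier) h (fun {k} => incl (Y k)) x

theorem up_self {i : ℕ} (x : (Y i).carrier) : up le_rfl x = x :=
  Nat.leRecOn_self (C := fun k => (Y k).carrier) x

theorem up_succ {i j : ℕ} (h : i ≤ j) (x : (Y i).carrier) :
    up (h.trans j.le_succ) x = incl (Y j) (up h x) :=
  Nat.leRecOn_succ (C := fun k => (Y k).carrier) h x

theorem up_up {i j k : ℕ} (h : i ≤ j) (h' : j ≤ k) (x : (Y i).carrier) :
    up h' (up h x) = up (h.trans h') x :=
  (Nat.leRecOn_trans (C := fun k => (Y k).carrier) h h' x).symm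

theorem dist_up {i j : ℕ} (h : i ≤ j) (x y : (Y i).carrier) :
    (Y j).d (up h x) (up h y) = (Y i).d x y := by
  induction j, h using Nat.le_induction with
  | base => rw [up_self, up_self]
  | succ j h ih =>
    rw [up_succ h, up_succ h, ← ih]
    exact gluedDist_incl (Y_isPseudo j) (stableAt_Y j).dist_p_q _ _

theorem up_injective {i j : ℕ} (h : i ≤ j) : Function.Injective (up h) := fun x y hxy => by
  rw [← (Y_isMetric i).eq_zero_iff, ← dist_up h, hxy, (Y_isMetric j).eq_zero_iff]

theorem toUnion_incl (i : ℕ) (x : (Y i).carrier) :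
    toUnion (i + 1) (incl (Y i) x) = toUnion i x := (Quot.sound (.step i x)).symm

theorem toUnion_up {i j : ℕ} (h : i ≤ j) (x : (Y i).carrier) :
    toUnion j (up h x) = toUnion i x := by
  induction j, h using Nat.le_induction with
  | base => rw [up_self]
  | succ j h ih => rw [up_succ h, toUnion_incl, ih]

theorem up_eq_of_toUnion_eq {i j k : ℕ} (hi : i ≤ k) (hj : j ≤ k) {x : (Y i).carrier}
    {y : (Y j).carrier} (h : toUnion i x = toUnion j y) : up hi x = up hj y := by
  have key : ∀ a b : Σ i : ℕ, (Y i).carrier, Relation.EqvGen UnionRel a b →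
      ∀ (k : ℕ) (ha : a.1 ≤ k) (hb : b.1 ≤ k), up ha a.2 = up hb b.2 := by
    intro a b hab
    induction hab with
    | rel a b h =>
      obtain ⟨i, x⟩ := h
      intro k ha hb
      change up ha x = up hb (incl (Y i) x)
      rw [← up_up i.le_succ hb x, up_succ le_rfl, up_self]
    | refl a => exact fun _ _ _ => rfl
    | symm a b _ ih => exact fun k ha hb => (ih k hb ha).symm
    | trans a b c _ _ ih ih' =>
      intro k ha hc
      refine up_injective (le_max_left k b.1) ?_
      rw [up_up, up_up, ih _ _ (le_max_right k b.1), ih']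
  exact key _ _ (Quot.eqvGen_exact h) k hi hj

theorem toUnion_injective (i : ℕ) : Function.Injective (toUnion i) := fun x y h => by
  simpa only [up_self] using up_eq_of_toUnion_eq le_rfl le_rfl h

theorem unionDist_toUnion (i : ℕ) (x y : (Y i).carrier) :
    unionDist (toUnion i x) (toUnion i y) = (Y i).d x y := by
  refine le_antisymm (iInf_le_of_le i (iInf_le_of_le x (iInf_le_of_le y
    (iInf_le_of_le ⟨rfl, rfl⟩ le_rfl)))) ?_
  refine le_iInf fun j => le_iInf fun x' => le_iInf fun y' => le_iInf fun ⟨hx, hy⟩ => ?_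
  rw [← dist_up (le_max_left i j), ← dist_up (le_max_right i j),
    up_eq_of_toUnion_eq _ (le_max_left i j) hx, up_eq_of_toUnion_eq _ (le_max_left i j) hy]

/-- `Y i` as a subset of the union. -/
def level (i : ℕ) : Set YUnion := Set.range (toUnion i)

theorem level_mono {i j : ℕ} (h : i ≤ j) : level i ⊆ level j := by
  rintro _ ⟨x, rfl⟩
  exact ⟨up h x, toUnion_up h x⟩

theorem exists_mem_level (a : YUnion) : ∃ i, a ∈ level i := by
  obtain ⟨⟨i, x⟩, rfl⟩ := Quot.exists_rep a
  exact ⟨i, x, rfl⟩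

/-- Any three points of the union belong to some `Y i`. -/
theorem exists_common_level (a b c : YUnion) :
    ∃ i x y z, a = toUnion i x ∧ b = toUnion i y ∧ c = toUnion i z := by
  obtain ⟨i, hi⟩ := exists_mem_level a
  obtain ⟨j, hj⟩ := exists_mem_level b
  obtain ⟨k, hk⟩ := exists_mem_level c
  obtain ⟨x, hx⟩ := level_mono (show i ≤ i + j + k by omega) hi
  obtain ⟨y, hy⟩ := level_mono (show j ≤ i + j + k by omega) hj
  obtain ⟨z, hz⟩ := level_mono (show k ≤ i + j + k by omega) hk
  exact ⟨_, x, y, z, hx.symm, hy.symm, hz.symm⟩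

theorem unionDist_isMetric : IsMetric unionDist where
  finite a b := by
    obtain ⟨i, x, y, -, rfl, rfl, -⟩ := exists_common_level a b b
    rw [unionDist_toUnion]
    exact (Y_isMetric i).finite x y
  eq_zero_iff a b := by
    obtain ⟨i, x, y, -, rfl, rfl, -⟩ := exists_common_level a b b
    rw [unionDist_toUnion, (Y_isMetric i).eq_zero_iff, (toUnion_injective i).eq_iff]
  symm a b := by
    obtain ⟨i, x, y, -, rfl, rfl, -⟩ := exists_common_level a b b
    rw [unionDist_toUnion, unionDist_toUnion, (Y_isMetric i).symm]
  triangle a b c := by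
    obtain ⟨i, x, y, z, rfl, rfl, rfl⟩ := exists_common_level a b c
    simp only [unionDist_toUnion]
    exact (Y_isMetric i).triangle x y z

theorem unionDist_isPseudo : IsPseudo unionDist := unionDist_isMetric.isPseudo

/-- The point `p` of the union. -/
def unionP : YUnion := toUnion 0 (Y 0).p

/-- The point `q` of the union. -/
def unionQ : YUnion := toUnion 0 (Y 0).q

theorem toUnion_p (i : ℕ) : toUnion i (Y i).p = unionP := by
  induction i with
  | zero => rfl
  | succ i ih => exact (toUnion_incl i _).trans ih

theorem toUnion_q (i : ℕ) : toUnion i (Y i).q = unionQ := by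
  induction i with
  | zero => rfl
  | succ i ih => exact (toUnion_incl i _).trans ih

theorem unionDist_p_q : unionDist unionP unionQ = 1 :=
  (unionDist_toUnion 0 _ _).trans (stableAt_Y 0).dist_p_q

theorem exists_incl_of_mem_row_one {X : Bipointed} {u : Glued X} (hu : u ∈ row X 1) :
    ∃ ξ, u = incl X ξ := by
  obtain ⟨i, ξ, rfl⟩ := hu
  refine ⟨ξ, ?_⟩
  rw [incl, show i = ⟨0, Nat.one_pos⟩ from Fin.ext (Nat.lt_one_iff.1 i.2)]

/-- `p` and `q` separate each `Y i` from the rest of the union. -/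
theorem unionDist_separated (i : ℕ) {a b : YUnion} (ha : a ∈ level i) (hb : b ∉ level i) :
    min (unionDist a unionP + unionDist unionP b) (unionDist a unionQ + unionDist unionQ b) ≤
      unionDist a b := by
  classical
  have hex := exists_mem_level b
  -- the first level that contains `b`
  obtain ⟨k, hbk, hbk', hik⟩ : ∃ k, b ∈ level (k + 1) ∧ b ∉ level k ∧ i ≤ k := by
    have hlt : i < Nat.find hex := by
      by_contra! h
      exact hb (level_mono h (Nat.find_spec hex))
    obtain ⟨k, hk⟩ := Nat.exists_eq_add_one_of_ne_zero (Nat.ne_zero_of_lt hlt)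
    refine ⟨k, hk ▸ Nat.find_spec hex, Nat.find_min hex (by omega), by omega⟩
  obtain ⟨x, rfl⟩ := level_mono hik ha
  obtain ⟨v, rfl⟩ : ∃ v : Glued (Y k), toUnion (k + 1) v = b := hbk
  have hv : v ∉ row (Y k) 1 := fun hv => hbk' (by
    obtain ⟨ξ, rfl⟩ := exists_incl_of_mem_row_one hv
    exact ⟨ξ, (toUnion_incl k ξ).symm⟩)
  have h := gluedDist_separated (Y_isPseudo k) (stableAt_Y k).dist_p_q 1 (incl (Y k) x)
    (inCopy_mem_row 1 _ x) v hv
  have hd : ∀ u w : Glued (Y k), gluedDist (Y k) u w =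
      unionDist (toUnion (k + 1) u) (toUnion (k + 1) w) := fun u w =>
    (unionDist_toUnion (k + 1) u w).symm
  simp only [hd, toUnion_incl, toUnion_p, toUnion_q] at h
  exact h

theorem unionDist_isComplete : IsComplete unionDist := by
  refine isComplete_of_far unionDist_isPseudo unionP unionQ fun u δ _ hu hp hq hd => ?_
  obtain ⟨i, hi⟩ := exists_mem_level (u 0)
  have hlevel : ∀ n, u n ∈ level i := by
    intro n
    by_contra hn
    refine absurd (hd 0 n) (not_lt.2 (le_trans (le_min ?_ ?_) (unionDist_separated i hi hn)))
    · exact (hp 0).trans le_self_add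
    · exact (hq 0).trans le_self_add
  choose x hx using hlevel
  obtain ⟨y, hy⟩ := (stableAt_Y i).complete x (by
    intro ε hε
    obtain ⟨N, hN⟩ := hu ε hε
    refine ⟨N, fun m hm n hn => ?_⟩
    rw [← unionDist_toUnion, hx, hx]
    exact hN m hm n hn)
  refine ⟨toUnion i y, fun ε hε N => ?_⟩
  obtain ⟨n, hn, hnN⟩ := ((hy.eventually_lt_const hε).and (Filter.eventually_ge_atTop N)).exists
  exact ⟨n, hnN, by rwa [← hx, unionDist_toUnion]⟩

/-! ### The union: the iterates -/

open Classical in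
/-- The map of the union to `Y i` that fixes `Y i` and takes all other points to `p`. Near `p` it
does not increase distances. -/
def retract (i : ℕ) (a : YUnion) : (Y i).carrier :=
  if h : ∃ x, toUnion i x = a then h.choose else (Y i).p

theorem retract_toUnion (i : ℕ) (x : (Y i).carrier) : retract i (toUnion i x) = x := by
  have h : ∃ y, toUnion i y = toUnion i x := ⟨x, rfl⟩
  rw [retract, dif_pos h]
  exact toUnion_injective i h.choose_spec

theorem retract_of_notMem {i : ℕ} {a : YUnion} (h : a ∉ level i) : retract i a = (Y i).p :=
  dif_neg h

theorem dist_retract_le (i : ℕ) {a b : YUnion} (ha : unionDist unionP a < 1 / 4)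
    (hb : unionDist unionP b < 1 / 4) (hab : unionDist a b < 1 / 4) :
    (Y i).d (retract i a) (retract i b) ≤ unionDist a b := by
  -- a step from `Y i` to its complement cannot pass near `q`
  have cross : ∀ a b, unionDist unionP a < 1 / 4 → unionDist a b < 1 / 4 → a ∈ level i →
      b ∉ level i → (Y i).d (retract i a) (retract i b) ≤ unionDist a b := by
    intro a b ha hab hai hbi
    rw [retract_of_notMem hbi]
    rcases min_le_iff.1 (unionDist_separated i hai hbi) with h | h
    · obtain ⟨x, rfl⟩ := hai
      rw [retract_toUnion, ← unionDist_toUnion, toUnion_p]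
      exact le_self_add.trans h
    · exfalso
      have h1 : (1 : ℝ≥0∞) < 1 / 4 + 1 / 4 :=
        unionDist_p_q.symm.trans_lt <| (unionDist_isPseudo.triangle _ a _).trans_lt
          (ENNReal.add_lt_add ha ((le_self_add.trans h).trans_lt hab))
      have h2 : (1 / 4 + 1 / 4 : ℝ≥0∞) ≤ 1 := by
        rw [← ENNReal.toReal_le_toReal (by simp) (by simp)]
        rw [ENNReal.toReal_add (by simp) (by simp)]
        norm_num
      exact absurd h1 (not_lt.2 h2)
  by_cases hai : a ∈ level i <;> by_cases hbi : b ∈ level i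
  · obtain ⟨x, rfl⟩ := hai
    obtain ⟨y, rfl⟩ := hbi
    rw [retract_toUnion, retract_toUnion, unionDist_toUnion]
  · exact cross a b ha hab hai hbi
  · rw [(Y_isPseudo i).symm, unionDist_isPseudo.symm]
    exact cross b a hb ((unionDist_isPseudo.symm _ _).trans_lt hab) hbi hai
  · rw [retract_of_notMem hai, retract_of_notMem hbi, (Y_isPseudo i).self]
    exact bot_le

/-- In high iterates the points of `Y i` are far from `p`. -/
theorem quarter_le_iterDist_p (i : ℕ) {x : (Y i).carrier} (hx : x ≠ (Y i).p) :
    1 / 4 ≤ iterDist unionDist (i + 1) unionP (toUnion i x) := by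
  by_contra! h
  have := sum_iterDist_le unionDist_isPseudo {()} (fun _ => retract i) 1
    {a | unionDist unionP a < 1 / 4} (σ := (Y i).d) (1 / 4)
    (fun a ha b hb hab => by simpa using dist_retract_le i ha hb hab) (i + 1) (1 / 4) le_rfl
    unionP (toUnion i x) (fun z hz => hz) h
  rw [Finset.sum_singleton, retract_toUnion, ← toUnion_p i, retract_toUnion, toUnion_p i,
    ENNReal.coe_one, one_mul] at this
  have h3 : (3 : ℝ≥0∞) ≤ 1 / 4 :=
    (le_self_add.trans ((stableAt_Y i).le_iter_p x hx)).trans (this.trans h.le)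
  rw [← ENNReal.toReal_le_toReal (by simp) (by simp)] at h3
  norm_num at h3

theorem iterDist_toUnion_le (i k : ℕ) (x y : (Y i).carrier) :
    iterDist unionDist k (toUnion i x) (toUnion i y) ≤ iterDist (Y i).d k x y := by
  have := iterDist_map_le (ρ := unionDist) (Y_isPseudo i) (toUnion i) (K := 1) one_ne_zero
    (fun x y => by rw [ENNReal.coe_one, one_mul, unionDist_toUnion]) k x y
  rwa [ENNReal.coe_one, one_mul] at this

theorem iterDist_union_p_q_le (n : ℕ) : iterDist unionDist n unionP unionQ ≤ 3 := by
  refine (unionDist_isPseudo.iterDist_mono n.le_succ _ _).trans ?_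
  rw [← toUnion_p n, ← toUnion_q n]
  exact (iterDist_toUnion_le n (n + 1) _ _).trans (stableAt_Y n).iter_p_q_le

theorem iterDist_union_lt (n : ℕ) : iterDist unionDist n < iterDist unionDist (n + 1) := by
  refine lt_of_le_of_ne (fun a b => unionDist_isPseudo.iterDist_mono n.le_succ a b) fun h => ?_
  have hS := stableAt_Y n
  -- the point `q` of the first of `13` copies in a row of `Y (n + 1)`; note that `3 / 13 < 1 / 4`
  let z : Glued (Y n) := inCopy (Y n) 13 ⟨0, by decide⟩ (Y n).q
  have hz0 : inCopy (Y n) 13 ⟨0, by decide⟩ (Y n).p = (Y (n + 1)).p := inCopy_zero_p 13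
  have hz : z ≠ (Y (n + 1)).p := by
    intro hz
    have h1 : gluedDist (Y n) (inCopy (Y n) 13 ⟨0, by decide⟩ (Y n).p) z = 0 := by
      rw [hz0, ← hz]
      exact (gluedDist_isPseudo (Y_isPseudo n)).self z
    rw [gluedDist_inCopy (Y_isPseudo n) hS.dist_p_q, hS.dist_p_q] at h1
    simp at h1
  have h1 : iterDist unionDist (n + 1) unionP (toUnion (n + 1) z) ≤ 3 / 13 := by
    rw [← toUnion_p (n + 1), ← hz0]
    exact (iterDist_toUnion_le (n + 1) (n + 1) _ _).trans
      (hS.iterDist_inCopy_p_q_le 13 ⟨0, by decide⟩)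
  have h2 := quarter_le_iterDist_p (n + 1) hz
  rw [iterDist_eq_of_eq_succ h (show n ≤ n + 1 + 1 by omega), h] at h2
  have h3 := h2.trans h1
  rw [← ENNReal.toReal_le_toReal (by simp) (by simp [ENNReal.div_eq_top])] at h3
  norm_num at h3

theorem quarter_le_iSup_iterDist_p {a : YUnion} (ha : a ≠ unionP) :
    1 / 4 ≤ ⨆ n, iterDist unionDist n unionP a := by
  obtain ⟨i, x, rfl⟩ := exists_mem_level a
  refine le_iSup_of_le (i + 1) (quarter_le_iterDist_p i ?_)
  rintro rfl
  exact ha (toUnion_p i)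

/-- `d₀` of the limit of the iterates is still a lower bound for `d̄`; it is infinite between `p`
and `q`, while the iterates are at most `3`. -/
theorem iSup_iterDist_lt_lengthDist :
    (fun a b => ⨆ n, iterDist unionDist n a b) < lengthDist unionDist := by
  have hU := unionDist_isPseudo
  refine Pi.lt_def.2 ⟨fun a b => iSup_le fun n => iterDist_le_lengthDist hU n a b, unionP,
    Pi.lt_def.2 ⟨fun b => iSup_le fun n => iterDist_le_lengthDist hU n _ b, unionQ, ?_⟩⟩
  have htop : lengthDist unionDist unionP unionQ = ∞ := by
    refine top_le_iff.1 (le_lengthDist hU fun γ hγ hfin h0 h1 => ?_)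
    have h := zeroDist_le_arcLength hU hγ hfin (F := fun a b => ⨆ n, iterDist unionDist n a b)
      (fun s t hst => iSup_le fun n => iterDist_le_arcLength hU hγ hfin n hst)
      (unitInterval.nonneg' (t := 1))
    rw [h0, h1] at h
    refine le_trans (top_le_iff.2 ?_) h
    refine zeroDist_eq_top (A := {unionP}) (ε := 1 / 8) (by norm_num) ?_ rfl ?_
    · rintro _ rfl v hv hle
      have := (quarter_le_iSup_iterDist_p hv).trans hle
      rw [← ENNReal.toReal_le_toReal (by simp) (by simp)] at this
      norm_num at this
    · intro h
      have := unionDist_p_q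
      rw [Set.mem_singleton_iff.1 h, hU.self] at this
      exact zero_ne_one this
  rw [htop]
  exact (iSup_le iterDist_union_p_q_le).trans_lt (by simp)

/-! ### The iterates on `Y_n` -/

section
variable {X : Bipointed} {n : ℕ} (hS : StableAt X n)
include hS

theorem StableAt.iterDist_p_eq {y : X.carrier} (hy : y ≠ X.p) :
    iterDist X.d n X.p y = 3 + lengthDist X.d X.q y := by
  have h := hS.metric.isPseudo
  refine le_antisymm (((h.iterDist n).triangle _ X.q _).trans
    (add_le_add hS.iter_p_q_le (iterDist_le_lengthDist h n _ _))) ?_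
  exact (add_le_add le_rfl (lengthDist_le_lipDist _ _ h)).trans (hS.le_iter_p y hy)

theorem StableAt.iterDist_eq {x y : X.carrier} (hx : x ≠ X.p) (hy : y ≠ X.p) :
    iterDist X.d n x y = lengthDist X.d x y :=
  have h := hS.metric.isPseudo
  le_antisymm (iterDist_le_lengthDist h n _ _)
    ((lengthDist_le_lipDist _ _ h).trans (hS.le_iter x y hx hy))

theorem StableAt.iterDist_succ_p_eq_top {y : X.carrier} (hy : y ≠ X.p) :
    iterDist X.d (n + 1) X.p y = ∞ := by
  refine zeroDist_eq_top (A := {X.p}) (ε := 1) one_pos ?_ rfl hy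
  rintro _ rfl v hv hle
  have := (le_self_add.trans (hS.le_iter_p v hv)).trans hle
  norm_num at this

theorem StableAt.iterDist_succ_eq : iterDist X.d (n + 1) = lengthDist X.d := by
  have h := hS.metric.isPseudo
  funext x y
  refine le_antisymm (iterDist_le_lengthDist h _ x y) ?_
  by_cases hxy : x = y
  · rw [hxy]
    exact (lengthDist_le_lipDist y y h).trans ((lipDist_self h y).trans_le bot_le)
  by_cases hx : x = X.p
  · subst hx
    rw [hS.iterDist_succ_p_eq_top (Ne.symm hxy)]
    exact le_top
  by_cases hy : y = X.p
  · subst hy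
    rw [(h.iterDist _).symm, hS.iterDist_succ_p_eq_top hx]
    exact le_top
  · rw [← hS.iterDist_eq hx hy]
    exact h.iterDist_mono n.le_succ x y

theorem StableAt.iterDist_lt_succ {k : ℕ} (hk : k ≤ n) :
    iterDist X.d k < iterDist X.d (k + 1) := by
  have h := hS.metric.isPseudo
  refine lt_of_le_of_ne (fun a b => h.iterDist_mono k.le_succ a b) fun heq => ?_
  have h1 := hS.iterDist_succ_p_eq_top hS.p_ne_q.symm
  rw [iterDist_eq_of_eq_succ heq (hk.trans n.le_succ), ← iterDist_eq_of_eq_succ heq hk] at h1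
  have := hS.iter_p_q_le
  rw [h1] at this
  simp at this

end

end DiscreteLength


end

/-- `Y i` is the space `Y_n` with `n = i + 1`. -/
theorem propositionP :
    (∀ i n : ℕ, n = i + 1 →
      (DiscreteLength.IsMetric (DiscreteLength.Y i).d ∧
        DiscreteLength.IsComplete (DiscreteLength.Y i).d) ∧
      (∀ y : (DiscreteLength.Y i).carrier, y ≠ (DiscreteLength.Y i).p →
        DiscreteLength.iterDist (DiscreteLength.Y i).d n (DiscreteLength.Y i).p y =
          3 + DiscreteLength.lengthDist (DiscreteLength.Y i).d (DiscreteLength.Y i).q y) ∧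
      (∀ x y : (DiscreteLength.Y i).carrier,
        x ≠ (DiscreteLength.Y i).p → y ≠ (DiscreteLength.Y i).p →
          DiscreteLength.iterDist (DiscreteLength.Y i).d n x y =
            DiscreteLength.lengthDist (DiscreteLength.Y i).d x y) ∧
      (∀ k ≤ n, DiscreteLength.iterDist (DiscreteLength.Y i).d k <
        DiscreteLength.iterDist (DiscreteLength.Y i).d (k + 1)) ∧
      DiscreteLength.iterDist (DiscreteLength.Y i).d (n + 1) =
        DiscreteLength.lengthDist (DiscreteLength.Y i).d) ∧
    ((DiscreteLength.IsMetric DiscreteLength.unionDist ∧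
        DiscreteLength.IsComplete DiscreteLength.unionDist) ∧
      (∀ n : ℕ, DiscreteLength.iterDist DiscreteLength.unionDist n <
        DiscreteLength.iterDist DiscreteLength.unionDist (n + 1)) ∧
      ∃ l : DiscreteLength.YUnion → DiscreteLength.YUnion → ℝ≥0∞,
        (∀ x y, Filter.Tendsto (fun n => DiscreteLength.iterDist DiscreteLength.unionDist n x y)
          Filter.atTop (nhds (l x y))) ∧
        l < DiscreteLength.lengthDist DiscreteLength.unionDist) := by
  refine ⟨?_, ⟨DiscreteLength.unionDist_isMetric, DiscreteLength.unionDist_isComplete⟩,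
    DiscreteLength.iterDist_union_lt, _, fun x y => ?_, DiscreteLength.iSup_iterDist_lt_lengthDist⟩
  · rintro i _ rfl
    have hS := DiscreteLength.stableAt_Y i
    exact ⟨⟨hS.metric, hS.complete⟩, fun _ => hS.iterDist_p_eq, fun _ _ => hS.iterDist_eq,
      fun _ => hS.iterDist_lt_succ, hS.iterDist_succ_eq⟩
  · exact tendsto_atTop_iSup fun m n hmn =>
      DiscreteLength.unionDist_isPseudo.iterDist_mono hmn x y
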